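/- Let $K$ be a complete discrete valuation field with normalized valuation $\mathrm{val}:K\twoheadrightarrow\mathbb Z\cup\{+\infty\}$ and uniformizer $\pi$, and let $\omega\in\mathbb R$ be such that two $n\times n$ matrices over $K$ can be multiplied in $O(n^\omega)$ operations in $K$. Let $M\in M_n(K)$, whose $(i,j)$ entry is given at precision $O(\pi^{N_{i,j}})$ with $N_{i,j}\in\mathbb Z$, and let $\lambda_1,\dots,\lambda_s\in K$ be distinct simple eigenvalues of $M$ (each generalized eigenspace has dimension $1$). Write $\chi_M$ for the characteristic polynomial of $M$ and $C=\mathrm{com}(X-M)\in M_n(K[X])$ for the comatrix of $X-M$ (with $\mathrm{com}(A)=\det(A)A^{-1}$ for invertible $A$). The optimal precision on $\lambda_k$ is $O(\pi^{N'_k})$ where, by definition, $$N'_k=\min_{1\le i,j\le n}\bigl(N_{j,i}+\mathrm{val}(C_{i,j}(\lambda_k))-\mathrm{val}(\chi'_M(\lambda_k))\bigr).$$ Let $V=(1,X,\dots,X^{n-1})$ and let $\mathscr C$ be the companion matrix of $\chi_M=a_0+\dots+a_{n-1}X^{n-1}+X^n$ (ones just above the diagonal, last row $(-a_0,\dots,-a_{n-1})$,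 zeros elsewhere). A short form of $C$ is a triple $(\alpha,P,Q)$ with $\alpha\in K[X]$, $P,Q\in \mathrm{GL}_n(K)$, $M=P\mathscr CP^{-1}$, $M^t=Q\mathscr CQ^{-1}$ and $C\equiv\alpha\cdot PV^t\cdot VQ^t \pmod{\chi_M}$; it exists whenever $M$ has a cyclic vector. For every short form $(\alpha,P,Q)$, writing $P_i$, $Q_j$ for the rows of $P$, $Q$ and $V(\lambda)=(1,\lambda,\dots,\lambda^{n-1})$, $$N'_k=\mathrm{val}(\alpha(\lambda_k))-\mathrm{val}(\chi'_M(\lambda_k))+\min_{1\le i,j\le n}\bigl(N_{j,i}+\mathrm{val}(P_iV(\lambda_k)^t)+\mathrm{val}(V(\lambda_k)Q_j^t)\bigr).$$ Given $M$, the $\lambda_k$ and the $N_{i,j}$, all the $N'_k$ ($1\le k\le s$) can be computed in $O\tilde{~}(n^\omega)$ operations in $K$ and $O(n^2s)$ operations with integers. If the $N_{i,j}$ are all equal, they can be computed in $O\tilde{~}(n^\omega)$ operations in $K$ and $O(ns)$ operations with integers. Here $O\tilde{~}(n^\omega)$ means $O(n^\omega\log(n+2)^d)$ for some $d\in\mathbb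 N$; the constants are independent of $n$, $s$ and the inputs. The model is that of (deterministic) algebraic computation trees over $K$, one tree for each $(n,s)$: operations in $K$ are arithmetic operations, zero tests and constants of $K$; operations with integers are addition, subtraction, minimum, comparison and constants; evaluating a valuation counts as one operation of each kind. -/

import Mathlib

noncomputable section

open Polynomial
open scoped WithZero

namespace PadicEigen

/-! ### The valuation -/

section Valuation

variable {K : Type*} [Field K] [Valued K ℤᵐ⁰]

/-- The additive valuation as an integer. The multiplicative valuation `Valued.v x` of a nonzero
`x` is `exp (-val x)`. Only meaningful for `x ≠ 0`. -/
def ord (x : K) : ℤ := -WithZero.log (Valued.v x)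

open Classical in
/-- The additive valuation `val : K → ℤ ∪ {+∞}`. -/
def val (x : K) : WithTop ℤ := if x = 0 then ⊤ else ((ord x : ℤ) : WithTop ℤ)

end Valuation

/-! ### Matrices, eigenvalues, precision -/

section Precision

variable {K : Type*} [Field K] {n : ℕ}

/-- The comatrix of `X - M`, with the convention `com A = det A • A⁻¹` for invertible `A`. -/
def comX (M : Matrix (Fin n) (Fin n) K) : Matrix (Fin n) (Fin n) K[X] :=
  M.charmatrix.adjugate

/-- `lam` is a simple eigenvalue of `M`: its generalized eigenspace has dimension one. -/
def IsSimpleEigenvalue (M : Matrix (Fin n) (Fin n) K) (lam : K) : Prop :=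
  Module.finrank K (Module.End.maxGenEigenspace (Matrix.toLin' M) lam) = 1

/-- `M` has a cyclic vector. -/
def HasCyclicVector (M : Matrix (Fin n) (Fin n) K) : Prop :=
  ∃ c : Fin n → K,
    Submodule.span K (Set.range fun i : ℕ => Matrix.mulVec (M ^ i) c) = ⊤

/-- The companion matrix of `χ_M = a₀ + ⋯ + aₙ₋₁ Xⁿ⁻¹ + Xⁿ`: ones above the diagonal, and last row
`(-a₀, …, -aₙ₋₁)`. -/
def companion (M : Matrix (Fin n) (Fin n) K) : Matrix (Fin n) (Fin n) K :=
  Matrix.of fun i j =>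
    if (i : ℕ) + 1 = n then -M.charpoly.coeff j
    else if (j : ℕ) = i + 1 then 1 else 0

/-- The product of the `i`-th row of `A` with the column `(1, X, …, Xⁿ⁻¹)`. -/
def rowPoly (A : Matrix (Fin n) (Fin n) K) (i : Fin n) : K[X] :=
  ∑ l : Fin n, C (A i l) * X ^ (l : ℕ)

/-- `(α, P, Q)` (together with `χ_M`) is a short form of `com (X - M)`:
`M = P 𝒞 P⁻¹`, `Mᵗ = Q 𝒞 Q⁻¹` with `𝒞` the companion matrix of `χ_M`, and
`com (X - M) = α · P Vᵗ · V Qᵗ` modulo `χ_M`, where `V = (1, X, …, Xⁿ⁻¹)`. -/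
structure IsShortForm (M : Matrix (Fin n) (Fin n) K) (α : K[X])
    (P Q : Matrix (Fin n) (Fin n) K) : Prop where
  isUnit_left : IsUnit P.det
  isUnit_right : IsUnit Q.det
  similar : M = P * companion M * P⁻¹
  similar_transpose : M.transpose = Q * companion M * Q⁻¹
  com_eq : ∀ i j : Fin n, M.charpoly ∣ comX M i j - α * rowPoly P i * rowPoly Q j

variable [Valued K ℤᵐ⁰]

/-- The optimal precision on the simple eigenvalue `lam` of `M` when the `(i,j)` entry of `M` is
known at precision `O(π ^ N i j)`:
`min_{i,j} (N_{j,i} + val (C_{i,j}(lam)) - val (χ'_M(lam)))`, with `C = com (X - M)`. -/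
def eigenPrec (M : Matrix (Fin n) (Fin n) K) (N : Matrix (Fin n) (Fin n) ℤ) (lam : K) :
    WithTop ℤ :=
  Finset.univ.inf fun ij : Fin n × Fin n =>
    ((N ij.2 ij.1 : ℤ) : WithTop ℤ) + val ((comX M ij.1 ij.2).eval lam)
      - val (M.charpoly.derivative.eval lam)

/-- The same precision in terms of a short form `(α, P, Q)`:
`val α(lam) - val χ'_M(lam) + min_{i,j} (N_{j,i} + val (P_i V(lam)ᵗ) + val (V(lam) Q_jᵗ))`. -/
def shortPrec (M : Matrix (Fin n) (Fin n) K) (α : K[X]) (P Q : Matrix (Fin n) (Fin n) K)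
    (N : Matrix (Fin n) (Fin n) ℤ) (lam : K) : WithTop ℤ :=
  val (α.eval lam) - val (M.charpoly.derivative.eval lam) +
    Finset.univ.inf fun ij : Fin n × Fin n =>
      ((N ij.2 ij.1 : ℤ) : WithTop ℤ) + val ((rowPoly P ij.1).eval lam)
        + val ((rowPoly Q ij.2).eval lam)

end Precision

/-! ### The computational model

Algebraic computation trees over `K`, with registers holding elements of `K` (named by `I`) and
registers holding integers (named by `J`). The program of a computation cannot look into a register
except through the instructions below. -/

/-- The arithmetic operations of `K`. -/
inductive FieldOp
  | add | sub | mul | div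

/-- The operations on integers. -/
inductive IntOp
  | add | sub | min

/-- Division by zero returns zero (a zero test could be made before each division). -/
def FieldOp.apply {K : Type*} [Field K] : FieldOp → K → K → K
  | .add, x, y => x + y
  | .sub, x, y => x - y
  | .mul, x, y => x * y
  | .div, x, y => x / y

def IntOp.apply : IntOp → ℤ → ℤ → ℤ
  | .add, a, b => a + b
  | .sub, a, b => a - b
  | .min, a, b => Min.min a b

/-- Computation trees. A leaf carries an output label in `O`, typically the names of the registers
that hold the result. -/
inductive CompTree (K : Type*) (I J O : Type)
  /-- Stop. -/
  | ret (o : O)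
  /-- Write the constant `c` into `dst`. -/
  | const (c : K) (dst : I) (next : CompTree K I J O)
  /-- Write the result of `op` applied to the contents of `x` and `y` into `dst`. -/
  | arith (op : FieldOp) (x y dst : I) (next : CompTree K I J O)
  /-- Branch on whether `x` contains zero. -/
  | ifZero (x : I) (yes no : CompTree K I J O)
  /-- Evaluate the valuation of the content of `x`: branch to `infinite` if it is `+∞`, and
  otherwise write it into the integer register `dst` and go to `finite`. -/
  | valuation (x : I) (dst : J) (infinite finite : CompTree K I J O)
  /-- Write the constant `c` into the integer register `dst`. -/
  | intConst (c : ℤ) (dst : J) (next : CompTree K I J O)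
  /-- Write the result of `op` applied to the contents of `a` and `b` into `dst`. -/
  | intArith (op : IntOp) (a b dst : J) (next : CompTree K I J O)
  /-- Branch on whether the content of `a` is at most that of `b`. -/
  | ifLe (a b : J) (yes no : CompTree K I J O)

/-- The result of running a computation tree: the output label, the final contents of the registers,
and the number of operations in `K` and of operations on integers on the path that was followed. -/
structure Outcome (K : Type*) (I J O : Type) where
  out : O
  reg : I → K
  intReg : J → ℤ
  fieldOps : ℕ
  intOps : ℕ

/-- Charge additional operations. -/
def Outcome.charge {K : Type*} {I J O : Type} (r : Outcome K I J O) (f z : ℕ) :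
    Outcome K I J O :=
  { r with fieldOps := r.fieldOps + f, intOps := r.intOps + z }

open Classical in
/-- Run a computation tree on given register contents. Constants, arithmetic operations and zero
tests in `K` cost one operation in `K`; constants, additions, subtractions, minima and comparisons
of integers cost one operation on integers; the evaluation of a valuation is charged both as one
operation in `K` and as one operation on integers. -/
def CompTree.run {K : Type*} [Field K] [Valued K ℤᵐ⁰] {I J O : Type} :
    CompTree K I J O → (I → K) → (J → ℤ) → Outcome K I J O
  | .ret o, ρ, ζ => ⟨o, ρ, ζ, 0, 0⟩
  | .const c dst t, ρ, ζ => (t.run (Function.update ρ dst c) ζ).charge 1 0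
  | .arith op x y dst t, ρ, ζ =>
      (t.run (Function.update ρ dst (op.apply (ρ x) (ρ y))) ζ).charge 1 0
  | .ifZero x t u, ρ, ζ => (if ρ x = 0 then t.run ρ ζ else u.run ρ ζ).charge 1 0
  | .valuation x dst t u, ρ, ζ =>
      (if ρ x = 0 then t.run ρ ζ else u.run ρ (Function.update ζ dst (ord (ρ x)))).charge 1 1
  | .intConst c dst t, ρ, ζ => (t.run ρ (Function.update ζ dst c)).charge 0 1
  | .intArith op a b dst t, ρ, ζ =>
      (t.run ρ (Function.update ζ dst (op.apply (ζ a) (ζ b)))).charge 0 1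
  | .ifLe a b t u, ρ, ζ => (if ζ a ≤ ζ b then t.run ρ ζ else u.run ρ ζ).charge 0 1

/-! ### The two computational problems -/

section Problems

variable (K : Type*) [Field K] [Valued K ℤᵐ⁰]

/-- Two `n × n` matrices over `K` can be multiplied in `O(n ^ ω)` operations in `K` (and no
operation on integers). The entries of the matrices are in the input registers; the work registers,
indexed by `ℕ`, are initially zero. -/
def MatMulExponent (ω : ℝ) : Prop :=
  ∃ c : ℝ, ∀ n : ℕ, 1 ≤ n →
    ∃ T : CompTree K (((Fin n × Fin n) ⊕ (Fin n × Fin n)) ⊕ ℕ) ℕ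
        (Fin n → Fin n → ((Fin n × Fin n) ⊕ (Fin n × Fin n)) ⊕ ℕ),
      ∀ A B : Matrix (Fin n) (Fin n) K,
        let r := T.run
          (Sum.elim (Sum.elim (fun p => A p.1 p.2) (fun p => B p.1 p.2)) (fun _ => 0))
          (fun _ => 0)
        (∀ i j, r.reg (r.out i j) = (A * B) i j) ∧
          (r.fieldOps : ℝ) ≤ c * (n : ℝ) ^ ω ∧ r.intOps = 0

/-- There is a computation tree which, on input an `n × n` matrix `M` over `K`, precisions `N` in
the set `S`, and `s` distinct simple eigenvalues `lam k` of `M` in `K`, computes the optimal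
precisions on all the `lam k`, with at most `f` operations in `K` and `z` operations on integers.
Its value is the one given by `eigenPrec`, and by `shortPrec` for every short form of
`com (X - M)`. The inputs are the entries of `M`, the `lam k`, and the entries of `N`; the work
registers, indexed by `ℕ`, are initially zero. -/
def EigenPrecComputable (n s : ℕ) (S : Set (Matrix (Fin n) (Fin n) ℤ)) (f z : ℝ) : Prop :=
  ∃ T : CompTree K (((Fin n × Fin n) ⊕ Fin s) ⊕ ℕ) ((Fin n × Fin n) ⊕ ℕ)
      (Fin s → (Fin n × Fin n) ⊕ ℕ),
    ∀ (M : Matrix (Fin n) (Fin n) K) (N : Matrix (Fin n) (Fin n) ℤ) (lam : Fin s → K),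
      N ∈ S → Function.Injective lam → (∀ k, IsSimpleEigenvalue M (lam k)) →
        let r := T.run
          (Sum.elim (Sum.elim (fun p => M p.1 p.2) lam) (fun _ => 0))
          (Sum.elim (fun p => N p.1 p.2) (fun _ => 0))
        (∀ k, ((r.intReg (r.out k) : ℤ) : WithTop ℤ) = eigenPrec M N (lam k) ∧
          ∀ (α : K[X]) (P Q : Matrix (Fin n) (Fin n) K), IsShortForm M α P Q →
            ((r.intReg (r.out k) : ℤ) : WithTop ℤ) = shortPrec M α P Q N (lam k)) ∧
        (r.fieldOps : ℝ) ≤ f ∧ (r.intOps : ℝ) ≤ z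

end Problems

end PadicEigen

end

noncomputable section

open Polynomial
open scoped WithZero

namespace PadicEigen

/-! ### Algorithms as growth of knowledge

A state of knowledge consists of the set of inputs `x : X` that are still possible, and of the
quantities depending on the input whose values have been computed. -/

/-! Let `v` and `w` be eigenvectors of `M` and of its transpose for a simple eigenvalue `λ`. The
columns of `C(λ)` lie on the line of `v`. Differentiating `(X - M) C = χ_M` at `λ` and multiplying
by `w` on the left determines the factors: `w · v ≠ 0` and `C_{ij}(λ) / χ'_M(λ) = v_i w_j / (w · v)`
(`IsSimpleEigenvalue.comX_eval`). The optimal precision therefore depends only on the valuations of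
the `v_i`, the `w_j` and `w · v`. The minimum over pairs takes `O(n²)` operations for each
eigenvalue; for equal precisions it splits into two minima over `n` terms. The formula for a short
form comes from evaluating its congruence at `λ`, a root of `χ_M` (`IsShortForm.shortPrec_eq`).

It remains to compute all the eigenvectors together. Following Keller-Gehrig, one selects a basis of
vectors `M ^ l e_j` by repeatedly doubling the length of the chains and eliminating greedily
(`learns_elim`, `IsKrylovStage.double`). In this basis `M` is block lower triangular with companion
blocks (`IsKrylovStage.isLowerCompanion`). An eigenvector is then given by one coordinate per block,
and these coordinates are found block after block, by a division or by a free choice where the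
characteristic polynomial of the block vanishes (`stepSol`). The contribution of the earlier blocks
is a strictly triangular product whose right factor is discovered along the way; it is computed for
all eigenvalues at once by online multiplication (`learns_online`). The quadratic terms in the cost
are harmless because a product of matrices must read its `n²` entries, whence `2 ≤ ω`
(`MatMulExponent.two_le`).

Algorithms are written as proofs of `Learns`: the zero tests shrink the set of possible inputs until
the shape of the computation is the same for all of them. `Learns.simulate` imports the
multiplication trees, and `Learns.compile` turns a proof of `Learns` into a computation tree.

Short forms come from the Krylov matrix of a cyclic vector and a Hankel matrix that intertwines the
companion matrix and its transpose. Modulo `χ_M`, rows and columns of `C` are eigenvectors for the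
class of `X`, which forces the rank one shape. -/

/-- A state of knowledge about an unknown input in `X`. -/
structure Know (X K : Type*) where
  dom : Set X
  fld : Set (X → K)
  int : Set (X → ℤ)

namespace Know

variable {X K : Type*}

/-- A later state has fewer possible inputs and more computed quantities, so that everything known
remains known. -/
instance : Preorder (Know X K) where
  le σ τ := τ.dom ⊆ σ.dom ∧ σ.fld ⊆ τ.fld ∧ σ.int ⊆ τ.int
  le_refl σ := ⟨subset_rfl, subset_rfl, subset_rfl⟩
  le_trans _ _ _ h h' := ⟨h'.1.trans h.1, h.2.1.trans h'.2.1, h.2.2.trans h'.2.2⟩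

/-- The quantity `f` has been computed. -/
def Knows (σ : Know X K) (f : X → K) : Prop := ∃ g ∈ σ.fld, ∀ x ∈ σ.dom, g x = f x

/-- The integer `f` has been computed. -/
def KnowsInt (σ : Know X K) (f : X → ℤ) : Prop := ∃ g ∈ σ.int, ∀ x ∈ σ.dom, g x = f x

/-- All entries of the matrix `A` have been computed. -/
def KnowsMat {α β : Type*} (σ : Know X K) (A : X → Matrix α β K) : Prop :=
  ∀ i j, σ.Knows fun x => A x i j

variable {σ τ : Know X K}

theorem Knows.mono {f : X → K} (h : σ.Knows f) (hστ : σ ≤ τ) : τ.Knows f := by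
  obtain ⟨g, hg, hgf⟩ := h
  exact ⟨g, hστ.2.1 hg, fun x hx => hgf x (hστ.1 hx)⟩

theorem KnowsInt.mono {f : X → ℤ} (h : σ.KnowsInt f) (hστ : σ ≤ τ) : τ.KnowsInt f := by
  obtain ⟨g, hg, hgf⟩ := h
  exact ⟨g, hστ.2.2 hg, fun x hx => hgf x (hστ.1 hx)⟩

theorem KnowsMat.mono {α β : Type*} {A : X → Matrix α β K} (h : σ.KnowsMat A) (hστ : σ ≤ τ) :
    τ.KnowsMat A := fun i j => (h i j).mono hστ

theorem Knows.congr {f f' : X → K} (h : σ.Knows f) (hf : ∀ x ∈ σ.dom, f x = f' x) :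
    σ.Knows f' := by
  obtain ⟨g, hg, hgf⟩ := h
  exact ⟨g, hg, fun x hx => (hgf x hx).trans (hf x hx)⟩

/-- `f` is known to vanish, or known not to vanish. -/
def Decided [Zero K] (σ : Know X K) (f : X → K) : Prop :=
  (∀ x ∈ σ.dom, f x = 0) ∨ ∀ x ∈ σ.dom, f x ≠ 0

theorem Decided.mono [Zero K] {f : X → K} (h : σ.Decided f) (hστ : σ ≤ τ) : τ.Decided f :=
  h.imp (fun h x hx => h x (hστ.1 hx)) fun h x hx => h x (hστ.1 hx)

theorem le_insert_fld (σ : Know X K) (g : X → K) : σ ≤ ⟨σ.dom, insert g σ.fld, σ.int⟩ :=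
  ⟨subset_rfl, Set.subset_insert _ _, subset_rfl⟩

theorem le_insert_int (σ : Know X K) (g : X → ℤ) : σ ≤ ⟨σ.dom, σ.fld, insert g σ.int⟩ :=
  ⟨subset_rfl, subset_rfl, Set.subset_insert _ _⟩

theorem le_sep (σ : Know X K) (p : X → Prop) : σ ≤ ⟨{x ∈ σ.dom | p x}, σ.fld, σ.int⟩ :=
  ⟨Set.sep_subset _ _, subset_rfl, subset_rfl⟩

theorem le_sep_insert (σ : Know X K) (p : X → Prop) (g : X → ℤ) :
    σ ≤ ⟨{x ∈ σ.dom | p x}, σ.fld, insert g σ.int⟩ :=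
  ⟨Set.sep_subset _ _, subset_rfl, Set.subset_insert _ _⟩

end Know

open Know

variable {X K : Type*} [Field K] [Valued K ℤᵐ⁰]

/-- `Learns Q σ f z`: from the state of knowledge `σ` one can reach, with at most `f` operations
in `K` and `z` operations on integers, a state of knowledge satisfying `Q`. -/
inductive Learns (Q : Know X K → Prop) : Know X K → ℝ → ℝ → Prop
  | done {σ f z} : 0 ≤ f → 0 ≤ z → Q σ → Learns Q σ f z
  -- A branch that no input reaches costs nothing, so even a negative budget is accepted here.
  | empty {σ f z} : σ.dom = ∅ → Learns Q σ f z
  | const {σ f z} (c : K) : Learns Q ⟨σ.dom, insert (fun _ => c) σ.fld, σ.int⟩ f z →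
      Learns Q σ (f + 1) z
  | arith {σ f z} (op : FieldOp) (g h : X → K) : g ∈ σ.fld → h ∈ σ.fld →
      Learns Q ⟨σ.dom, insert (fun x => op.apply (g x) (h x)) σ.fld, σ.int⟩ f z →
      Learns Q σ (f + 1) z
  | ifZero {σ f z} (g : X → K) : g ∈ σ.fld →
      Learns Q ⟨{x ∈ σ.dom | g x = 0}, σ.fld, σ.int⟩ f z →
      Learns Q ⟨{x ∈ σ.dom | g x ≠ 0}, σ.fld, σ.int⟩ f z →
      Learns Q σ (f + 1) z
  | valuation {σ f z} (g : X → K) : g ∈ σ.fld →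
      Learns Q ⟨{x ∈ σ.dom | g x = 0}, σ.fld, σ.int⟩ f z →
      Learns Q ⟨{x ∈ σ.dom | g x ≠ 0}, σ.fld, insert (fun x => ord (g x)) σ.int⟩ f z →
      Learns Q σ (f + 1) (z + 1)
  | intArith {σ f z} (op : IntOp) (g h : X → ℤ) : g ∈ σ.int → h ∈ σ.int →
      Learns Q ⟨σ.dom, σ.fld, insert (fun x => op.apply (g x) (h x)) σ.int⟩ f z →
      Learns Q σ f (z + 1)

/-! ### Composition of algorithms and elementary operations -/

namespace Learns

variable {Q R : Know X K → Prop} {σ τ : Know X K} {f f' z z' : ℝ}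

theorem le_cost (h : Learns Q σ f z) (hf : f ≤ f') (hz : z ≤ z') : Learns Q σ f' z' := by
  induction h generalizing f' z' with
  | done h0 h1 hQ => exact .done (h0.trans hf) (h1.trans hz) hQ
  | empty h => exact .empty h
  | const c _ ih =>
    have := Learns.const c (ih (f' := f' - 1) (z' := z') (by linarith) hz)
    rwa [sub_add_cancel] at this
  | arith op g h hg hh _ ih =>
    have := Learns.arith op g h hg hh (ih (f' := f' - 1) (z' := z') (by linarith) hz)
    rwa [sub_add_cancel] at this
  | ifZero g hg _ _ ih1 ih2 =>
    have := Learns.ifZero g hg (ih1 (f' := f' - 1) (z' := z') (by linarith) hz)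
      (ih2 (f' := f' - 1) (z' := z') (by linarith) hz)
    rwa [sub_add_cancel] at this
  | valuation g hg _ _ ih1 ih2 =>
    have := Learns.valuation g hg (ih1 (f' := f' - 1) (z' := z' - 1) (by linarith) (by linarith))
      (ih2 (f' := f' - 1) (z' := z' - 1) (by linarith) (by linarith))
    rwa [sub_add_cancel, sub_add_cancel] at this
  | intArith op g h hg hh _ ih =>
    have := Learns.intArith op g h hg hh (ih (f' := f') (z' := z' - 1) hf (by linarith))
    rwa [sub_add_cancel] at this

/-- Sequential composition: the second algorithm is grafted at each leaf of the first, and may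
differ from one leaf to another. Costs add along every path. -/
theorem bind (h : Learns Q σ f z) (hk : ∀ τ, σ ≤ τ → Q τ → Learns R τ f' z') :
    Learns R σ (f + f') (z + z') := by
  induction h with
  | done h0 h1 hQ => exact (hk _ le_rfl hQ).le_cost (by linarith) (by linarith)
  | empty h => exact .empty h
  | const c _ ih =>
    rw [add_right_comm]
    exact .const c (ih fun τ hτ => hk τ ((le_insert_fld _ _).trans hτ))
  | arith op g h hg hh _ ih =>
    rw [add_right_comm]
    exact .arith op g h hg hh
      (ih fun τ hτ => hk τ ((le_insert_fld _ _).trans hτ))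
  | ifZero g hg _ _ ih1 ih2 =>
    rw [add_right_comm]
    exact .ifZero g hg
      (ih1 fun τ hτ => hk τ ((le_sep _ _).trans hτ))
      (ih2 fun τ hτ => hk τ ((le_sep _ _).trans hτ))
  | valuation g hg _ _ ih1 ih2 =>
    rw [add_right_comm, add_right_comm _ 1 z']
    exact .valuation g hg
      (ih1 fun τ hτ => hk τ ((le_sep _ _).trans hτ))
      (ih2 fun τ hτ => hk τ
        ((le_sep_insert _ _ _).trans hτ))
  | intArith op g h hg hh _ ih =>
    rw [add_right_comm]
    exact .intArith op g h hg hh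
      (ih fun τ hτ => hk τ ((le_insert_int _ _).trans hτ))

theorem bind_le {a b : ℝ} (h : Learns Q σ f z) (hk : ∀ τ, σ ≤ τ → Q τ → Learns R τ f' z')
    (ha : f + f' ≤ a) (hb : z + z' ≤ b) : Learns R σ a b :=
  (h.bind hk).le_cost ha hb

theorem imp (h : Learns Q σ f z) (hQR : ∀ τ, σ ≤ τ → Q τ → R τ) : Learns R σ f z := by
  have := h.bind (f' := 0) (z' := 0) fun τ hτ hQ => .done le_rfl le_rfl (hQR τ hτ hQ)
  rwa [add_zero, add_zero] at this

/-- Learn a finite family of facts, one after the other. -/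
theorem finset {ι : Type*} (s : Finset ι) (P : ι → Know X K → Prop)
    (hP : ∀ i, ∀ ⦃τ τ' : Know X K⦄, τ ≤ τ' → P i τ → P i τ')
    (h : ∀ i ∈ s, ∀ τ, σ ≤ τ → Learns (P i) τ f z) :
    Learns (fun τ => ∀ i ∈ s, P i τ) σ (s.card * f) (s.card * z) := by
  classical
  induction s using Finset.induction_on with
  | empty => exact .done (by simp) (by simp) (by simp)
  | insert a s ha ih =>
    rw [Finset.card_insert_of_notMem ha]
    push_cast
    refine bind_le (ih fun i hi => h i (Finset.mem_insert_of_mem hi)) (fun τ hτ hQ =>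
      (h a (Finset.mem_insert_self _ _) τ hτ).imp fun τ' hτ' hP' => ?_)
      (le_of_eq (by ring)) (le_of_eq (by ring))
    exact Finset.forall_mem_insert _ _ _ |>.2 ⟨hP', fun i hi => hP i hτ' (hQ i hi)⟩

theorem pi {ι : Type*} [Fintype ι] (P : ι → Know X K → Prop)
    (hP : ∀ i, ∀ ⦃τ τ' : Know X K⦄, τ ≤ τ' → P i τ → P i τ')
    (h : ∀ i, ∀ τ, σ ≤ τ → Learns (P i) τ f z) :
    Learns (fun τ => ∀ i, P i τ) σ (Fintype.card ι * f) (Fintype.card ι * z) := by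
  refine (Learns.finset Finset.univ P hP fun i _ => h i).imp fun τ _ h i => h i (Finset.mem_univ i)

theorem pi_knows {ι : Type*} [Fintype ι] (F : ι → X → K)
    (h : ∀ i, ∀ τ, σ ≤ τ → Learns (fun τ => τ.Knows (F i)) τ f z) :
    Learns (fun τ => ∀ i, τ.Knows (F i)) σ (Fintype.card ι * f) (Fintype.card ι * z) :=
  Learns.pi (fun i τ => τ.Knows (F i)) (fun _ _ _ hτ hk => hk.mono hτ) h

theorem knows_const (c : K) : Learns (fun τ => τ.Knows fun _ => c) σ 1 0 := by
  have := Learns.const (Q := fun τ => τ.Knows fun _ => c) (σ := σ) (f := 0) (z := 0) c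
    (.done le_rfl le_rfl ⟨_, Set.mem_insert _ _, fun _ _ => rfl⟩)
  rwa [zero_add] at this

theorem knows_op (op : FieldOp) {g h : X → K} (hg : σ.Knows g) (hh : σ.Knows h) :
    Learns (fun τ => τ.Knows fun x => op.apply (g x) (h x)) σ 1 0 := by
  obtain ⟨g', hg', hg⟩ := hg
  obtain ⟨h', hh', hh⟩ := hh
  have := Learns.arith (Q := fun τ => τ.Knows fun x => op.apply (g x) (h x)) (σ := σ)
    (f := 0) (z := 0) op g' h' hg' hh'
    (.done le_rfl le_rfl ⟨_, Set.mem_insert _ _, fun x hx => by rw [hg x hx, hh x hx]⟩)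
  rwa [zero_add] at this

theorem knows_add {g h : X → K} (hg : σ.Knows g) (hh : σ.Knows h) :
    Learns (fun τ => τ.Knows fun x => g x + h x) σ 1 0 := knows_op .add hg hh

theorem knows_sub {g h : X → K} (hg : σ.Knows g) (hh : σ.Knows h) :
    Learns (fun τ => τ.Knows fun x => g x - h x) σ 1 0 := knows_op .sub hg hh

theorem knows_mul {g h : X → K} (hg : σ.Knows g) (hh : σ.Knows h) :
    Learns (fun τ => τ.Knows fun x => g x * h x) σ 1 0 := knows_op .mul hg hh

theorem knows_div {g h : X → K} (hg : σ.Knows g) (hh : σ.Knows h) :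
    Learns (fun τ => τ.Knows fun x => g x / h x) σ 1 0 := knows_op .div hg hh

/-- After a zero test the answer is the same for all remaining inputs. Later constructions can thus
split into cases once, instead of input by input. -/
theorem decide {g : X → K} (hg : σ.Knows g) : Learns (fun τ => τ.Decided g) σ 1 0 := by
  obtain ⟨g', hg', hg⟩ := hg
  have := Learns.ifZero (Q := fun τ => τ.Decided g) (σ := σ) (f := 0) (z := 0) g' hg'
    (.done le_rfl le_rfl (.inl fun x hx => (hg x hx.1).symm.trans hx.2))
    (.done le_rfl le_rfl (.inr fun x hx => fun h => hx.2 ((hg x hx.1).trans h)))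
  rwa [zero_add] at this

/-- Linear search for a nonzero element of a finite family. -/
theorem search {ι : Type*} (s : Finset ι) (F : ι → X → K) (hF : ∀ i ∈ s, σ.Knows (F i)) :
    Learns (fun τ => (∃ i ∈ s, ∀ x ∈ τ.dom, F i x ≠ 0) ∨ ∀ i ∈ s, ∀ x ∈ τ.dom, F i x = 0)
      σ s.card 0 := by
  have := Learns.finset (σ := σ) (f := 1) (z := 0) s (fun i τ => τ.Decided (F i))
    (fun i τ τ' hτ h => h.mono hτ) fun i hi τ hτ => decide ((hF i hi).mono hτ)
  simp only [mul_one, mul_zero] at this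
  refine this.imp fun τ _ h => ?_
  by_cases hex : ∃ i ∈ s, ∀ x ∈ τ.dom, F i x ≠ 0
  · exact .inl hex
  · push Not at hex
    refine .inr fun i hi => (h i hi).resolve_right fun h' => ?_
    obtain ⟨x, hx, h0⟩ := hex i hi
    exact h' x hx h0

end Learns

end PadicEigen

end

noncomputable section

open Polynomial
open scoped WithZero

namespace PadicEigen

open Know

variable {X K : Type*} [Field K] [Valued K ℤᵐ⁰]

/-! ### Integers with infinity -/

/-- The quantity `f` with values in `ℤ ∪ {+∞}` is known: it is infinite, or a known integer. -/
def Know.KnowsTop {K : Type*} (σ : Know X K) (f : X → WithTop ℤ) : Prop :=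
  (∀ x ∈ σ.dom, f x = ⊤) ∨ ∃ g, σ.KnowsInt g ∧ ∀ x ∈ σ.dom, f x = (g x : WithTop ℤ)

theorem Know.KnowsTop.mono {K : Type*} {σ τ : Know X K} {f : X → WithTop ℤ} (h : σ.KnowsTop f)
    (hστ : σ ≤ τ) : τ.KnowsTop f :=
  h.imp (fun h x hx => h x (hστ.1 hx)) fun ⟨g, hg, h⟩ => ⟨g, hg.mono hστ, fun x hx => h x (hστ.1 hx)⟩

namespace Learns

variable {Q R : Know X K → Prop} {σ τ : Know X K} {f f' z z' : ℝ}

theorem knowsInt_op (op : IntOp) {g h : X → ℤ} (hg : σ.KnowsInt g) (hh : σ.KnowsInt h) :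
    Learns (fun τ => τ.KnowsInt fun x => op.apply (g x) (h x)) σ 0 1 := by
  obtain ⟨g', hg', hg⟩ := hg
  obtain ⟨h', hh', hh⟩ := hh
  have := Learns.intArith (Q := fun τ => τ.KnowsInt fun x => op.apply (g x) (h x)) (σ := σ)
    (f := 0) (z := 0) op g' h' hg' hh'
    (.done le_rfl le_rfl ⟨_, Set.mem_insert _ _, fun x hx => by rw [hg x hx, hh x hx]⟩)
  rwa [zero_add] at this

/-- Which quantities are infinite is part of the state of knowledge, so infinity needs no register:
an operation involving it is free, and otherwise one integer operation suffices. -/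
theorem knowsTop_add {g h : X → WithTop ℤ} (hg : σ.KnowsTop g) (hh : σ.KnowsTop h) :
    Learns (fun τ => τ.KnowsTop fun x => g x + h x) σ 0 1 := by
  rcases hg with hg | ⟨g', hg', hg⟩
  · exact .done le_rfl zero_le_one (.inl fun x hx => by beta_reduce; rw [hg x hx, top_add])
  rcases hh with hh | ⟨h', hh', hh⟩
  · exact .done le_rfl zero_le_one (.inl fun x hx => by beta_reduce; rw [hh x hx, add_top])
  refine (knowsInt_op .add hg' hh').imp fun τ hτ hQ => .inr ⟨_, hQ, fun x hx => ?_⟩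
  beta_reduce
  rw [hg x (hτ.1 hx), hh x (hτ.1 hx)]
  rfl

theorem knowsTop_sub {g h : X → WithTop ℤ} (hg : σ.KnowsTop g) (hh : σ.KnowsTop h)
    (hfin : ∀ x ∈ σ.dom, h x ≠ ⊤) :
    Learns (fun τ => τ.KnowsTop fun x => g x - h x) σ 0 1 := by
  -- With no input left, `h` counts as known to be infinite, and `hfin` contradicts nothing.
  rcases σ.dom.eq_empty_or_nonempty with he | ⟨x₀, hx₀⟩
  · exact .empty he
  rcases hh with hh | ⟨h', hh', hh⟩
  · exact absurd (hh x₀ hx₀) (hfin x₀ hx₀)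
  rcases hg with hg | ⟨g', hg', hg⟩
  · exact .done le_rfl zero_le_one (.inl fun x hx => by beta_reduce; rw [hg x hx, hh x hx]; rfl)
  refine (knowsInt_op .sub hg' hh').imp fun τ hτ hQ => .inr ⟨_, hQ, fun x hx => ?_⟩
  beta_reduce
  rw [hg x (hτ.1 hx), hh x (hτ.1 hx)]
  rfl

theorem knowsTop_inf {g h : X → WithTop ℤ} (hg : σ.KnowsTop g) (hh : σ.KnowsTop h) :
    Learns (fun τ => τ.KnowsTop fun x => g x ⊓ h x) σ 0 1 := by
  rcases hg with hg | ⟨g', hg', hg⟩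
  · refine .done le_rfl zero_le_one ?_
    rcases hh with hh | ⟨h', hh', hh⟩
    · exact .inl fun x hx => by beta_reduce; rw [hg x hx, top_inf_eq, hh x hx]
    · exact .inr ⟨h', hh', fun x hx => by beta_reduce; rw [hg x hx, top_inf_eq, hh x hx]⟩
  rcases hh with hh | ⟨h', hh', hh⟩
  · exact .done le_rfl zero_le_one
      (.inr ⟨g', hg', fun x hx => by beta_reduce; rw [hh x hx, inf_top_eq, hg x hx]⟩)
  refine (knowsInt_op .min hg' hh').imp fun τ hτ hQ => .inr ⟨_, hQ, fun x hx => ?_⟩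
  beta_reduce
  rw [hg x (hτ.1 hx), hh x (hτ.1 hx)]
  exact (WithTop.coe_min _ _).symm

theorem knowsTop_finset_inf {ι : Type*} (s : Finset ι) (F : ι → X → WithTop ℤ)
    (hF : ∀ i ∈ s, σ.KnowsTop (F i)) :
    Learns (fun τ => τ.KnowsTop fun x => s.inf fun i => F i x) σ 0 s.card := by
  classical
  induction s using Finset.induction_on with
  | empty => exact .done le_rfl (by simp) (.inl fun x _ => by simp)
  | insert a s ha ih =>
    rw [Finset.card_insert_of_notMem ha]
    refine bind_le (ih fun i hi => hF i (Finset.mem_insert_of_mem hi)) (fun τ hτ hQ =>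
      (knowsTop_inf ((hF a (Finset.mem_insert_self _ _)).mono hτ) hQ).imp fun τ' hτ' h => ?_)
      (by simp) (by push_cast; rfl)
    simpa only [Finset.inf_insert] using h

theorem knowsTop_val {g : X → K} (hg : σ.Knows g) :
    Learns (fun τ => τ.KnowsTop fun x => val (g x)) σ 1 1 := by
  obtain ⟨g', hg', hg⟩ := hg
  have := Learns.valuation (Q := fun τ => τ.KnowsTop fun x => val (g x)) (σ := σ)
    (f := 0) (z := 0) g' hg'
    (.done le_rfl le_rfl (.inl fun x hx => by
      beta_reduce
      rw [← hg x hx.1, hx.2, val, if_pos rfl]))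
    (.done le_rfl le_rfl (.inr ⟨_, ⟨_, Set.mem_insert _ _, fun x hx => rfl⟩, fun x hx => by
      beta_reduce
      rw [← hg x hx.1, val, if_neg hx.2]⟩))
  rwa [zero_add] at this

/-! ### Computation trees and growth of knowledge -/

/-- A computation tree without operations on integers is a way to learn. -/
theorem simulate {I J O : Type} (T : CompTree K I J O) (σ : Know X K) (ρ : I → X → K)
    (ζ : J → ℤ) (hρ : ∀ i, σ.Knows (ρ i)) (f : ℝ)
    (hf : ∀ x ∈ σ.dom, ((T.run (fun i => ρ i x) ζ).fieldOps : ℝ) ≤ f ∧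
      (T.run (fun i => ρ i x) ζ).intOps = 0) :
    Learns (fun τ => ∃ (o : O) (ρ' : I → X → K), (∀ i, τ.Knows (ρ' i)) ∧
      ∀ x ∈ τ.dom, (T.run (fun i => ρ i x) ζ).out = o ∧
        ∀ i, (T.run (fun i => ρ i x) ζ).reg i = ρ' i x) σ f 0 := by
  classical
  -- A possible input is kept throughout the induction: it shows that the budget is nonnegative at a
  -- leaf, and that no integer instruction is met.
  rcases σ.dom.eq_empty_or_nonempty with he | ⟨x₀, hx₀⟩
  · exact .empty he
  induction T generalizing σ ρ f x₀ with
  | ret o =>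
    refine .done ?_ le_rfl ⟨o, ρ, hρ, fun x _ => ⟨rfl, fun i => rfl⟩⟩
    have := (hf x₀ hx₀).1
    simpa [CompTree.run] using this
  | const c dst t ih =>
    have key : ∀ x, (fun i => (Function.update ρ dst fun _ => c) i x) =
        Function.update (fun i => ρ i x) dst c := by
      intro x; ext i; by_cases h : i = dst
      · subst h; simp
      · simp [h]
    refine bind_le (knows_const c) (fun τ hτ hk => ?_) (add_sub_cancel 1 f).le (add_zero 0).le
    rcases τ.dom.eq_empty_or_nonempty with he | ⟨x₁, hx₁⟩
    · exact .empty he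
    have := ih τ (Function.update ρ dst fun _ => c) (fun i => ?_) (f - 1) (fun x hx => ?_) x₁ hx₁
    · simp only [key] at this
      simpa only [CompTree.run, Outcome.charge] using this
    · by_cases h : i = dst
      · subst h; simpa using hk
      · simpa [h] using (hρ i).mono hτ
    · have := hf x (hτ.1 hx)
      rw [key]
      simp only [CompTree.run, Outcome.charge, Nat.cast_add, Nat.cast_one] at this
      exact ⟨by linarith [this.1], this.2⟩
  | arith op a b dst t ih =>
    have key : ∀ x, (fun i => (Function.update ρ dst fun x => op.apply (ρ a x) (ρ b x)) i x) =
        Function.update (fun i => ρ i x) dst (op.apply (ρ a x) (ρ b x)) := by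
      intro x; ext i; by_cases h : i = dst
      · subst h; simp
      · simp [h]
    refine bind_le (knows_op op (hρ a) (hρ b)) (fun τ hτ hk => ?_) (add_sub_cancel 1 f).le
      (add_zero 0).le
    rcases τ.dom.eq_empty_or_nonempty with he | ⟨x₁, hx₁⟩
    · exact .empty he
    have := ih τ (Function.update ρ dst fun x => op.apply (ρ a x) (ρ b x)) (fun i => ?_) (f - 1)
      (fun x hx => ?_) x₁ hx₁
    · simp only [key] at this
      simpa only [CompTree.run, Outcome.charge] using this
    · by_cases h : i = dst
      · subst h; simpa using hk
      · simpa [h] using (hρ i).mono hτ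
    · have := hf x (hτ.1 hx)
      rw [key]
      simp only [CompTree.run, Outcome.charge, Nat.cast_add, Nat.cast_one] at this
      exact ⟨by linarith [this.1], this.2⟩
  | ifZero a t u iht ihu =>
    refine bind_le (decide (hρ a)) (fun τ hτ hk => ?_) (add_sub_cancel 1 f).le (add_zero 0).le
    rcases τ.dom.eq_empty_or_nonempty with he | ⟨x₁, hx₁⟩
    · exact .empty he
    rcases hk with hk | hk
    · refine (iht τ ρ (fun i => (hρ i).mono hτ) (f - 1) (fun x hx => ?_) x₁ hx₁).imp
        fun τ' hτ' ⟨o, ρ', h1, h2⟩ => ⟨o, ρ', h1, fun x hx => ?_⟩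
      · have := hf x (hτ.1 hx)
        simp only [CompTree.run, Outcome.charge, Nat.cast_add, Nat.cast_one, hk x hx,
          if_true] at this
        exact ⟨by linarith [this.1], this.2⟩
      · have := h2 x hx
        simpa only [CompTree.run, Outcome.charge, hk x (hτ'.1 hx), if_true] using this
    · refine (ihu τ ρ (fun i => (hρ i).mono hτ) (f - 1) (fun x hx => ?_) x₁ hx₁).imp
        fun τ' hτ' ⟨o, ρ', h1, h2⟩ => ⟨o, ρ', h1, fun x hx => ?_⟩
      · have := hf x (hτ.1 hx)
        simp only [CompTree.run, Outcome.charge, Nat.cast_add, Nat.cast_one, hk x hx,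
          if_false] at this
        exact ⟨by linarith [this.1], this.2⟩
      · have := h2 x hx
        simpa only [CompTree.run, Outcome.charge, hk x (hτ'.1 hx), if_false] using this
  | valuation => exact absurd (hf x₀ hx₀).2 (by simp [CompTree.run, Outcome.charge])
  | intConst => exact absurd (hf x₀ hx₀).2 (by simp [CompTree.run, Outcome.charge])
  | intArith => exact absurd (hf x₀ hx₀).2 (by simp [CompTree.run, Outcome.charge])
  | ifLe => exact absurd (hf x₀ hx₀).2 (by simp [CompTree.run, Outcome.charge])

/-- The input registers, and the work registers below `m`. -/
def _root_.PadicEigen.InUse {ι : Type} (m : ℕ) (a : ι ⊕ ℕ) : Prop := ∀ k, a = .inr k → k < m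

theorem _root_.PadicEigen.InUse.ne {ι : Type} {m : ℕ} {a : ι ⊕ ℕ} (h : InUse m a) : a ≠ .inr m :=
  fun e => lt_irrefl m (h m e)

theorem _root_.PadicEigen.InUse.succ {ι : Type} {m : ℕ} {a : ι ⊕ ℕ} (h : InUse m a) :
    InUse (m + 1) a := fun k hk => (h k hk).trans (Nat.lt_succ_self m)

/-- `CompTree.run` updates registers with classical decidability of equality, whereas registers also
carry a decidable equality of their own. -/
theorem _root_.PadicEigen.update_classical {α β : Type*} [DecidableEq α] (ρ : α → β) (a : α)
    (v : β) : @Function.update α (fun _ => β) (fun a b => Classical.propDecidable (a = b)) ρ a v =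
      Function.update ρ a v := by
  congr
  exact Subsingleton.elim _ _

/-- A way to learn integers is a computation tree. -/
theorem compile {ι κ : Type} {O : Type} (res : X → O → ℤ → Prop)
    (h : Learns Q σ f z)
    (hQ : ∀ τ : Know X K, Q τ → ∀ o, ∃ g ∈ τ.int, ∀ x ∈ τ.dom, res x o (g x)) :
    ∀ (m m' : ℕ) (a : (X → K) → ι ⊕ ℕ) (b : (X → ℤ) → κ ⊕ ℕ),
      (∀ g ∈ σ.fld, InUse m (a g)) → (∀ g ∈ σ.int, InUse m' (b g)) →
      ∃ T : CompTree K (ι ⊕ ℕ) (κ ⊕ ℕ) (O → κ ⊕ ℕ), ∀ x ∈ σ.dom, ∀ ρ ζ,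
        (∀ g ∈ σ.fld, ρ (a g) = g x) → (∀ g ∈ σ.int, ζ (b g) = g x) →
        (∀ o, res x o ((T.run ρ ζ).intReg ((T.run ρ ζ).out o))) ∧
          ((T.run ρ ζ).fieldOps : ℝ) ≤ f ∧ ((T.run ρ ζ).intOps : ℝ) ≤ z := by
  classical
  induction h with
  | @done σ f z h0 h1 h =>
    intro m m' a b ha hb
    choose g hg hres using hQ _ h
    refine ⟨.ret fun o => b (g o), fun x hx ρ ζ _ hζ => ⟨fun o => ?_, ?_, ?_⟩⟩
    · simp only [CompTree.run, hζ _ (hg o)]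
      exact hres o x hx
    · simpa [CompTree.run] using h0
    · simpa [CompTree.run] using h1
  | empty h =>
    exact fun m m' a b _ _ => ⟨.ret fun _ => .inr 0, fun x hx => by simp [h] at hx⟩
  | @const σ f z c _ ih =>
    intro m m' a b ha hb
    -- The new value goes into `m`, the first unused work register, so nothing stored is
    -- overwritten. If this very function was stored before, its address simply moves to `m`.
    obtain ⟨T, hT⟩ := ih (m + 1) m' (Function.update a (fun _ => c) (.inr m)) b (fun g hg => by
      by_cases hgc : g = fun _ => c
      · subst hgc; intro k hk; simp at hk; omega
      · rw [Function.update_of_ne hgc]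
        exact (ha g (hg.resolve_left hgc)).succ) hb
    refine ⟨.const c (.inr m) T, fun x hx ρ ζ hρ hζ => ?_⟩
    have := hT x hx (Function.update ρ (.inr m) c) ζ (fun g hg => by
      by_cases hgc : g = fun _ => c
      · subst hgc; simp
      · have hg' := hg.resolve_left hgc
        rw [Function.update_of_ne hgc, Function.update_of_ne (ha g hg').ne]
        exact hρ g hg') hζ
    simpa [CompTree.run, Outcome.charge, update_classical] using this
  | @arith σ f z op u v hu hv _ ih =>
    intro m m' a b ha hb
    obtain ⟨T, hT⟩ := ih (m + 1) m'
      (Function.update a (fun x => op.apply (u x) (v x)) (.inr m)) b (fun g hg => by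
      by_cases hgc : g = fun x => op.apply (u x) (v x)
      · subst hgc; intro k hk; simp at hk; omega
      · rw [Function.update_of_ne hgc]
        exact (ha g (hg.resolve_left hgc)).succ) hb
    refine ⟨.arith op (a u) (a v) (.inr m) T, fun x hx ρ ζ hρ hζ => ?_⟩
    have := hT x hx (Function.update ρ (.inr m) (op.apply (ρ (a u)) (ρ (a v)))) ζ (fun g hg => by
      by_cases hgc : g = fun x => op.apply (u x) (v x)
      · subst hgc; simp [hρ u hu, hρ v hv]
      · have hg' := hg.resolve_left hgc
        rw [Function.update_of_ne hgc, Function.update_of_ne (ha g hg').ne]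
        exact hρ g hg') hζ
    simpa [CompTree.run, Outcome.charge, update_classical] using this
  | @ifZero σ f z u hu _ _ ih1 ih2 =>
    intro m m' a b ha hb
    obtain ⟨T1, hT1⟩ := ih1 m m' a b ha hb
    obtain ⟨T2, hT2⟩ := ih2 m m' a b ha hb
    refine ⟨.ifZero (a u) T1 T2, fun x hx ρ ζ hρ hζ => ?_⟩
    by_cases h0 : u x = 0
    · have := hT1 x ⟨hx, h0⟩ ρ ζ hρ hζ
      simpa [CompTree.run, Outcome.charge, hρ u hu, h0, update_classical] using this
    · have := hT2 x ⟨hx, h0⟩ ρ ζ hρ hζ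
      simpa [CompTree.run, Outcome.charge, hρ u hu, h0, update_classical] using this
  | @valuation σ f z u hu _ _ ih1 ih2 =>
    intro m m' a b ha hb
    obtain ⟨T1, hT1⟩ := ih1 m m' a b ha hb
    obtain ⟨T2, hT2⟩ := ih2 m (m' + 1) a (Function.update b (fun x => ord (u x)) (.inr m')) ha
      (fun g hg => by
      by_cases hgc : g = fun x => ord (u x)
      · subst hgc; intro k hk; simp at hk; omega
      · rw [Function.update_of_ne hgc]
        exact (hb g (hg.resolve_left hgc)).succ)
    refine ⟨.valuation (a u) (.inr m') T1 T2, fun x hx ρ ζ hρ hζ => ?_⟩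
    by_cases h0 : u x = 0
    · have := hT1 x ⟨hx, h0⟩ ρ ζ hρ hζ
      simpa [CompTree.run, Outcome.charge, hρ u hu, h0, update_classical] using this
    · have := hT2 x ⟨hx, h0⟩ ρ (Function.update ζ (.inr m') (ord (u x))) hρ (fun g hg => by
        by_cases hgc : g = fun x => ord (u x)
        · subst hgc; simp
        · have hg' := hg.resolve_left hgc
          rw [Function.update_of_ne hgc, Function.update_of_ne (hb g hg').ne]
          exact hζ g hg')
      simpa [CompTree.run, Outcome.charge, hρ u hu, h0, update_classical] using this
  | @intArith σ f z op u v hu hv _ ih =>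
    intro m m' a b ha hb
    obtain ⟨T, hT⟩ := ih m (m' + 1) a
      (Function.update b (fun x => op.apply (u x) (v x)) (.inr m')) ha (fun g hg => by
      by_cases hgc : g = fun x => op.apply (u x) (v x)
      · subst hgc; intro k hk; simp at hk; omega
      · rw [Function.update_of_ne hgc]
        exact (hb g (hg.resolve_left hgc)).succ)
    refine ⟨.intArith op (b u) (b v) (.inr m') T, fun x hx ρ ζ hρ hζ => ?_⟩
    have := hT x hx ρ (Function.update ζ (.inr m') (op.apply (ζ (b u)) (ζ (b v)))) hρ
      (fun g hg => by
      by_cases hgc : g = fun x => op.apply (u x) (v x)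
      · subst hgc; simp [hζ u hu, hζ v hv]
      · have hg' := hg.resolve_left hgc
        rw [Function.update_of_ne hgc, Function.update_of_ne (hb g hg').ne]
        exact hζ g hg')
    simpa [CompTree.run, Outcome.charge, update_classical] using this

end Learns

/-! ### Matrix multiplication -/

/-- Known `w × w` matrices can be multiplied with `c * w ^ ω` operations. -/
def HasMul (X K : Type*) [Field K] [Valued K ℤᵐ⁰] (c ω : ℝ) : Prop :=
  ∀ w : ℕ, 1 ≤ w → ∀ (σ : Know X K) (A B : X → Matrix (Fin w) (Fin w) K),
    σ.Knows (fun _ => 0) → σ.KnowsMat A → σ.KnowsMat B →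
    Learns (fun τ => τ.KnowsMat fun x => A x * B x) σ (c * (w : ℝ) ^ ω) 0

/-- A known zero stands for all the blank work registers of the multiplication tree, which can
therefore be run anew at each use without resetting anything. -/
theorem MatMulExponent.hasMul {ω : ℝ} (h : MatMulExponent K ω) :
    ∃ c : ℝ, 0 ≤ c ∧ ∀ X : Type*, HasMul X K c ω := by
  obtain ⟨c, hc⟩ := h
  refine ⟨max c 0, le_max_right _ _, fun X w hw σ A B h0 hA hB => ?_⟩
  obtain ⟨T, hT⟩ := hc w hw
  have key : ∀ x, (fun i => (Sum.elim (Sum.elim (fun p x => A x p.1 p.2) (fun p x => B x p.1 p.2))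
      (fun _ _ => 0) : ((Fin w × Fin w) ⊕ (Fin w × Fin w)) ⊕ ℕ → X → K) i x) =
      Sum.elim (Sum.elim (fun p => A x p.1 p.2) (fun p => B x p.1 p.2)) (fun _ => 0) := by
    intro x; ext ((_ | _) | _) <;> rfl
  refine (Learns.simulate T σ (Sum.elim (Sum.elim (fun p x => A x p.1 p.2)
    (fun p x => B x p.1 p.2)) (fun _ _ => 0)) (fun _ => 0) ?_ (max c 0 * (w : ℝ) ^ ω) ?_).imp ?_
  · rintro ((p | p) | _)
    exacts [hA _ _, hB _ _, h0]
  · intro x _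
    rw [key]
    exact ⟨(hT (A x) (B x)).2.1.trans
      (mul_le_mul_of_nonneg_right (le_max_left _ _) (by positivity)), (hT (A x) (B x)).2.2⟩
  · rintro τ hτ ⟨o, ρ', h1, h2⟩ i j
    refine (h1 (o i j)).congr fun x hx => ?_
    have := h2 x hx
    rw [key] at this
    rw [← this.2, ← this.1]
    exact (hT (A x) (B x)).1 i j

theorem exists_injective_blocks {α : Type*} [Fintype α] {a w : ℕ} (h : Fintype.card α ≤ a * w) :
    ∃ e : α → Fin a × Fin w, Function.Injective e := by
  have : Nonempty (α ↪ Fin a × Fin w) := Function.Embedding.nonempty_of_card_le (by simpa using h)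
  exact ⟨this.some, this.some.injective⟩

open Classical in
/-- Multiplication of rectangular matrices by blocks. -/
theorem HasMul.mul {c ω : ℝ} (hmul : HasMul X K c ω) {α β γ : Type*} [Fintype α] [Fintype β]
    [Fintype γ] {a b w : ℕ} (hw : 1 ≤ w) (hα : Fintype.card α ≤ a * w)
    (hβ : Fintype.card β ≤ w) (hγ : Fintype.card γ ≤ b * w) {σ : Know X K}
    (h0 : σ.Knows fun _ => 0) {A : X → Matrix α β K} {B : X → Matrix β γ K}
    (hA : σ.KnowsMat A) (hB : σ.KnowsMat B) :
    Learns (fun τ => τ.KnowsMat fun x => A x * B x) σ (a * b * (c * (w : ℝ) ^ ω)) 0 := by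
  obtain ⟨e, he⟩ := exists_injective_blocks hα
  obtain ⟨g, hg⟩ := exists_injective_blocks hγ
  obtain ⟨⟨u, hu⟩⟩ : Nonempty (β ↪ Fin w) := Function.Embedding.nonempty_of_card_le (by simpa using hβ)
  -- The `p`-th horizontal block of `A`, padded with zeros. Its entries are entries of `A` or zero,
  -- so cutting into blocks takes no operation.
  let A' : Fin a → X → Matrix (Fin w) (Fin w) K := fun p x i j =>
    if h : ∃ s : α × β, e s.1 = (p, i) ∧ u s.2 = j then A x h.choose.1 h.choose.2 else 0
  let B' : Fin b → X → Matrix (Fin w) (Fin w) K := fun q x i j =>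
    if h : ∃ s : β × γ, u s.1 = i ∧ g s.2 = (q, j) then B x h.choose.1 h.choose.2 else 0
  have hA' : ∀ s t x, A' (e s).1 x (e s).2 (u t) = A x s t := by
    intro s t x
    have h : ∃ s' : α × β, e s'.1 = ((e s).1, (e s).2) ∧ u s'.2 = u t := ⟨(s, t), rfl, rfl⟩
    simp only [A']
    rw [dif_pos h, he h.choose_spec.1, hu h.choose_spec.2]
  have hA0 : ∀ p i j x, (∀ t, u t ≠ j) → A' p x i j = 0 := by
    intro p i j x h
    simp only [A']
    exact dif_neg fun ⟨s, hs⟩ => h _ hs.2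
  have hB' : ∀ s t x, B' (g t).1 x (u s) (g t).2 = B x s t := by
    intro s t x
    have h : ∃ s' : β × γ, u s'.1 = u s ∧ g s'.2 = ((g t).1, (g t).2) := ⟨(s, t), rfl, rfl⟩
    simp only [B']
    rw [dif_pos h, hu h.choose_spec.1, hg h.choose_spec.2]
  have kA : ∀ p, σ.KnowsMat (A' p) := by
    intro p i j
    by_cases h : ∃ s : α × β, e s.1 = (p, i) ∧ u s.2 = j
    · simp only [A', dif_pos h]; exact hA _ _
    · simp only [A', dif_neg h]; exact h0
  have kB : ∀ q, σ.KnowsMat (B' q) := by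
    intro q i j
    by_cases h : ∃ s : β × γ, u s.1 = i ∧ g s.2 = (q, j)
    · simp only [B', dif_pos h]; exact hB _ _
    · simp only [B', dif_neg h]; exact h0
  have := Learns.pi (σ := σ) (ι := Fin a × Fin b) (f := c * (w : ℝ) ^ ω) (z := 0)
    (fun pq τ => τ.KnowsMat fun x => A' pq.1 x * B' pq.2 x) (fun _ _ _ hτ h => h.mono hτ)
    fun pq τ hτ => hmul w hw τ _ _ (h0.mono hτ) ((kA _).mono hτ) ((kB _).mono hτ)
  simp only [Fintype.card_prod, Fintype.card_fin, Nat.cast_mul, mul_zero] at this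
  refine this.imp fun τ hτ h i j => (h ((e i).1, (g j).1) (e i).2 (g j).2).congr fun x _ => ?_
  simp only [Matrix.mul_apply]
  rw [← Finset.sum_subset (Finset.subset_univ (Finset.univ.map ⟨u, hu⟩)), Finset.sum_map]
  · exact Finset.sum_congr rfl fun t _ => by
      rw [Function.Embedding.coeFn_mk, hA', hB']
  · intro t _ ht
    rw [hA0, zero_mul]
    intro t' h
    exact ht (by simp [← h])

end PadicEigen

end

noncomputable section

open Polynomial
open scoped WithZero

namespace PadicEigen

open Know

variable {X K : Type*} [Field K] [Valued K ℤᵐ⁰]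

/-! ### Elimination -/

/-- Bound for the cost of a divide-and-conquer algorithm of width `2 ^ p` in ambient
dimension `2 ^ P`. -/
def dcCost (C ω : ℝ) (P p : ℕ) : ℝ := C * (p + 1) * 2 ^ P * ((2 : ℝ) ^ p) ^ (ω - 1)

theorem dcCost_nonneg {C : ℝ} (hC : 0 ≤ C) (ω : ℝ) (P p : ℕ) : 0 ≤ dcCost C ω P p := by
  unfold dcCost; positivity

theorem dcCost_zero (C ω : ℝ) (P : ℕ) : dcCost C ω P 0 = C * 2 ^ P := by
  simp [dcCost]

/-- The recurrence of divide and conquer: two calls at half width, and two rectangular products with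
their additions. With `w = 2 ^ p`, the bound `2 ≤ ω` gives `w ≤ w ^ (ω - 1)`, which absorbs the
additions, and `2 * w ^ (ω - 1) ≤ (2 * w) ^ (ω - 1)`, so that each level contributes one more copy
of the same term. -/
theorem dcCost_succ {C c ω : ℝ} (hω : 2 ≤ ω) (hC : 2 * (c + 1) ≤ C) (hc : 0 ≤ c) {P p : ℕ}
    (hp : p < P) :
    dcCost C ω P p + dcCost C ω P p +
      2 * (2 ^ (P - p) * (c * ((2 : ℝ) ^ p) ^ ω) + 2 ^ P * 2 ^ p) ≤ dcCost C ω P (p + 1) := by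
  set w : ℝ := 2 ^ p with hw
  have hw1 : 1 ≤ w := one_le_pow₀ one_le_two
  have hP : (2 : ℝ) ^ P = 2 ^ (P - p) * w := by rw [hw, ← pow_add]; congr 1; omega
  have h1 : w ^ ω = w * w ^ (ω - 1) := by
    conv_lhs => rw [show ω = 1 + (ω - 1) by ring, Real.rpow_add (by linarith), Real.rpow_one]
  have h2 : w ≤ w ^ (ω - 1) := by
    conv_lhs => rw [← Real.rpow_one w]
    exact Real.rpow_le_rpow_of_exponent_le hw1 (by linarith)
  have h3 : 2 * w ^ (ω - 1) ≤ ((2 : ℝ) ^ (p + 1)) ^ (ω - 1) := by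
    rw [pow_succ', Real.mul_rpow (by norm_num) (by positivity)]
    refine mul_le_mul_of_nonneg_right ?_ (by positivity)
    conv_lhs => rw [← Real.rpow_one 2]
    exact Real.rpow_le_rpow_of_exponent_le one_le_two (by linarith)
  have hC0 : 0 ≤ C := by linarith
  set v := w ^ (ω - 1) with hv
  have hv0 : 0 ≤ v := by positivity
  have hB : (0 : ℝ) ≤ 2 ^ P := by positivity
  calc dcCost C ω P p + dcCost C ω P p + 2 * (2 ^ (P - p) * (c * w ^ ω) + 2 ^ P * w)
      = C * (p + 1) * 2 ^ P * (2 * v) + 2 * (2 ^ P * (c * v) + 2 ^ P * w) := by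
        rw [h1, dcCost, ← hw, ← hv, hP]; ring
    _ ≤ C * (p + 1) * 2 ^ P * (2 * v) + 2 ^ P * (C * v) := by
        have : 2 * (2 ^ P * (c * v) + 2 ^ P * w) ≤ 2 ^ P * (2 * (c + 1) * v) := by
          nlinarith [mul_le_mul_of_nonneg_left h2 hB]
        have h4 : (2 : ℝ) ^ P * (2 * (c + 1) * v) ≤ 2 ^ P * (C * v) := by gcongr
        linarith
    _ ≤ C * (p + 1) * 2 ^ P * (2 * v) + 2 ^ P * (C * (2 * v)) := by
        gcongr; linarith
    _ = C * ((p + 1 : ℕ) + 1) * 2 ^ P * (2 * v) := by push_cast; ring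
    _ ≤ _ := by
        unfold dcCost; gcongr

/-- A finite set of natural numbers of cardinality at most `a + b` is cut into an initial part and
a final part of cardinality at most `a` and `b`. -/
theorem exists_initial_final (L : Finset ℕ) {a b : ℕ} (h : L.card ≤ a + b) :
    ∃ L₁ L₂ : Finset ℕ, L₁ ∪ L₂ = L ∧ (∀ s ∈ L₁, ∀ t ∈ L₂, s < t) ∧ L₁.card ≤ a ∧ L₂.card ≤ b := by
  induction a generalizing L with
  | zero => exact ⟨∅, L, by simp, by simp, by simp, by simpa using h⟩
  | succ a ih =>
    rcases L.eq_empty_or_nonempty with rfl | hne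
    · exact ⟨∅, ∅, by simp, by simp, by simp, by simp⟩
    obtain ⟨L₁, L₂, h1, h2, h3, h4⟩ := ih (L.erase (L.min' hne)) (by
      rw [Finset.card_erase_of_mem (L.min'_mem hne)]; omega)
    refine ⟨insert (L.min' hne) L₁, L₂, ?_, ?_, (Finset.card_insert_le _ _).trans (by omega), h4⟩
    · rw [Finset.insert_union, h1, Finset.insert_erase (L.min'_mem hne)]
    · intro s hs t ht
      rcases Finset.mem_insert.1 hs with rfl | hs
      · have : t ∈ L.erase (L.min' hne) := h1 ▸ Finset.mem_union_right _ ht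
        exact lt_of_le_of_ne (L.min'_le t (Finset.mem_of_mem_erase this))
          (Finset.ne_of_mem_erase this).symm
      · exact h2 s hs t ht

section

variable {ι : Type} [Fintype ι] [DecidableEq ι]

/-- The columns of `E` outside `R` are those of the identity matrix. -/
def IsIdOutside (R : Finset ι) (E : Matrix ι ι K) : Prop :=
  ∀ i ∉ R, ∀ l, E l i = if l = i then 1 else 0

omit [Valued K ℤᵐ⁰] in
theorem IsIdOutside.mulVec {R : Finset ι} {E : Matrix ι ι K} (h : IsIdOutside R E) (v : ι → K)
    (l : ι) : E.mulVec v l = ∑ i : R, E l i * v i + if l ∈ R then 0 else v l := by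
  rw [Matrix.mulVec, dotProduct, ← Finset.sum_add_sum_compl R, Finset.sum_coe_sort R fun i => E l i * v i]
  congr 1
  have : ∀ i ∈ Rᶜ, E l i * v i = if l = i then v l else 0 := fun i hi => by
    rw [h i (by simpa using hi)]; split_ifs with hli <;> simp [hli]
  rw [Finset.sum_congr rfl this, Finset.sum_ite_eq]
  simp

omit [Valued K ℤᵐ⁰] in
/-- `E` fixes the vectors supported outside `R`. -/
theorem IsIdOutside.mulVec_eq_self {R : Finset ι} {E : Matrix ι ι K} (h : IsIdOutside R E)
    {v : ι → K} (hv : ∀ i ∈ R, v i = 0) : E.mulVec v = v := by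
  ext l
  rw [h.mulVec, Finset.sum_eq_zero fun i _ => by rw [hv i i.2, mul_zero], zero_add]
  split_ifs with hl
  · rw [hv l hl]
  · rfl

/-- Multiplication of a family of vectors by a matrix with few nontrivial columns. -/
theorem learns_mulVec {c ω : ℝ} (hmul : HasMul X K c ω) {γ : Type*} [Fintype γ] {a b w : ℕ}
    (hw : 1 ≤ w) (hι : Fintype.card ι ≤ a * w) (hγ : Fintype.card γ ≤ b * w) (R : Finset ι)
    (hR : R.card ≤ w) {σ : Know X K} (h0 : σ.Knows fun _ => 0) {E : X → Matrix ι ι K}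
    {B : γ → X → ι → K} (hE : σ.KnowsMat E) (hB : ∀ q i, σ.Knows fun x => B q x i)
    (hid : ∀ x ∈ σ.dom, IsIdOutside R (E x)) :
    Learns (fun τ => ∀ q i, τ.Knows fun x => (E x).mulVec (B q x) i) σ
      (a * b * (c * (w : ℝ) ^ ω) + Fintype.card ι * Fintype.card γ) 0 := by
  refine Learns.bind_le (hmul.mul (A := fun x => Matrix.of fun (l : ι) (i : R) => E x l i)
    (B := fun x => Matrix.of fun (i : R) (q : γ) => B q x i) hw hι (by simpa using hR) hγ h0
    (fun l i => hE l i) (fun i q => hB q i)) (fun τ hτ hQ => ?_) le_rfl (add_zero 0).le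
  have := Learns.pi_knows (σ := τ) (ι := ι × γ) (f := 1) (z := 0)
    (fun s x => (E x).mulVec (B s.2 x) s.1) fun s τ' hτ' => ?_
  · simp only [Fintype.card_prod, Nat.cast_mul, mul_one, mul_zero] at this
    exact this.imp fun _ _ h q i => h (i, q)
  · have h1 := (hQ s.1 s.2).mono hτ'
    have h2 : τ'.Knows fun x => if s.1 ∈ R then 0 else B s.2 x s.1 := by
      split_ifs
      · exact h0.mono (hτ.trans hτ')
      · exact (hB _ _).mono (hτ.trans hτ')
    refine (Learns.knows_add h1 h2).imp fun τ'' hτ'' h => h.congr fun x hx => ?_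
    rw [(hid x ((hτ.trans (hτ'.trans hτ'')).1 hx)).mulVec]
    simp only [Matrix.mul_apply, Matrix.of_apply]

/-- The state of a greedy elimination: the vectors `A t` for `t ∈ L` are considered in increasing
order; those in `sel'` were selected, and `E` maps them to distinct vectors of the standard basis,
given by `row'`. A vector `A t` is not considered when `t` is linked to `t - 1` and `t - 1` is
not selected. -/
structure IsElim (link : ℕ → Prop) (A : ℕ → ι → K) (L sel : Finset ℕ)
    (sel' : Finset ℕ) (row' : ℕ → ι) (E : Matrix ι ι K) : Prop where
  isId : IsIdOutside ((sel' \ sel).image row') E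
  inj : Function.Injective E.mulVec
  selected : ∀ t ∈ L, t ∈ sel' → E.mulVec (A t) = Pi.single (row' t) 1
  notSelected : ∀ t ∈ L, t ∉ sel' → (link t ∧ t - 1 ∉ sel') ∨
    ∀ i, E.mulVec (A t) i ≠ 0 → ∃ s ∈ sel', s < t ∧ row' s = i

/-- The selection made by a greedy elimination. -/
structure IsSel (link : ℕ → Prop) (L sel : Finset ℕ) (row : ℕ → ι)
    (sel' : Finset ℕ) (row' : ℕ → ι) : Prop where
  sub : sel ⊆ sel'
  sub_union : sel' ⊆ sel ∪ L
  agree : ∀ t ∈ sel, row' t = row t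
  injOn : Set.InjOn row' sel'
  linked : ∀ t ∈ sel', t ∉ sel → link t → t - 1 ∈ sel'

omit [Fintype ι] [DecidableEq ι] in
theorem IsSel.trans {link : ℕ → Prop} {L₁ L₂ sel sel₁ sel₂ : Finset ℕ} {row row₁ row₂ : ℕ → ι}
    (h₁ : IsSel link L₁ sel row sel₁ row₁) (h₂ : IsSel link L₂ sel₁ row₁ sel₂ row₂) :
    IsSel link (L₁ ∪ L₂) sel row sel₂ row₂ where
  sub := h₁.sub.trans h₂.sub
  sub_union := by
    refine h₂.sub_union.trans ?_
    rw [← Finset.union_assoc]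
    exact Finset.union_subset_union h₁.sub_union subset_rfl
  agree t ht := (h₂.agree t (h₁.sub ht)).trans (h₁.agree t ht)
  injOn := h₂.injOn
  linked t ht hts hl := by
    by_cases h : t ∈ sel₁
    · exact h₂.sub (h₁.linked t h hts hl)
    · exact h₂.linked t ht h hl

-- The pivot rows of the second stage are new, so `E₂` fixes the basis vectors and the dependent
-- vectors produced by `E₁`. As `L₁` precedes `L₂`, no label of `L₁` can be selected later, and an
-- omission decided in the first stage stays justified.
omit [Valued K ℤᵐ⁰] in
theorem IsElim.trans {link : ℕ → Prop} {A : ℕ → ι → K} {L₁ L₂ sel sel₁ sel₂ : Finset ℕ}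
    {row row₁ row₂ : ℕ → ι} {E₁ E₂ : Matrix ι ι K} (hL : ∀ s ∈ L₁, ∀ t ∈ L₂, s < t)
    (s₁ : IsSel link L₁ sel row sel₁ row₁) (s₂ : IsSel link L₂ sel₁ row₁ sel₂ row₂)
    (h₁ : IsElim link A L₁ sel sel₁ row₁ E₁)
    (h₂ : IsElim link (fun t => E₁.mulVec (A t)) L₂ sel₁ sel₂ row₂ E₂) :
    IsElim link A (L₁ ∪ L₂) sel sel₂ row₂ (E₂ * E₁) := by
  have hfresh : ∀ s ∈ sel₁, row₁ s ∉ (sel₂ \ sel₁).image row₂ := by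
    intro s hs h
    obtain ⟨t, ht, hts⟩ := Finset.mem_image.1 h
    rw [Finset.mem_sdiff] at ht
    rw [← s₂.agree s hs] at hts
    exact ht.2 (s₂.injOn ht.1 (s₂.sub hs) hts ▸ hs)
  have hold : ∀ t ∈ L₁, t ∈ sel₂ → t ∈ sel₁ := fun t ht hts =>
    (Finset.mem_union.1 (s₂.sub_union hts)).resolve_right fun h => lt_irrefl _ (hL t ht t h)
  refine ⟨fun i hi l => ?_, ?_, fun t ht hts => ?_, fun t ht hts => ?_⟩
  · have hi₁ : i ∉ (sel₁ \ sel).image row₁ := by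
      intro h
      obtain ⟨t, ht, hti⟩ := Finset.mem_image.1 h
      rw [Finset.mem_sdiff] at ht
      exact hi (Finset.mem_image.2 ⟨t, Finset.mem_sdiff.2 ⟨s₂.sub ht.1, ht.2⟩,
        (s₂.agree t ht.1).trans hti⟩)
    have hi₂ : i ∉ (sel₂ \ sel₁).image row₂ := fun h =>
      hi (Finset.image_subset_image (Finset.sdiff_subset_sdiff subset_rfl s₁.sub) h)
    rw [Matrix.mul_apply, Finset.sum_congr rfl fun k _ => by rw [h₁.isId i hi₁ k]]
    simpa using h₂.isId i hi₂ l
  · have : (E₂ * E₁).mulVec = E₂.mulVec ∘ E₁.mulVec := by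
      ext v; simp [Matrix.mulVec_mulVec]
    rw [this]
    exact h₂.inj.comp h₁.inj
  · rw [← Matrix.mulVec_mulVec]
    by_cases ht₁ : t ∈ L₁
    · have hs := hold t ht₁ hts
      rw [h₁.selected t ht₁ hs, s₂.agree t hs]
      refine h₂.isId.mulVec_eq_self fun i hi => ?_
      rw [Pi.single_apply, if_neg]
      rintro rfl
      exact hfresh t hs hi
    · exact h₂.selected t ((Finset.mem_union.1 ht).resolve_left ht₁) hts
  · simp_rw [← Matrix.mulVec_mulVec]
    by_cases ht₁ : t ∈ L₁
    · rcases h₁.notSelected t ht₁ fun h => hts (s₂.sub h) with h | h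
      · refine .inl ⟨h.1, fun h' => ?_⟩
        rcases Finset.mem_union.1 (s₂.sub_union h') with h' | h'
        · exact h.2 h'
        · exact absurd (hL t ht₁ _ h') (by omega)
      · right
        rw [h₂.isId.mulVec_eq_self fun i hi => ?_]
        · intro i hi
          obtain ⟨s, hs, hst, hsi⟩ := h i hi
          exact ⟨s, s₂.sub hs, hst, (s₂.agree s hs).trans hsi⟩
        · by_contra h0
          obtain ⟨s, hs, -, rfl⟩ := h i h0
          exact hfresh s hs hi
    · exact h₂.notSelected t ((Finset.mem_union.1 ht).resolve_left ht₁) hts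

/-- The elimination matrix for one vector `v` with pivot `i`. -/
def pivotMatrix (v : ι → K) (i : ι) : Matrix ι ι K := Matrix.of fun l j =>
  if j = i then (if l = i then 1 / v i else 0 - v l / v i) else if l = j then 1 else 0

omit [Fintype ι] [Valued K ℤᵐ⁰] in
theorem isIdOutside_pivotMatrix (v : ι → K) (i : ι) : IsIdOutside {i} (pivotMatrix v i) := by
  intro j hj l
  simp only [pivotMatrix, Matrix.of_apply, if_neg (show j ≠ i by simpa using hj)]

omit [Valued K ℤᵐ⁰] in
theorem pivotMatrix_mulVec (v w : ι → K) (i l : ι) : (pivotMatrix v i).mulVec w l =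
    if l = i then w i / v i else w l - v l / v i * w i := by
  rw [(isIdOutside_pivotMatrix v i).mulVec, Finset.univ_eq_attach, Finset.sum_attach {i}
    (fun j => pivotMatrix v i l j * w j)]
  simp only [Finset.sum_singleton, pivotMatrix, Matrix.of_apply, if_true, Finset.mem_singleton]
  split_ifs <;> ring

omit [Valued K ℤᵐ⁰] in
theorem pivotMatrix_injective {v : ι → K} {i : ι} (h : v i ≠ 0) :
    Function.Injective (pivotMatrix v i).mulVec := by
  intro w w' hw
  have hi : w i = w' i := by
    have := congrFun hw i
    simp only [pivotMatrix_mulVec, if_true] at this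
    field_simp at this
    exact this
  ext l
  by_cases hl : l = i
  · rw [hl, hi]
  · have := congrFun hw l
    simpa only [pivotMatrix_mulVec, if_neg hl, hi, sub_left_inj] using this

/-- Greedy elimination for at most one vector. -/
theorem learns_elim_one (link : ℕ → Prop) {P : ℕ} (hι : Fintype.card ι ≤ 2 ^ P) (L : Finset ℕ)
    (hL : L.card ≤ 1) (sel : Finset ℕ) (row : ℕ → ι) (hrow : Set.InjOn row sel)
    (hlt : ∀ s ∈ sel, ∀ t ∈ L, s < t) (A : ℕ → X → ι → K) (σ : Know X K)
    (h0 : σ.Knows fun _ => 0) (h1 : σ.Knows fun _ => 1)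
    (hA : ∀ t ∈ L, ∀ i, σ.Knows fun x => A t x i) :
    Learns (fun τ => ∃ (sel' : Finset ℕ) (row' : ℕ → ι) (E : X → Matrix ι ι K),
      τ.KnowsMat E ∧ IsSel link L sel row sel' row' ∧
        ∀ x ∈ τ.dom, IsElim link (fun t => A t x) L sel sel' row' (E x)) σ (3 * 2 ^ P) 0 := by
  have hιr : (Fintype.card ι : ℝ) ≤ 2 ^ P := by exact_mod_cast hι
  have hid : ∀ R : Finset ι, IsIdOutside R (1 : Matrix ι ι K) := fun R i _ l => Matrix.one_apply
  have hinj : Function.Injective (1 : Matrix ι ι K).mulVec := fun v w h => by simpa using h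
  have hsel : IsSel link L sel row sel row :=
    ⟨subset_rfl, Finset.subset_union_left, fun _ _ => rfl, hrow, fun t h h' => absurd h h'⟩
  have hone : σ.KnowsMat fun _ => (1 : Matrix ι ι K) := by
    intro i j
    simp only [Matrix.one_apply]
    split_ifs
    exacts [h1, h0]
  have hnot : ∀ t ∈ L, t ∉ sel := fun t ht hs => lt_irrefl _ (hlt t hs t ht)
  rcases Finset.card_le_one_iff_subset_singleton.1 hL with ⟨t, hLt⟩
  -- If the only label is skipped, or if there is none, the identity matrix serves and no operation
  -- is needed.
  by_cases hskip : ∀ t ∈ L, link t ∧ t - 1 ∉ sel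
  · refine .done (by positivity) le_rfl ⟨sel, row, fun _ => 1, hone, hsel, fun x _ =>
      ⟨hid _, hinj, fun t ht hs => absurd hs (hnot t ht), fun t ht _ => .inl (hskip t ht)⟩⟩
  push Not at hskip
  obtain ⟨t', ht', hlk⟩ := hskip
  obtain rfl : t' = t := by simpa using hLt ht'
  obtain rfl : L = {t'} := Finset.Subset.antisymm hLt (by simpa using ht')
  -- The pivot must be in a row not yet used. The search takes at most `2 ^ P` tests, and the single
  -- nontrivial column of the pivot matrix at most two operations per entry.
  refine Learns.bind_le (Learns.search (sel.image row)ᶜ (fun i x => A t' x i)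
    fun i _ => hA _ ht' i) (f' := 2 * 2 ^ P) (z' := 0) (fun τ hτ hQ => ?_) ?_ (add_zero 0).le
  · rcases hQ with ⟨i, hi, hne⟩ | hz
    · have := Learns.pi_knows (σ := τ) (f := 2) (z := 0)
        (fun l x => pivotMatrix (A t' x) i l i) fun l τ' hτ' => ?_
      · rw [mul_zero] at this
        refine (this.le_cost (by linarith) le_rfl).imp fun τ' hτ' hE => ?_
        have hi' : ∀ s ∈ sel, row s ≠ i := by simpa using hi
        have hts : t' ∉ sel := hnot t' ht'
        have hns : ∀ s ∈ sel, s ≠ t' := fun s hs h => hts (h ▸ hs)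
        refine ⟨insert t' sel, Function.update row t' i, fun x => pivotMatrix (A t' x) i, ?_,
          ⟨Finset.subset_insert _ _, ?_, fun s hs => ?_, ?_, ?_⟩, fun x hx => ⟨?_, ?_, ?_, ?_⟩⟩
        · intro l j
          by_cases hj : j = i
          · exact hj ▸ hE l
          · simp only [pivotMatrix, Matrix.of_apply, if_neg hj]
            split_ifs
            exacts [h1.mono (hτ.trans hτ'), h0.mono (hτ.trans hτ')]
        · rw [Finset.union_comm]; rfl
        · rw [Function.update_of_ne (hns s hs)]
        · rw [Finset.coe_insert, Set.injOn_insert (by simpa using hts)]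
          refine ⟨hrow.congr fun s hs => (Function.update_of_ne (hns s hs) _ _).symm, ?_⟩
          rintro ⟨s, hs, h⟩
          rw [Function.update_self, Function.update_of_ne (hns s hs)] at h
          exact hi' s hs h
        · intro s hs hs' hl
          obtain rfl := (Finset.mem_insert.1 hs).resolve_right hs'
          exact Finset.mem_insert_of_mem (hlk hl)
        · rw [Finset.insert_sdiff_of_notMem _ hts, Finset.sdiff_self]
          simpa using isIdOutside_pivotMatrix _ _
        · exact pivotMatrix_injective (hne x (hτ'.1 hx))
        · intro s hs _
          obtain rfl := Finset.mem_singleton.1 hs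
          ext l
          have := hne x (hτ'.1 hx)
          rw [pivotMatrix_mulVec, Function.update_self, Pi.single_apply]
          split_ifs
          · exact div_self this
          · field_simp; ring
        · intro s hs hs'
          exact absurd (Finset.mem_insert.2 (.inl (Finset.mem_singleton.1 hs))) hs'
      · have hAi : ∀ l, τ'.Knows fun x => A t' x l := fun l => (hA _ ht' l).mono (hτ.trans hτ')
        by_cases hl : l = i
        · simp only [pivotMatrix, Matrix.of_apply, if_true, hl]
          exact (Learns.knows_div (h1.mono (hτ.trans hτ')) (hAi i)).le_cost (by norm_num) le_rfl
        · simp only [pivotMatrix, Matrix.of_apply, if_true, hl, if_false]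
          exact Learns.bind_le (Learns.knows_div (hAi l) (hAi i)) (fun τ'' hτ'' h =>
            Learns.knows_sub (h0.mono (hτ.trans (hτ'.trans hτ''))) h) (by norm_num) (by norm_num)
    · refine .done (by positivity) le_rfl ⟨sel, row, fun _ => 1, hone.mono hτ, hsel, fun x hx =>
        ⟨hid _, hinj, fun t ht hs => absurd hs (hnot t ht), fun t ht _ => .inr fun i hi => ?_⟩⟩
      obtain rfl := Finset.mem_singleton.1 ht
      rw [Matrix.one_mulVec] at hi
      by_contra hcon
      refine hi (hz i ?_ x hx)
      simp only [Finset.mem_compl, Finset.mem_image, not_exists, not_and]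
      exact fun s hs hsi => hcon ⟨s, hs, hlt s hs t ht, hsi⟩
  · have : (((sel.image row)ᶜ.card : ℕ) : ℝ) ≤ Fintype.card ι := by
      exact_mod_cast Finset.card_le_univ _
    linarith

/-- Greedy elimination by divide and conquer. -/
theorem learns_elim {c ω C : ℝ} (hω : 2 ≤ ω) (hc : 0 ≤ c) (hC : 2 * (c + 1) ≤ C) (hC3 : 3 ≤ C)
    (hmul : HasMul X K c ω) (link : ℕ → Prop) {P : ℕ} (hι : Fintype.card ι ≤ 2 ^ P)
    (p : ℕ) (hp : p ≤ P) (L : Finset ℕ)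
    (hL : L.card ≤ 2 ^ p) (sel : Finset ℕ) (row : ℕ → ι) (hrow : Set.InjOn row sel)
    (hlt : ∀ s ∈ sel, ∀ t ∈ L, s < t) (A : ℕ → X → ι → K) (σ : Know X K)
    (h0 : σ.Knows fun _ => 0) (h1 : σ.Knows fun _ => 1)
    (hA : ∀ t ∈ L, ∀ i, σ.Knows fun x => A t x i) :
    Learns (fun τ => ∃ (sel' : Finset ℕ) (row' : ℕ → ι) (E : X → Matrix ι ι K),
      τ.KnowsMat E ∧ IsSel link L sel row sel' row' ∧
        ∀ x ∈ τ.dom, IsElim link (fun t => A t x) L sel sel' row' (E x)) σ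
      (dcCost C ω P p) 0 := by
  induction p generalizing L sel row A σ with
  | zero =>
    refine (learns_elim_one link hι L (by simpa using hL) sel row hrow hlt A σ h0 h1 hA).le_cost
      ?_ le_rfl
    rw [dcCost_zero]
    gcongr
  | succ p ih =>
    obtain ⟨L₁, L₂, rfl, hL₁₂, hL₁, hL₂⟩ := exists_initial_final L (a := 2 ^ p) (b := 2 ^ p)
      (by rw [pow_succ] at hL; omega)
    have hιr : (Fintype.card ι : ℝ) ≤ 2 ^ P := by exact_mod_cast hι
    have hιw : Fintype.card ι ≤ 2 ^ (P - p) * 2 ^ p := by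
      rw [← pow_add, Nat.sub_add_cancel (by omega)]; exact hι
    have hcost : ∀ k : ℕ, k ≤ 2 ^ p → ((2 ^ (P - p) : ℕ) : ℝ) * (1 : ℕ) *
        (c * ((2 ^ p : ℕ) : ℝ) ^ ω) + Fintype.card ι * k ≤
        2 ^ (P - p) * (c * ((2 : ℝ) ^ p) ^ ω) + 2 ^ P * 2 ^ p := by
      intro k hk
      have hkr : (k : ℝ) ≤ 2 ^ p := by exact_mod_cast hk
      push_cast
      rw [mul_one]
      gcongr
    have hrank : ∀ {L sel sel' : Finset ℕ} {row row' : ℕ → ι}, L.card ≤ 2 ^ p →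
        IsSel link L sel row sel' row' → ((sel' \ sel).image row').card ≤ 2 ^ p := by
      intro L sel sel' row row' hL hs
      refine Finset.card_image_le.trans ((Finset.card_le_card ?_).trans hL)
      intro t ht
      rw [Finset.mem_sdiff] at ht
      exact (Finset.mem_union.1 (hs.sub_union ht.1)).resolve_left ht.2
    refine Learns.bind_le (f' := dcCost C ω P p + 2 * (2 ^ (P - p) * (c * ((2 : ℝ) ^ p) ^ ω) +
      2 ^ P * 2 ^ p)) (z' := 0) (ih (by omega) L₁ hL₁ sel row hrow
      (fun s hs t ht => hlt s hs t (Finset.mem_union_left _ ht)) A σ h0 h1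
      fun t ht => hA t (Finset.mem_union_left _ ht)) (fun τ₁ hτ₁ hQ₁ => ?_)
      (by linarith [dcCost_succ hω hC hc (show p < P by omega)]) (add_zero 0).le
    obtain ⟨sel₁, row₁, E₁, kE₁, s₁, e₁⟩ := hQ₁
    have hlt₁ : ∀ s ∈ sel₁, ∀ t ∈ L₂, s < t := by
      intro s hs t ht
      rcases Finset.mem_union.1 (s₁.sub_union hs) with h | h
      · exact hlt s h t (Finset.mem_union_right _ ht)
      · exact hL₁₂ s h t ht
    -- The second call works on the images under `E₁` of the vectors of `L₂`. This product is cheap: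
    -- `E₁` has at most `2 ^ p` nontrivial columns.
    refine Learns.bind_le (f' := dcCost C ω P p + (2 ^ (P - p) * (c * ((2 : ℝ) ^ p) ^ ω) +
      2 ^ P * 2 ^ p)) (z' := 0) ((learns_mulVec hmul (γ := L₂) (b := 1) Nat.one_le_two_pow hιw
        (by simpa using hL₂) _ (hrank hL₁ s₁) (h0.mono hτ₁) (B := fun t => A t) kE₁
        (fun t i => (hA t (Finset.mem_union_right _ t.2) i).mono hτ₁)
        fun x hx => (e₁ x hx).isId).le_cost (hcost _ (by simpa using hL₂)) le_rfl)
      (fun τ₂ hτ₂ hQ₂ => ?_) (by linarith) (add_zero 0).le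
    refine Learns.bind_le (ih (by omega) L₂ hL₂ sel₁ row₁ s₁.injOn hlt₁
      (fun t x => (E₁ x).mulVec (A t x)) τ₂ (h0.mono (hτ₁.trans hτ₂)) (h1.mono (hτ₁.trans hτ₂))
      fun t ht => hQ₂ ⟨t, ht⟩) (fun τ₃ hτ₃ hQ₃ => ?_) le_rfl (add_zero 0).le
    obtain ⟨sel₂, row₂, E₂, kE₂, s₂, e₂⟩ := hQ₃
    -- Only the columns of `E₂ * E₁` at the pivot rows of the first stage are computed; the others
    -- are columns of `E₂`.
    refine ((learns_mulVec hmul (γ := ((sel₁ \ sel).image row₁ : Finset ι)) (b := 1)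
      Nat.one_le_two_pow hιw (by simpa using hrank hL₁ s₁) _ (hrank hL₂ s₂)
      (h0.mono (hτ₁.trans (hτ₂.trans hτ₃))) (B := fun i x l => E₁ x l i) kE₂
      (fun i l => (kE₁ l i).mono (hτ₂.trans hτ₃))
      fun x hx => (e₂ x hx).isId).le_cost (hcost _ (by simpa using hrank hL₁ s₁)) le_rfl).imp
      fun τ₄ hτ₄ hQ₄ => ?_
    refine ⟨sel₂, row₂, fun x => E₂ x * E₁ x, fun l i => ?_, s₁.trans s₂, fun x hx =>
      (e₁ x ((hτ₂.trans (hτ₃.trans hτ₄)).1 hx)).trans hL₁₂ s₁ s₂ (e₂ x (hτ₄.1 hx))⟩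
    by_cases hi : i ∈ (sel₁ \ sel).image row₁
    · exact hQ₄ ⟨i, hi⟩ l
    · refine ((kE₂ l i).mono hτ₄).congr fun x hx => ?_
      beta_reduce
      rw [Matrix.mul_apply, Finset.sum_congr rfl fun k _ => by
        rw [(e₁ x ((hτ₂.trans (hτ₃.trans hτ₄)).1 hx)).isId i hi k]]
      simp

end

end PadicEigen

end

noncomputable section

open Polynomial
open scoped WithZero

namespace PadicEigen

open Know

/-! ### Krylov bases -/

section Krylov

variable {K : Type*} [Field K] {n : ℕ}

/-- The `j`-th vector of the standard basis. -/
def unitVec (K : Type*) [Field K] (n j : ℕ) : Fin n → K := fun i => if (i : ℕ) = j then 1 else 0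

/-- The vector `M ^ l * e_j`, where `t = b * j + l` with `l < b`. -/
def krylovVec (M : Matrix (Fin n) (Fin n) K) (b t : ℕ) : Fin n → K :=
  (M ^ (t % b)).mulVec (unitVec K n (t / b))

/-- The span of the vectors `M ^ l' * e_j'` with `(j', l')` lexicographically smaller than
`(j, l)`. -/
def krylovLT (M : Matrix (Fin n) (Fin n) K) (j l : ℕ) : Submodule K (Fin n → K) :=
  Submodule.span K {v | ∃ j' l', (j' < j ∨ j' = j ∧ l' < l) ∧ v = (M ^ l').mulVec (unitVec K n j')}

/-- A label encodes a pair (index of the unit vector, power of `M`). Adding `q` raises the power by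
`q`, provided that it stays below `b`. -/
theorem add_div_mod {b t q : ℕ} (h : t % b + q < b) :
    (t + q) / b = t / b ∧ (t + q) % b = t % b + q := by
  refine (Nat.div_mod_unique (by omega)).2 ⟨?_, h⟩
  have := Nat.mod_add_div t b
  omega

theorem sub_one_div_mod {b t : ℕ} (hb : 0 < b) (h : t % b ≠ 0) :
    (t - 1) / b = t / b ∧ (t - 1) % b = t % b - 1 := by
  refine (Nat.div_mod_unique hb).2 ⟨?_, ?_⟩
  · have := Nat.mod_add_div t b
    omega
  · have := Nat.mod_lt t hb
    omega

/-- The order of the labels is the lexicographic one, so treating labels in increasing order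
exhausts one chain before starting the next. -/
theorem lex_of_lt {b s t : ℕ} (h : s < t) : s / b < t / b ∨ s / b = t / b ∧ s % b < t % b := by
  rcases lt_or_eq_of_le (Nat.div_le_div_right (c := b) h.le) with h' | h'
  · exact .inl h'
  · refine .inr ⟨h', ?_⟩
    have h1 := Nat.mod_add_div s b
    have h2 := Nat.mod_add_div t b
    rw [h'] at h1
    omega

theorem lt_of_lex {b s t : ℕ}
    (h : s / b < t / b ∨ s / b = t / b ∧ s % b < t % b) : s < t := by
  by_contra hst
  rcases (not_lt.1 hst).eq_or_lt with rfl | h'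
  · omega
  · have := lex_of_lt (b := b) h'
    omega

theorem krylovVec_mem_krylovLT (M : Matrix (Fin n) (Fin n) K) {b s t : ℕ} (h : s < t) :
    krylovVec M b s ∈ krylovLT M (t / b) (t % b) :=
  Submodule.subset_span ⟨_, _, lex_of_lt h, rfl⟩

/-- A set of labels made of chains of length at most `q`. -/
structure IsChains (n b q : ℕ) (S : Finset ℕ) : Prop where
  div_lt : ∀ t ∈ S, t / b < n
  mod_lt : ∀ t ∈ S, t % b < q
  linked : ∀ t ∈ S, t % b ≠ 0 → t - 1 ∈ S

/-- Chains are initial segments. -/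
theorem IsChains.mem_of_le {b q : ℕ} {S : Finset ℕ} (h : IsChains n b q S) (hb : 0 < b) {t : ℕ}
    (ht : t ∈ S) {m : ℕ} (hm : m ≤ t % b) : t - m ∈ S ∧ (t - m) / b = t / b ∧
      (t - m) % b = t % b - m := by
  induction m with
  | zero => simpa using ht
  | succ m ih =>
    obtain ⟨h1, h2, h3⟩ := ih (by omega)
    have h4 : (t - m) % b ≠ 0 := by omega
    obtain ⟨h5, h6⟩ := sub_one_div_mod hb h4
    exact ⟨h.linked _ h1 h4, h5.trans h2, by rw [Nat.sub_add_eq, h6, h3]; omega⟩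

/-- The vectors of the chains of `S` are independent, as shown by `E`, and a chain of length less
than `q` cannot be continued. -/
structure IsKrylovStage (M : Matrix (Fin n) (Fin n) K) (b q : ℕ) (S : Finset ℕ) (row : ℕ → Fin n)
    (E : Matrix (Fin n) (Fin n) K) : Prop where
  inj : Function.Injective E.mulVec
  mulVec_eq : ∀ t ∈ S, E.mulVec (krylovVec M b t) = Pi.single (row t) 1
  halt : ∀ t, t / b < n → t % b < q → (t % b ≠ 0 → t - 1 ∈ S) → t ∉ S →
    krylovVec M b t ∈ krylovLT M (t / b) (t % b)

variable {M E : Matrix (Fin n) (Fin n) K} {b q : ℕ} {S : Finset ℕ} {row : ℕ → Fin n}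

/-- As `E` sends the `v s` to distinct vectors of the standard basis, the coordinates of `E w` are
the coefficients of the combination sought, and injectivity of `E` lifts the identity back. -/
theorem mem_span_of_support {v : ℕ → Fin n → K} (hE : Function.Injective E.mulVec)
    (hv : ∀ t ∈ S, E.mulVec (v t) = Pi.single (row t) 1) (hrow : Set.InjOn row S)
    {w : Fin n → K} (hw : ∀ i, E.mulVec w i ≠ 0 → ∃ s ∈ S, row s = i) :
    w ∈ Submodule.span K (v '' S) := by
  have : w = ∑ s ∈ S, E.mulVec w (row s) • v s := by
    apply hE
    rw [Matrix.mulVec_sum]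
    ext i
    rw [Finset.sum_apply]
    have h1 : ∀ s ∈ S, E.mulVec (E.mulVec w (row s) • v s) i =
        if row s = i then E.mulVec w i else 0 := by
      intro s hs
      rw [Matrix.mulVec_smul, hv s hs, Pi.smul_apply, Pi.single_apply, smul_eq_mul]
      by_cases h : row s = i
      · simp [h]
      · simp [h, Ne.symm h]
    rw [Finset.sum_congr rfl h1]
    by_cases h0 : E.mulVec w i = 0
    · simp [h0]
    · obtain ⟨s, hs, rfl⟩ := hw i h0
      rw [Finset.sum_eq_single_of_mem s hs, if_pos rfl]
      intro s' hs' hne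
      rw [if_neg fun h => hne (hrow hs' hs h)]
  rw [this]
  exact Submodule.sum_mem _ fun s hs => Submodule.smul_mem _ _
    (Submodule.subset_span (Set.mem_image_of_mem _ hs))

theorem support_of_mem_span {v : ℕ → Fin n → K} {T : Set ℕ}
    (hv : ∀ t ∈ T, E.mulVec (v t) = Pi.single (row t) 1)
    {w : Fin n → K} (hw : w ∈ Submodule.span K (v '' T)) (i : Fin n) (hi : E.mulVec w i ≠ 0) :
    ∃ s ∈ T, row s = i := by
  by_contra hcon
  refine hi ?_
  induction hw using Submodule.span_induction with
  | mem w hw =>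
    obtain ⟨s, hs, rfl⟩ := hw
    rw [hv s hs, Pi.single_apply, if_neg fun h => hcon ⟨s, hs, h.symm⟩]
  | zero => simp
  | add u w _ _ hu hw =>
    rw [Matrix.mulVec_add, Pi.add_apply]
    by_cases h1 : E.mulVec u i = 0 <;> by_cases h2 : E.mulVec w i = 0 <;> simp_all
  | smul a u _ hu =>
    rw [Matrix.mulVec_smul, Pi.smul_apply]
    by_cases h1 : E.mulVec u i = 0 <;> simp_all

theorem IsChains.injOn_card_le (hrow : Set.InjOn row S) : S.card ≤ n := by
  simpa using Finset.card_le_card_of_injOn row (fun _ _ => Finset.mem_univ _) hrow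

/-- With chains shorter than `q`, the span of the chains is invariant. -/
theorem IsKrylovStage.krylovLT_le (h : IsKrylovStage M b q S row E)
    (hrow : Set.InjOn row S) (hq : n < q) (hb : q ≤ b) (j : ℕ) (hj : j ≤ n) :
    krylovLT M j 0 ≤ Submodule.span K (krylovVec M b '' {s | s ∈ S ∧ s / b < j}) := by
  have hb0 : 0 < b := by omega
  induction j with
  | zero =>
    refine Submodule.span_le.2 ?_
    rintro _ ⟨j', l', h, -⟩
    omega
  | succ j ih =>
    -- The `j`-th chain breaks before length `q`: the pivot rows are distinct, so `S` has at most `n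
    -- < q` labels.
    have hex : ∃ l, b * j + l ∉ S ∧ l < q := by
      by_contra hcon
      push Not at hcon
      have : (Finset.range q).card ≤ S.card := Finset.card_le_card_of_injOn (fun l => b * j + l)
        (fun l hl => by
          by_contra h0
          exact absurd (hcon l h0) (not_le.2 (Finset.mem_range.1 hl)))
        fun l _ l' _ hll => by simpa using hll
      have := IsChains.injOn_card_le hrow
      rw [Finset.card_range] at *
      omega
    classical
    set k := Nat.find hex with hk
    obtain ⟨hk1, hk2⟩ := Nat.find_spec hex
    have hlt : ∀ l < k, b * j + l ∈ S := fun l hl => by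
      by_contra h0
      exact Nat.find_min hex hl ⟨h0, by omega⟩
    have hdm : ∀ l < b, (b * j + l) / b = j ∧ (b * j + l) % b = l := fun l hl =>
      (Nat.div_mod_unique hb0).2 ⟨by ring, hl⟩
    set U := Submodule.span K (krylovVec M b '' {s | s ∈ S ∧ s / b < j + 1}) with hU
    have hWU : krylovLT M j 0 ≤ U := (ih (by omega)).trans
      (Submodule.span_mono (Set.image_mono fun s hs => ⟨hs.1, by have := hs.2; omega⟩))
    have hsmall : ∀ l < k, (M ^ l).mulVec (unitVec K n j) ∈ U := by
      intro l hl
      obtain ⟨h1, h2⟩ := hdm l (by omega)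
      refine Submodule.subset_span ⟨b * j + l, ⟨hlt l hl, by omega⟩, ?_⟩
      rw [krylovVec, h1, h2]
    have hZU : krylovLT M j k ≤ U := by
      refine Submodule.span_le.2 ?_
      rintro _ ⟨j', l', h | ⟨rfl, h⟩, rfl⟩
      · exact hWU (Submodule.subset_span ⟨j', l', .inl h, rfl⟩)
      · exact hsmall l' h
    have hkU : (M ^ k).mulVec (unitVec K n j) ∈ krylovLT M j k := by
      obtain ⟨h1, h2⟩ := hdm k (by omega)
      have := h.halt (b * j + k) (by omega) (by omega) (fun h0 => ?_) hk1
      · rwa [krylovVec, h1, h2] at this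
      · have := hlt (k - 1) (by omega)
        rwa [show b * j + k - 1 = b * j + (k - 1) by omega]
    -- For the earlier indices all powers are present, and in the chain of `j` the only product that
    -- could leave the space is `M ^ k * e_j`, which is in it by `hkU`.
    have hinv : ∀ w ∈ krylovLT M j k, M.mulVec w ∈ krylovLT M j k := by
      intro w hw
      suffices krylovLT M j k ≤ (krylovLT M j k).comap M.mulVecLin from this hw
      refine Submodule.span_le.2 ?_
      rintro _ ⟨j', l', h, rfl⟩
      change M.mulVec _ ∈ krylovLT M j k
      rw [Matrix.mulVec_mulVec, ← pow_succ']
      rcases h with h | ⟨rfl, h⟩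
      · exact Submodule.subset_span ⟨j', l' + 1, .inl h, rfl⟩
      · rcases (show l' + 1 ≤ k from h).eq_or_lt with h' | h'
        · rw [h']; exact hkU
        · exact Submodule.subset_span ⟨j', l' + 1, .inr ⟨rfl, h'⟩, rfl⟩
    have hall : ∀ l, (M ^ (k + l)).mulVec (unitVec K n j) ∈ krylovLT M j k := by
      intro l
      induction l with
      | zero => exact hkU
      | succ l ihl =>
        rw [← add_assoc, pow_succ', ← Matrix.mulVec_mulVec]
        exact hinv _ ihl
    refine Submodule.span_le.2 ?_
    rintro _ ⟨j', l', h | h, rfl⟩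
    · rcases (Nat.lt_succ_iff.1 h).eq_or_lt with rfl | h'
      · rcases lt_or_ge l' k with hl | hl
        · exact hsmall l' hl
        · have := hall (l' - k)
          rw [Nat.add_sub_cancel' hl] at this
          exact hZU this
      · exact hWU (Submodule.subset_span ⟨j', l', .inl h', rfl⟩)
    · omega

/-- Every unit vector starts a chain and hence lies in the span of the selected vectors, which
therefore form a basis. -/
theorem IsKrylovStage.card_eq (h : IsKrylovStage M b q S row E)
    (hrow : Set.InjOn row S) (hq : n < q) (hb : q ≤ b) : S.card = n := by
  classical
  refine le_antisymm (IsChains.injOn_card_le hrow) ?_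
  have htop : Submodule.span K ((S.image (krylovVec M b) : Finset _) : Set (Fin n → K)) = ⊤ := by
    rw [eq_top_iff]
    intro w _
    have hw : w = ∑ i : Fin n, w i • unitVec K n i := by
      ext l
      simp [Finset.sum_apply, unitVec, Fin.val_inj]
    rw [hw]
    refine Submodule.sum_mem _ fun i _ => Submodule.smul_mem _ _ ?_
    have h1 : unitVec K n i ∈ krylovLT M n 0 := Submodule.subset_span
      ⟨i, 0, .inl i.2, by simp⟩
    refine Submodule.span_mono ?_ (h.krylovLT_le hrow hq hb n le_rfl h1)
    rw [Finset.coe_image]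
    exact Set.image_mono fun s hs => hs.1
  have := finrank_span_finset_le_card (R := K) (S.image (krylovVec M b))
  rw [Set.finrank, htop, finrank_top, Module.finrank_fin_fun] at this
  exact this.trans Finset.card_image_le

/-- The multiplication by `M` in the basis given by the chains. -/
theorem IsKrylovStage.mulVec_krylovVec (h : IsKrylovStage M b q S row E) (hS : IsChains n b q S)
    (hrow : Set.InjOn row S) (hq : n < q) (hb : q < b) {t : ℕ} (ht : t ∈ S) :
    M.mulVec (krylovVec M b t) = krylovVec M b (t + 1) ∧
      (t + 1 ∉ S → krylovVec M b (t + 1) ∈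
        Submodule.span K (krylovVec M b '' {s | s ∈ S ∧ s ≤ t})) := by
  have hb0 : 0 < b := by omega
  have htq := hS.mod_lt t ht
  obtain ⟨h1, h2⟩ := add_div_mod (b := b) (t := t) (q := 1) (by omega)
  refine ⟨by rw [krylovVec, Matrix.mulVec_mulVec, ← pow_succ', krylovVec, h1, h2], fun hn => ?_⟩
  -- The part of the chain up to `t` has `t % b + 1` labels in `S`, hence at most `n < q`. The
  -- halting condition thus applies to `t + 1`.
  have hlt : t % b + 1 < q := by
    have : (Finset.range (t % b + 1)).card ≤ S.card :=
      Finset.card_le_card_of_injOn (fun l => t - l)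
        (fun l hl => (hS.mem_of_le hb0 ht (by
          have : l < t % b + 1 := by simpa using hl
          omega)).1)
        fun l hl l' hl' hll => by
          have h3 : l < t % b + 1 := by simpa using hl
          have h4 : l' < t % b + 1 := by simpa using hl'
          have := Nat.mod_le t b
          simp only at hll
          omega
    have := IsChains.injOn_card_le hrow
    rw [Finset.card_range] at *
    omega
  have := h.halt (t + 1) (by rw [h1]; exact hS.div_lt t ht) (by omega) (fun _ => by simpa using ht) hn
  rw [h1, h2] at this
  refine Submodule.span_le.2 ?_ this
  rintro _ ⟨j', l', hlex, rfl⟩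
  rcases hlex with hlex | ⟨rfl, hlex⟩
  · have h0 : (M ^ l').mulVec (unitVec K n j') ∈ krylovLT M (t / b) 0 :=
      Submodule.subset_span ⟨j', l', .inl hlex, rfl⟩
    have h3 := h.krylovLT_le hrow hq hb.le (t / b) (hS.div_lt t ht).le h0
    have h4 : krylovVec M b '' {s | s ∈ S ∧ s / b < t / b} ⊆
        krylovVec M b '' {s | s ∈ S ∧ s ≤ t} :=
      Set.image_mono fun s hs => ⟨hs.1, (lt_of_lex (.inl hs.2)).le⟩
    exact Submodule.span_mono h4 h3
  · obtain ⟨h3, h4, h5⟩ := hS.mem_of_le hb0 ht (m := t % b - l') (by omega)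
    refine Submodule.subset_span ⟨_, ⟨h3, Nat.sub_le _ _⟩, ?_⟩
    rw [krylovVec, h4, h5]
    congr 2
    omega

end Krylov

end PadicEigen

end

noncomputable section

open Polynomial
open scoped WithZero

namespace PadicEigen

open Know

variable {X K : Type*} [Field K]

/-! ### Doubling of the chains and reduction to companion blocks -/

section

variable {n b q : ℕ} {S sel : Finset ℕ} {row row' : ℕ → Fin n}

/-- The labels of the vectors `v` and `M ^ q * v`, for `v` in the chains of `S`. -/
def doubled (q : ℕ) (S : Finset ℕ) : Finset ℕ := S ∪ S.image (· + q)

theorem mem_doubled {t : ℕ} : t ∈ doubled q S ↔ t ∈ S ∨ ∃ s ∈ S, s + q = t := by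
  simp [doubled]

theorem card_doubled_le : (doubled q S).card ≤ 2 * S.card := by
  have := Finset.card_union_le S (S.image (· + q))
  have := Finset.card_image_le (s := S) (f := (· + q))
  unfold doubled
  omega

theorem IsChains.double (hS : IsChains n b q S) (hb : 2 * q ≤ b)
    (hsel : IsSel (fun t => t % b ≠ 0) (doubled q S) ∅ row sel row') :
    IsChains n b (2 * q) sel := by
  have hsub : sel ⊆ doubled q S := by simpa using hsel.sub_union
  refine ⟨fun t ht => ?_, fun t ht => ?_, fun t ht h => hsel.linked t ht (by simp) h⟩
  · rcases mem_doubled.1 (hsub ht) with h | ⟨s, hs, rfl⟩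
    · exact hS.div_lt t h
    · have := hS.mod_lt s hs
      rw [(add_div_mod (b := b) (t := s) (q := q) (by omega)).1]
      exact hS.div_lt s hs
  · rcases mem_doubled.1 (hsub ht) with h | ⟨s, hs, rfl⟩
    · have := hS.mod_lt t h
      omega
    · have := hS.mod_lt s hs
      rw [(add_div_mod (b := b) (t := s) (q := q) (by omega)).2]
      omega

/-- The new chains are picked among the candidates `v` and `M ^ q v`. A rejected candidate whose
predecessor was kept depends on earlier selected vectors. A continuation that was not even a
candidate either was ruled out at the previous stage or leads to a contradiction, so no possible
continuation is missed. -/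
theorem IsKrylovStage.double {M E E' : Matrix (Fin n) (Fin n) K} {row₀ : ℕ → Fin n} (hq : 0 < q)
    (h : IsKrylovStage M b q S row E) (hS : IsChains n b q S) (hb : 2 * q ≤ b)
    (hsel : IsSel (fun t => t % b ≠ 0) (doubled q S) ∅ row₀ sel row')
    (hE : IsElim (fun t => t % b ≠ 0) (krylovVec M b) (doubled q S) ∅ sel row' E') :
    IsKrylovStage M b (2 * q) sel row' E' := by
  have hsub : sel ⊆ doubled q S := by simpa using hsel.sub_union
  have hb0 : 0 < b := by omega
  have hS' := hS.double hb hsel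
  refine ⟨hE.inj, fun t ht => hE.selected t (hsub ht) ht, fun t ht htq hl hn => ?_⟩
  by_cases htL : t ∈ doubled q S
  · rcases hE.notSelected t htL hn with h' | h'
    · exact absurd (hl h'.1) h'.2
    · have := mem_span_of_support (S := {s ∈ sel | s < t}) (v := krylovVec M b) hE.inj
        (fun s hs => hE.selected s (hsub (Finset.mem_filter.1 hs).1) (Finset.mem_filter.1 hs).1)
        (hsel.injOn.mono fun s hs => (Finset.mem_filter.1 hs).1)
        (w := krylovVec M b t) fun i hi => by
          obtain ⟨s, hs, hst, hsi⟩ := h' i hi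
          exact ⟨s, Finset.mem_filter.2 ⟨hs, hst⟩, hsi⟩
      refine Submodule.span_le.2 ?_ this
      rintro _ ⟨s, hs, rfl⟩
      exact krylovVec_mem_krylovLT M (Finset.mem_filter.1 hs).2
  · have htS : t ∉ S := fun h' => htL (mem_doubled.2 (.inl h'))
    by_cases ht0 : t % b = 0
    · exact h.halt t ht (by omega) (fun h' => absurd ht0 h') htS
    obtain ⟨hd, hm⟩ := sub_one_div_mod hb0 ht0
    have hpred := hl ht0
    by_cases hpS : t - 1 ∈ S
    · have hlt := hS.mod_lt _ hpS
      rcases (show t % b ≤ q by omega).lt_or_eq with h' | h'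
      · exact h.halt t ht h' (fun _ => hpS) htS
      · exfalso
        obtain ⟨h1, h2, h3⟩ := hS.mem_of_le hb0 hpS (m := q - 1) (by omega)
        refine htL (mem_doubled.2 (.inr ⟨_, h1, ?_⟩))
        have := Nat.mod_le t b
        omega
    -- Here `t - 1 = s + q` with `s` in `S` and `s + 1` not in `S`. Going back `q - 1` places along
    -- the selected chain shows that `s + 1` is a candidate, hence of the form `u + q`. This forces
    -- `s % b = q - 1`, so that `t % b = 2 * q`, which is too large.
    · exfalso
      obtain ⟨s, hs, hst⟩ := (mem_doubled.1 (hsub hpred)).resolve_left hpS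
      have hsq := hS.mod_lt s hs
      obtain ⟨h1, h2⟩ := add_div_mod (b := b) (t := s) (q := q) (by omega)
      rw [hst, hm] at h2
      have hsS : s + 1 ∉ S := fun h' => htL (mem_doubled.2 (.inr ⟨_, h', by
        have := Nat.mod_le t b
        omega⟩))
      obtain ⟨h3, h4, h5⟩ := hS'.mem_of_le hb0 hpred (m := q - 1) (by omega)
      have hs1 : t - 1 - (q - 1) = s + 1 := by omega
      rw [hs1] at h3 h5
      rcases mem_doubled.1 (hsub h3) with h' | ⟨u, hu, hus⟩
      · exact hsS h'
      · have huq := hS.mod_lt u hu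
        obtain ⟨h6, h7⟩ := add_div_mod (b := b) (t := u) (q := q) (by omega)
        rw [hus, h5, hm] at h7
        have h8 : s % b = q - 1 := by omega
        refine hpS ?_
        have h9 : u % b = 0 := by omega
        omega

/-- The matrix `H` is block lower triangular, and its diagonal blocks are companion matrices: the
`j`-th column is the vector `e_{j-1}` if `lk j` holds, which means that `j - 1` and `j` belong to
the same block. -/
structure IsLowerCompanion (n : ℕ) (lk : ℕ → Prop) (H : Matrix (Fin n) (Fin n) K) : Prop where
  linked : ∀ i j : Fin n, lk j → H i j = if (i : ℕ) + 1 = j then 1 else 0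
  head : ∀ i j : Fin n, ¬ lk j → i < j → H i j = 0
  not_zero : ¬ lk 0
  lt : ∀ j, lk j → j < n

/-- In decreasing order of labels, dependence on earlier vectors means dependence on later indices,
which yields a lower triangular shape; the end of a chain becomes the head of a block. -/
theorem exists_antitone_enum (hS : S.card = n) :
    ∃ e : Fin n → ℕ, (∀ i, e i ∈ S) ∧ (∀ s ∈ S, ∃ i, e i = s) ∧ ∀ i j, e i < e j ↔ j < i := by
  refine ⟨fun i => S.orderEmbOfFin hS i.rev, fun i => S.orderEmbOfFin_mem hS _, fun s hs => ?_,
    fun i j => ?_⟩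
  · have : s ∈ Set.range (S.orderEmbOfFin hS) := by
      rw [Finset.range_orderEmbOfFin]; exact hs
    obtain ⟨i, hi⟩ := this
    exact ⟨i.rev, by simpa using hi⟩
  · rw [OrderEmbedding.lt_iff_lt, Fin.rev_lt_rev]

/-- The matrix of the multiplication by `M` in the basis of the chains, in decreasing order. -/
theorem IsKrylovStage.isLowerCompanion {M E V W H : Matrix (Fin n) (Fin n) K}
    (h : IsKrylovStage M b q S row E) (hS : IsChains n b q S) (hrow : Set.InjOn row S)
    (hq : n < q) (hb : q < b) {e : Fin n → ℕ} (heS : ∀ i, e i ∈ S)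
    (hsurj : ∀ s ∈ S, ∃ i, e i = s) (hanti : ∀ i j, e i < e j ↔ j < i)
    (hV : ∀ i j, V i j = krylovVec M b (e j) i) (hW : ∀ i j, W i j = E (row (e i)) j)
    (hH : H = W * (M * V)) :
    V * W = 1 ∧ M * V = V * H ∧
      IsLowerCompanion n (fun i => ∃ hi : i < n, e ⟨i, hi⟩ + 1 ∈ S) H := by
  have hinj : Function.Injective e := fun i j hij => by
    rcases lt_trichotomy i j with hlt | heq | hlt
    · exact absurd hij ((hanti j i).2 hlt).ne'
    · exact heq
    · exact absurd hij ((hanti i j).2 hlt).ne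
  have hWv : ∀ v i, W.mulVec v i = E.mulVec v (row (e i)) := by
    intro v i
    simp only [Matrix.mulVec, dotProduct, hW]
  have hVcol : ∀ j, (fun i => V i j) = krylovVec M b (e j) := fun j => by
    ext i; exact hV i j
  have hWV : W * V = 1 := by
    ext i j
    have : (W * V) i j = W.mulVec (fun i => V i j) i := rfl
    rw [this, hVcol, hWv, h.mulVec_eq _ (heS j), Pi.single_apply, Matrix.one_apply]
    congr 1
    exact propext ⟨fun h => hinj (hrow (heS i) (heS j) h), fun h => h ▸ rfl⟩
  have hVW : V * W = 1 := mul_eq_one_comm.1 hWV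
  have hHcol : ∀ i j, H i j = E.mulVec (M.mulVec (krylovVec M b (e j))) (row (e i)) := by
    intro i j
    have : H i j = W.mulVec (M.mulVec fun i => V i j) i := by rw [hH]; rfl
    rw [this, hVcol, hWv]
  have hrowinj : ∀ i j, row (e i) = row (e j) ↔ i = j :=
    fun i j => ⟨fun h => hinj (hrow (heS i) (heS j) h), fun h => h ▸ rfl⟩
  refine ⟨hVW, ?_, fun i j hj => ?_, fun i j hj hij => ?_, ?_, fun j ⟨hj, _⟩ => hj⟩
  · rw [hH, ← Matrix.mul_assoc, hVW, Matrix.one_mul]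
  · obtain ⟨hj', hmem⟩ := hj
    obtain ⟨k, hk⟩ := hsurj _ hmem
    rw [hHcol, (h.mulVec_krylovVec hS hrow hq hb (heS j)).1]
    change e j + 1 ∈ S at hmem
    change e k = e j + 1 at hk
    rw [h.mulVec_eq _ hmem, Pi.single_apply, ← hk]
    refine if_congr ((hrowinj i k).trans ?_) rfl rfl
    -- The labels `e j` and `e k = e j + 1` are consecutive integers, so no index lies strictly
    -- between `k` and `j`.
    have hkj : k < j := (hanti j k).1 (by omega)
    have hkj' : (k : ℕ) + 1 = j := by
      by_contra hne
      have hlt : (k : ℕ) + 1 < j := by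
        have : (k : ℕ) < j := hkj
        omega
      have h1 := (hanti ⟨k + 1, hlt.trans j.2⟩ k).2 (Nat.lt_succ_self (k : ℕ))
      have h2 := (hanti j ⟨k + 1, hlt.trans j.2⟩).2 hlt
      omega
    rw [Fin.ext_iff]
    omega
  · have hn : e j + 1 ∉ S := fun h' => hj ⟨j.2, h'⟩
    obtain ⟨h1, h2⟩ := h.mulVec_krylovVec hS hrow hq hb (heS j)
    rw [hHcol, h1]
    by_contra hne
    obtain ⟨s, ⟨hs, hsj⟩, hsi⟩ := support_of_mem_span (row := row)
      (fun t ht => h.mulVec_eq t ht.1) (h2 hn) _ hne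
    obtain ⟨k, rfl⟩ := hsurj s hs
    obtain rfl := (hrowinj k i).1 hsi
    have := (hanti j k).2 hij
    omega
  · rintro ⟨h0, hmem⟩
    obtain ⟨k, hk⟩ := hsurj _ hmem
    have := (hanti ⟨0, h0⟩ k).1 (by omega)
    exact absurd this (Nat.not_lt_zero _)

/-- The state of knowledge after a number of steps of the algorithm of Keller-Gehrig. -/
def KnowsStage (M : X → Matrix (Fin n) (Fin n) K) (b q : ℕ) (τ : Know X K) : Prop :=
  ∃ (S : Finset ℕ) (row : ℕ → Fin n) (E : X → Matrix (Fin n) (Fin n) K),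
    τ.KnowsMat E ∧ τ.KnowsMat (fun x => M x ^ q) ∧ IsChains n b q S ∧ Set.InjOn row S ∧
    (∀ t ∈ S, ∀ i, τ.Knows fun x => krylovVec (M x) b t i) ∧
    ∀ x ∈ τ.dom, IsKrylovStage (M x) b q S row (E x)

theorem krylovVec_add (M : Matrix (Fin n) (Fin n) K) {t : ℕ} (h : t % b + q < b) :
    krylovVec M b (t + q) = (M ^ q).mulVec (krylovVec M b t) := by
  obtain ⟨h1, h2⟩ := add_div_mod h
  rw [krylovVec, krylovVec, h1, h2, Matrix.mulVec_mulVec, ← pow_add, add_comm]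

/-- Chains of length one are the unit vectors themselves, already eliminated by the identity, so the
first stage is free. -/
theorem knowsStage_one (hn : 0 < n) (hb : 1 < b) (M : X → Matrix (Fin n) (Fin n) K) (σ : Know X K)
    (h0 : σ.Knows fun _ => 0) (h1 : σ.Knows fun _ => 1) (hM : σ.KnowsMat M) :
    KnowsStage M b 1 σ := by
  have hb0 : 0 < b := by omega
  have hmem : ∀ t, t ∈ (Finset.range n).image (b * ·) ↔ t / b < n ∧ t % b = 0 := by
    intro t
    simp only [Finset.mem_image, Finset.mem_range]
    constructor
    · rintro ⟨j, hj, rfl⟩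
      simpa [Nat.mul_div_cancel_left _ hb0] using hj
    · rintro ⟨h, h'⟩
      exact ⟨t / b, h, Nat.mul_div_cancel' (Nat.dvd_of_mod_eq_zero h')⟩
  have hvec : ∀ (M : Matrix (Fin n) (Fin n) K) t, t % b = 0 →
      krylovVec M b t = unitVec K n (t / b) := by
    intro M t ht
    rw [krylovVec, ht, pow_zero, Matrix.one_mulVec]
  refine ⟨(Finset.range n).image (b * ·), fun t => ⟨t / b % n, Nat.mod_lt _ hn⟩, fun _ => 1, ?_, ?_,
    ⟨fun t ht => ((hmem t).1 ht).1, fun t ht => by rw [((hmem t).1 ht).2]; exact one_pos,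
      fun t ht h => absurd ((hmem t).1 ht).2 h⟩, ?_, fun t ht i => ?_, fun x _ => ⟨?_, ?_, ?_⟩⟩
  · intro i j
    simp only [Matrix.one_apply]
    split_ifs
    exacts [h1, h0]
  · simpa using hM
  · intro t ht s hs hts
    obtain ⟨h1, h2⟩ := (hmem t).1 ht
    obtain ⟨h3, h4⟩ := (hmem s).1 hs
    simp only [Fin.mk.injEq, Nat.mod_eq_of_lt h1, Nat.mod_eq_of_lt h3] at hts
    rw [← Nat.div_add_mod t b, ← Nat.div_add_mod s b, h2, h4, hts]
  · have : ∀ x, krylovVec (M x) b t i = if (i : ℕ) = t / b then 1 else 0 := fun x => by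
      rw [hvec _ _ ((hmem t).1 ht).2]; rfl
    simp only [this]
    split_ifs
    exacts [h1, h0]
  · intro v w h
    simpa using h
  · intro t ht
    obtain ⟨h1, h2⟩ := (hmem t).1 ht
    rw [Matrix.one_mulVec, hvec _ _ h2]
    ext i
    simp only [unitVec, Pi.single_apply, Fin.ext_iff, Nat.mod_eq_of_lt h1]
  · intro t h1 h2 _ h3
    exact absurd ((hmem t).2 ⟨h1, by omega⟩) h3

variable [Valued K ℤᵐ⁰]

theorem HasMul.mul_square {c ω : ℝ} (hmul : HasMul X K c ω) {P : ℕ} {α β γ : Type*} [Fintype α]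
    [Fintype β] [Fintype γ] (hα : Fintype.card α ≤ 2 ^ P)
    (hβ : Fintype.card β ≤ 2 ^ P) (hγ : Fintype.card γ ≤ 2 ^ P) {σ : Know X K}
    (h0 : σ.Knows fun _ => 0) {A : X → Matrix α β K} {B : X → Matrix β γ K}
    (hA : σ.KnowsMat A) (hB : σ.KnowsMat B) :
    Learns (fun τ => τ.KnowsMat fun x => A x * B x) σ (c * ((2 : ℝ) ^ P) ^ ω) 0 := by
  have := hmul.mul (a := 1) (b := 1) Nat.one_le_two_pow (by simpa using hα) hβ
    (by simpa using hγ) h0 hA hB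
  simpa using this

variable {c ω C : ℝ} {P : ℕ}

/-- One product applies `M ^ q` to all the chains, another squares `M ^ q`, and one greedy
elimination sorts the candidates. There are at most `2 n` of these, hence the hypothesis on `P`. -/
theorem learns_stage_double (hω : 2 ≤ ω) (hc : 0 ≤ c) (hC : 2 * (c + 1) ≤ C) (hC3 : 3 ≤ C)
    (hmul : HasMul X K c ω) (hP : 2 * n ≤ 2 ^ P) (M : X → Matrix (Fin n) (Fin n) K)
    (hq : 0 < q) (hb : 2 * q ≤ b) (σ : Know X K) (h0 : σ.Knows fun _ => 0)
    (h1 : σ.Knows fun _ => 1) (h : KnowsStage M b q σ) :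
    Learns (KnowsStage M b (2 * q)) σ (2 * (c * ((2 : ℝ) ^ P) ^ ω) + dcCost C ω P P) 0 := by
  obtain ⟨S, row, E, -, hMq, hS, hrow, hvec, hst⟩ := h
  have hn : Fintype.card (Fin n) ≤ 2 ^ P := by simp; omega
  have hcard : S.card ≤ n := IsChains.injOn_card_le hrow
  refine Learns.bind_le (hmul.mul_square (A := fun x => M x ^ q)
    (B := fun x => Matrix.of fun (i : Fin n) (t : S) => krylovVec (M x) b t i) hn hn
    (by simp; omega) h0 hMq fun i t => hvec t t.2 i)
    (f' := c * ((2 : ℝ) ^ P) ^ ω + dcCost C ω P P) (z' := 0) (fun τ₁ hτ₁ hQ₁ => ?_)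
    (by linarith) (add_zero 0).le
  refine Learns.bind_le (hmul.mul_square hn hn hn (h0.mono hτ₁) (hMq.mono hτ₁) (hMq.mono hτ₁))
    (fun τ₂ hτ₂ hQ₂ => ?_) le_rfl (add_zero 0).le
  have hσ₂ := hτ₁.trans hτ₂
  have hvec' : ∀ t ∈ doubled q S, ∀ i, τ₂.Knows fun x => krylovVec (M x) b t i := by
    intro t ht i
    rcases mem_doubled.1 ht with ht | ⟨s, hs, rfl⟩
    · exact (hvec t ht i).mono hσ₂
    · have := hS.mod_lt s hs
      refine ((hQ₁ i ⟨s, hs⟩).mono hτ₂).congr fun x _ => ?_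
      rw [krylovVec_add (M x) (by omega)]
      rfl
  refine (learns_elim hω hc hC hC3 hmul (fun t => t % b ≠ 0) hn P le_rfl (doubled q S)
    (card_doubled_le.trans (by omega)) ∅ row (by simp) (by simp)
    (fun t x => krylovVec (M x) b t) τ₂ (h0.mono hσ₂) (h1.mono hσ₂) hvec').imp ?_
  rintro τ₃ hτ₃ ⟨sel, row', E', kE', hsel, hE'⟩
  refine ⟨sel, row', E', kE', fun i j => ?_, hS.double hb hsel, hsel.injOn, fun t ht i => ?_,
    fun x hx => (hst x ((hσ₂.trans hτ₃).1 hx)).double hq hS hb hsel (hE' x hx)⟩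
  · refine ((hQ₂ i j).mono hτ₃).congr fun x _ => ?_
    beta_reduce
    rw [two_mul, pow_add]
  · have hsub : sel ⊆ doubled q S := by simpa using hsel.sub_union
    exact (hvec' t (hsub ht) i).mono hτ₃

/-- Reduction to a block triangular matrix with companion blocks on the diagonal. -/
theorem learns_lowerCompanion (hω : 2 ≤ ω) (hc : 0 ≤ c) (hC : 2 * (c + 1) ≤ C) (hC3 : 3 ≤ C)
    (hmul : HasMul X K c ω) (hn : 0 < n) (hP : 2 * n ≤ 2 ^ P) (M : X → Matrix (Fin n) (Fin n) K)
    (σ : Know X K) (h0 : σ.Knows fun _ => 0) (h1 : σ.Knows fun _ => 1) (hM : σ.KnowsMat M) :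
    Learns (fun τ => ∃ (V W H : X → Matrix (Fin n) (Fin n) K) (lk : ℕ → Prop),
      τ.KnowsMat V ∧ τ.KnowsMat H ∧ ∀ x ∈ τ.dom, V x * W x = 1 ∧ M x * V x = V x * H x ∧
        IsLowerCompanion n lk (H x)) σ
      (P * (2 * (c * ((2 : ℝ) ^ P) ^ ω) + dcCost C ω P P) + 2 * (c * ((2 : ℝ) ^ P) ^ ω)) 0 := by
  have hcard : Fintype.card (Fin n) ≤ 2 ^ P := by simp; omega
  -- The modulus exceeds the final length `2 ^ P` by one, so that the successor of a label never
  -- runs into the next chain.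
  have hstage : ∀ i ≤ P, Learns (fun τ => KnowsStage M (2 ^ P + 1) (2 ^ i) τ) σ
      (i * (2 * (c * ((2 : ℝ) ^ P) ^ ω) + dcCost C ω P P)) 0 := by
    intro i
    induction i with
    | zero =>
      exact fun _ => .done (by simp) le_rfl (knowsStage_one hn
        (by have := Nat.one_le_two_pow (n := P); omega) M σ h0 h1 hM)
    | succ i ih =>
      intro hi
      refine Learns.bind_le (ih (by omega)) (fun τ hτ hQ => ?_) (f' :=
        2 * (c * ((2 : ℝ) ^ P) ^ ω) + dcCost C ω P P) (z' := 0) (by push_cast; linarith)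
        (add_zero 0).le
      rw [pow_succ']
      have : 2 ^ (i + 1) ≤ 2 ^ P := Nat.pow_le_pow_right (by norm_num) hi
      exact learns_stage_double hω hc hC hC3 hmul hP M (by positivity) (by omega) τ (h0.mono hτ)
        (h1.mono hτ) hQ
  refine Learns.bind_le (hstage P le_rfl) (fun τ₁ hτ₁ hQ₁ => ?_) le_rfl (add_zero 0).le
  obtain ⟨S, row, E, kE, -, hS, hrow, hvec, hst⟩ := hQ₁
  have hq : n < 2 ^ P := by omega
  rcases τ₁.dom.eq_empty_or_nonempty with hempty | ⟨x₀, hx₀⟩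
  · exact .empty hempty
  obtain ⟨e, heS, hsurj, hanti⟩ := exists_antitone_enum
    ((hst x₀ hx₀).card_eq hrow hq (Nat.le_succ _))
  let V : X → Matrix (Fin n) (Fin n) K := fun x => Matrix.of fun i j => krylovVec (M x) (2 ^ P + 1) (e j) i
  let W : X → Matrix (Fin n) (Fin n) K := fun x => Matrix.of fun i j => E x (row (e i)) j
  have kV : τ₁.KnowsMat V := fun i j => hvec _ (heS j) i
  have kW : τ₁.KnowsMat W := fun i j => kE _ j
  refine Learns.bind_le (hmul.mul_square hcard hcard hcard (h0.mono hτ₁) (hM.mono hτ₁) kV)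
    (fun τ₂ hτ₂ hQ₂ => ?_) (by linarith) (add_zero 0).le (f' := c * ((2 : ℝ) ^ P) ^ ω)
  refine (hmul.mul_square hcard hcard hcard (h0.mono (hτ₁.trans hτ₂)) (kW.mono hτ₂) hQ₂).imp
    fun τ₃ hτ₃ hQ₃ => ?_
  refine ⟨V, W, fun x => W x * (M x * V x),
    fun i => ∃ hi : i < n, e ⟨i, hi⟩ + 1 ∈ S, kV.mono (hτ₂.trans hτ₃), hQ₃, fun x hx => ?_⟩
  exact (hst x ((hτ₂.trans hτ₃).1 hx)).isLowerCompanion hS hrow hq (Nat.lt_succ_self _) heS hsurj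
    hanti (fun _ _ => rfl) (fun _ _ => rfl) rfl

end

end PadicEigen

end

noncomputable section

open Polynomial
open scoped WithZero

namespace PadicEigen

open Know

/-! ### Eigenvectors of a block triangular matrix with companion blocks -/

/-- Since `F i` looks only at values below `i`, strong recursion with a default value elsewhere
solves the system. -/
theorem exists_strongRec {α : Type*} [Inhabited α] (F : ℕ → (ℕ → α) → α)
    (hF : ∀ i f g, (∀ j < i, f j = g j) → F i f = F i g) : ∃ Y : ℕ → α, ∀ i, Y i = F i Y := by
  classical
  let Y : ℕ → α := fun i => Nat.strongRec (motive := fun _ => α)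
    (fun i ih => F i fun j => if h : j < i then ih j h else default) i
  refine ⟨Y, fun i => ?_⟩
  have : Y i = F i fun j => if j < i then Y j else default := by
    simp only [Y]
    rw [Nat.strongRec]
    rfl
  rw [this]
  exact hF _ _ _ fun j hj => if_pos hj

/-! ### Heads and ends of blocks -/

section Blocks

variable (lk : ℕ → Prop)

open Classical in
/-- The first index of the block of `i`. -/
def blockHead : ℕ → ℕ
  | 0 => 0
  | i + 1 => if lk (i + 1) then blockHead i else i + 1

theorem blockHead_le (i : ℕ) : blockHead lk i ≤ i := by
  induction i with
  | zero => rfl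
  | succ i ih => rw [blockHead]; split_ifs <;> omega

variable {lk}

theorem blockHead_of_not {i : ℕ} (h : ¬ lk i) : blockHead lk i = i := by
  cases i with
  | zero => rfl
  | succ i => rw [blockHead, if_neg h]

theorem not_lk_blockHead (h0 : ¬ lk 0) (i : ℕ) : ¬ lk (blockHead lk i) := by
  induction i with
  | zero => exact h0
  | succ i ih =>
    rw [blockHead]
    split_ifs with h
    exacts [ih, h]

open Classical in
/-- A sum over the heads of blocks is a sum over the ends of blocks. -/
theorem sum_heads {K : Type*} [AddCommMonoid K] (h0 : ¬ lk 0) (f : ℕ → K) (i : ℕ) :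
    ∑ j ∈ Finset.range (i + 1), (if lk j then 0 else f j) = f (blockHead lk i) +
      ∑ e ∈ Finset.range i, if lk (e + 1) then 0 else f (blockHead lk e) := by
  induction i with
  | zero => simp [h0, blockHead]
  | succ i ih =>
    rw [Finset.sum_range_succ, ih, Finset.sum_range_succ _ i, blockHead]
    by_cases h : lk (i + 1)
    · simp [h]
    · simp only [h, if_false]
      rw [add_comm, add_comm (f (blockHead lk i))]

variable {n : ℕ}

theorem exists_blockEnd (hlt : ∀ j, lk j → j < n) (i : ℕ) : ∃ d, ¬ lk (i + d + 1) :=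
  ⟨n, fun h => by have := hlt _ h; omega⟩

open Classical in
/-- The last index of the block of `i`. -/
def blockEnd (hlt : ∀ j, lk j → j < n) (i : ℕ) : ℕ := i + Nat.find (exists_blockEnd hlt i)

variable {hlt : ∀ j, lk j → j < n}

theorem blockEnd_of_not {i : ℕ} (h : ¬ lk (i + 1)) : blockEnd hlt i = i := by
  classical
  have : Nat.find (exists_blockEnd hlt i) = 0 := (Nat.find_eq_zero _).2 h
  rw [blockEnd, this, add_zero]

theorem not_lk_blockEnd (i : ℕ) : ¬ lk (blockEnd hlt i + 1) := by
  classical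
  exact Nat.find_spec (exists_blockEnd hlt i)

theorem blockEnd_of_lk {i : ℕ} (h : lk (i + 1)) : blockEnd hlt i = blockEnd hlt (i + 1) := by
  classical
  have h1 := Nat.find_comp_succ (exists_blockEnd hlt i)
    (by obtain ⟨d, hd⟩ := exists_blockEnd hlt (i + 1)
        exact ⟨d, by rwa [show i + (d + 1) + 1 = i + 1 + d + 1 by ring]⟩) (by simpa using h)
  rw [blockEnd, h1, blockEnd]
  have : ∀ d, i + (d + 1) + 1 = i + 1 + d + 1 := fun d => by ring
  simp only [this]
  ring

theorem blockEnd_lt {i : ℕ} (hi : i < n) : blockEnd hlt i < n := by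
  classical
  by_contra h
  have : Nat.find (exists_blockEnd hlt i) ≤ n - 1 - i := Nat.find_min' _ fun h' => by
    have := hlt _ h'
    omega
  rw [blockEnd] at h
  omega

theorem blockEnd_blockHead (i : ℕ) : blockEnd hlt (blockHead lk i) = blockEnd hlt i := by
  induction i with
  | zero => rfl
  | succ i ih =>
    rw [blockHead]
    split_ifs with h
    · rw [ih, blockEnd_of_lk h]
    · rfl

end Blocks

/-! ### Recurrences for the coordinates of an eigenvector -/

section Solution

variable {K : Type*} [Field K]

open Classical in
/-- The solution of the homogeneous recurrence in each block, started with `1`. -/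
def homSol (lk : ℕ → Prop) (h : ℕ → ℕ → K) (z : K) : ℕ → K
  | 0 => 1
  | i + 1 => if lk (i + 1) then z * homSol lk h z i - h i (blockHead lk i) else 1

/-- The continuation of the homogeneous recurrence; at the end of a block, this is the value at `z`
of the characteristic polynomial of the block. -/
def homNext (lk : ℕ → Prop) (h : ℕ → ℕ → K) (z : K) (i : ℕ) : K :=
  z * homSol lk h z i - h i (blockHead lk i)

/-- The contribution of the previous blocks to row `i`. -/
def carry (lk : ℕ → Prop) (h : ℕ → ℕ → K) (Y : ℕ → K) (i : ℕ) : K :=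
  ∑ e ∈ Finset.range i, h i (blockHead lk e) * Y e

open Classical in
/-- The solution of the inhomogeneous recurrence in each block, started with `0`. -/
def inhomSol (lk : ℕ → Prop) (h : ℕ → ℕ → K) (z : K) (Y : ℕ → K) : ℕ → K
  | 0 => 0
  | i + 1 => if lk (i + 1) then z * inhomSol lk h z Y i + carry lk h Y i else 0

/-- The continuation of the inhomogeneous recurrence. -/
def inhomNext (lk : ℕ → Prop) (h : ℕ → ℕ → K) (z : K) (Y : ℕ → K) (i : ℕ) : K :=
  z * inhomSol lk h z Y i + carry lk h Y i

/-- The index `e` is the end of a block whose characteristic polynomial vanishes at `z`. -/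
def IsRootEnd (n : ℕ) (lk : ℕ → Prop) (h : ℕ → ℕ → K) (z : K) (e : ℕ) : Prop :=
  e < n ∧ ¬ lk (e + 1) ∧ homNext lk h z e = 0

open Classical in
/-- The first coordinate in its block of an eigenvector, at the last index of the block. -/
def stepSol (n : ℕ) (lk : ℕ → Prop) (h : ℕ → ℕ → K) (z : K) (i : ℕ) (Y : ℕ → K) : K :=
  if lk (i + 1) then 0
  else if ∃ e, i < e ∧ IsRootEnd n lk h z e then 0
  else if homNext lk h z i = 0 then 1
  else inhomNext lk h z Y i / homNext lk h z i

variable {n : ℕ} {lk : ℕ → Prop} {h : ℕ → ℕ → K} {z : K} {Y Y' : ℕ → K}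

theorem carry_congr {i : ℕ} (hY : ∀ j < i, Y j = Y' j) : carry lk h Y i = carry lk h Y' i :=
  Finset.sum_congr rfl fun e he => by rw [hY e (Finset.mem_range.1 he)]

theorem inhomSol_congr {i : ℕ} (hY : ∀ j < i, Y j = Y' j) :
    inhomSol lk h z Y i = inhomSol lk h z Y' i := by
  induction i with
  | zero => rfl
  | succ i ih =>
    rw [inhomSol, inhomSol, ih fun j hj => hY j (by omega),
      carry_congr fun j hj => hY j (by omega)]

theorem inhomNext_congr {i : ℕ} (hY : ∀ j < i, Y j = Y' j) :
    inhomNext lk h z Y i = inhomNext lk h z Y' i := by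
  rw [inhomNext, inhomNext, inhomSol_congr hY, carry_congr hY]

theorem inhomNext_zero (i : ℕ) : inhomNext lk h z (fun _ => 0) i = 0 := by
  have h1 : ∀ i, carry lk h (fun _ => 0) i = 0 := fun i => by simp [carry]
  have h2 : ∀ i, inhomSol lk h z (fun _ => 0) i = 0 := by
    intro i
    induction i with
    | zero => rfl
    | succ i ih => rw [inhomSol, ih, h1]; simp
  rw [inhomNext, h1, h2]
  simp

variable (n lk h z) in
theorem exists_sol : ∃ Y : ℕ → K, ∀ i, Y i = stepSol n lk h z i Y :=
  haveI : Inhabited K := ⟨0⟩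
  exists_strongRec _ fun i f g hfg => by
    rw [stepSol, stepSol, inhomNext_congr hfg]

/-- An eigenvector, given by its first coordinates in each block. -/
def eigSol (hlt : ∀ j, lk j → j < n) (h : ℕ → ℕ → K) (z : K) (Y : ℕ → K) (i : ℕ) : K :=
  Y (blockEnd hlt i) * homSol lk h z i - inhomSol lk h z Y i

theorem homSol_of_not {i : ℕ} (hi : ¬ lk i) : homSol lk h z i = 1 := by
  cases i with
  | zero => rfl
  | succ i => rw [homSol, if_neg hi]

theorem inhomSol_of_not {i : ℕ} (hi : ¬ lk i) : inhomSol lk h z Y i = 0 := by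
  cases i with
  | zero => rfl
  | succ i => rw [inhomSol, if_neg hi]

variable {hlt : ∀ j, lk j → j < n}

theorem eigSol_blockHead (h0 : ¬ lk 0) (i : ℕ) :
    eigSol hlt h z Y (blockHead lk i) = Y (blockEnd hlt i) := by
  rw [eigSol, homSol_of_not (not_lk_blockHead h0 i), inhomSol_of_not (not_lk_blockHead h0 i),
    blockEnd_blockHead, mul_one, sub_zero]

/-- The eigenvector equation in the last row of a block. Up to the last block with root `z`, all
previous coordinates are zero and so is the right side; the left side vanishes because `Y i = 0` or,
at the root itself, because `homNext` does. After that block, `Y i` is defined by the division. -/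
theorem stop_eq (hY : ∀ i, Y i = stepSol n lk h z i Y) {i : ℕ} (hi : i < n) (hl : ¬ lk (i + 1)) :
    Y i * homNext lk h z i = inhomNext lk h z Y i := by
  classical
  by_cases hroot : ∃ e, i ≤ e ∧ IsRootEnd n lk h z e
  · obtain ⟨e, he, hr⟩ := hroot
    have hzero : ∀ j < i, Y j = 0 := fun j hj => by
      rw [hY, stepSol]
      split_ifs with h1 h2 h3
      · rfl
      · rfl
      all_goals exact absurd ⟨e, by omega, hr⟩ h2
    rw [inhomNext_congr (Y' := fun _ => 0) hzero, inhomNext_zero]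
    rcases he.eq_or_lt with rfl | he
    · rw [hr.2.2, mul_zero]
    · rw [hY, stepSol, if_neg hl, if_pos ⟨e, he, hr⟩, zero_mul]
  · have h1 : ¬ ∃ e, i < e ∧ IsRootEnd n lk h z e := fun ⟨e, he, hr⟩ => hroot ⟨e, he.le, hr⟩
    have h2 : homNext lk h z i ≠ 0 := fun h2 => hroot ⟨i, le_rfl, hi, hl, h2⟩
    rw [hY, stepSol, if_neg hl, if_neg h1, if_neg h2, div_mul_cancel₀ _ h2]

/-- Extension by zero of a matrix. -/
def natEntry (H : Matrix (Fin n) (Fin n) K) (i j : ℕ) : K :=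
  if hij : i < n ∧ j < n then H ⟨i, hij.1⟩ ⟨j, hij.2⟩ else 0

-- Each row of `H` meets three kinds of columns: the linked column `i + 1`, the head of the block of
-- `i`, and the heads of earlier blocks. The last are indexed by the ends of their blocks, where `Y`
-- stores the unknowns.
open Classical in
theorem IsLowerCompanion.mulVec_eq {H : Matrix (Fin n) (Fin n) K} (hH : IsLowerCompanion n lk H)
    (u : ℕ → K) {i : ℕ} (hi : i < n) : H.mulVec (fun j => u j) ⟨i, hi⟩ =
      (if lk (i + 1) then u (i + 1) else 0) + (natEntry H i (blockHead lk i) * u (blockHead lk i) +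
        ∑ e ∈ Finset.range i,
          if lk (e + 1) then 0 else natEntry H i (blockHead lk e) * u (blockHead lk e)) := by
  have h1 : H.mulVec (fun j => u j) ⟨i, hi⟩ = ∑ j ∈ Finset.range n, natEntry H i j * u j := by
    rw [Finset.sum_range, Matrix.mulVec, dotProduct]
    refine Finset.sum_congr rfl fun j _ => ?_
    rw [natEntry, dif_pos ⟨hi, j.2⟩]
  have h2 : ∀ j ∈ Finset.range n, natEntry H i j * u j =
      (if j = i + 1 then (if lk j then u j else 0) else 0) +
        if j < i + 1 then (if lk j then 0 else natEntry H i j * u j) else 0 := by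
    intro j hj
    have hj' := Finset.mem_range.1 hj
    rw [natEntry, dif_pos ⟨hi, hj'⟩]
    by_cases hl : lk j
    · rw [hH.linked ⟨i, hi⟩ ⟨j, hj'⟩ hl]
      by_cases hji : j = i + 1
      · subst hji
        simp [hl]
      · simp [hl, hji, Ne.symm hji]
    · rcases lt_or_ge i j with hij | hij
      · rw [hH.head ⟨i, hi⟩ ⟨j, hj'⟩ hl hij]
        have : ¬ j < i + 1 := by omega
        simp [hl, this]
      · have : j < i + 1 := by omega
        simp [hl, this]
  rw [h1, Finset.sum_congr rfl h2, Finset.sum_add_distrib,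
    ← sum_heads hH.not_zero (fun j => natEntry H i j * u j)]
  congr 1
  · rw [Finset.sum_ite_eq']
    by_cases hl : lk (i + 1)
    · simp [hH.lt _ hl]
    · simp [hl]
  · rw [← Finset.sum_filter]
    congr 1
    ext j
    simp only [Finset.mem_filter, Finset.mem_range]
    omega

/-- A row inside a block is one step of the recurrences for `homSol` and `inhomSol`; the last row of
a block is `stop_eq`. -/
theorem IsLowerCompanion.mulVec_eigSol {H : Matrix (Fin n) (Fin n) K}
    (hH : IsLowerCompanion n lk H) (hY : ∀ i, Y i = stepSol n lk (natEntry H) z i Y) :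
    H.mulVec (fun i => eigSol hH.lt (natEntry H) z Y i) =
      z • fun i : Fin n => eigSol hH.lt (natEntry H) z Y i := by
  classical
  ext ⟨i, hi⟩
  have hsum : ∑ e ∈ Finset.range i, (if lk (e + 1) then 0 else natEntry H i (blockHead lk e) *
      eigSol hH.lt (natEntry H) z Y (blockHead lk e)) = carry lk (natEntry H) Y i := by
    refine Finset.sum_congr rfl fun e _ => ?_
    split_ifs with he
    · rw [hY, stepSol, if_pos he, mul_zero]
    · rw [eigSol_blockHead hH.not_zero, blockEnd_of_not he]
  rw [hH.mulVec_eq _ hi, hsum, eigSol_blockHead hH.not_zero, Pi.smul_apply, smul_eq_mul]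
  by_cases hl : lk (i + 1)
  · rw [if_pos hl]
    simp only [eigSol, homSol, inhomSol, if_pos hl, ← blockEnd_of_lk (hlt := hH.lt) hl]
    ring
  · have := stop_eq hY hi hl
    rw [if_neg hl]
    simp only [eigSol, blockEnd_of_not (hlt := hH.lt) hl, homNext, inhomNext] at this ⊢
    linear_combination -this

/-- At the head of the last block with root `z`, the coordinate was chosen to be `1`. -/
theorem IsLowerCompanion.eigSol_ne_zero {H : Matrix (Fin n) (Fin n) K}
    (hH : IsLowerCompanion n lk H) (hY : ∀ i, Y i = stepSol n lk (natEntry H) z i Y)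
    (hr : ∃ e, IsRootEnd n lk (natEntry H) z e) :
    (fun i : Fin n => eigSol hH.lt (natEntry H) z Y i) ≠ 0 := by
  classical
  have hmax : ∃ e, IsRootEnd n lk (natEntry H) z e ∧
      ¬ ∃ e', e < e' ∧ IsRootEnd n lk (natEntry H) z e' := by
    obtain ⟨e, he⟩ := hr
    have hs : ((Finset.range n).filter (IsRootEnd n lk (natEntry H) z)).Nonempty :=
      ⟨e, Finset.mem_filter.2 ⟨Finset.mem_range.2 he.1, he⟩⟩
    refine ⟨_, (Finset.mem_filter.1 (Finset.max'_mem _ hs)).2, fun ⟨e', he', hr'⟩ => ?_⟩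
    exact absurd (Finset.le_max' _ e' (Finset.mem_filter.2 ⟨Finset.mem_range.2 hr'.1, hr'⟩))
      (not_le.2 he')
  obtain ⟨e, ⟨he, hl, h0⟩, hmax⟩ := hmax
  intro hzero
  have := congrFun hzero ⟨blockHead lk e, (blockHead_le lk e).trans_lt he⟩
  simp only [eigSol_blockHead hH.not_zero, blockEnd_of_not hl, Pi.zero_apply] at this
  rw [hY, stepSol, if_neg hl, if_neg hmax, if_pos h0] at this
  exact one_ne_zero this

/-- The first nonzero coordinate `u m` of an eigenvector is at the head of a block, since the
preceding row determines any other coordinate from zeros. In that block nothing comes from earlier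
blocks, so the coordinates are `u m` times `homSol`, and the last row says that `homNext` vanishes.
-/
theorem IsLowerCompanion.exists_isRootEnd {H : Matrix (Fin n) (Fin n) K}
    (hH : IsLowerCompanion n lk H) {v : Fin n → K} (hv : v ≠ 0) (hHv : H.mulVec v = z • v) :
    ∃ e, IsRootEnd n lk (natEntry H) z e := by
  classical
  let u : ℕ → K := fun i => if hi : i < n then v ⟨i, hi⟩ else 0
  have huv : (fun j : Fin n => u j) = v := by
    ext j; simp [u]
  have hrow : ∀ i < n, z * u i = (if lk (i + 1) then u (i + 1) else 0) +
      (natEntry H i (blockHead lk i) * u (blockHead lk i) + ∑ e ∈ Finset.range i,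
          if lk (e + 1) then 0 else natEntry H i (blockHead lk e) * u (blockHead lk e)) := by
    intro i hi
    rw [← hH.mulVec_eq u hi, huv, hHv]
    simp [u, hi]
  have hex : ∃ i, u i ≠ 0 := by
    by_contra hcon
    push Not at hcon
    exact hv (huv ▸ funext fun j => hcon j)
  set m := Nat.find hex with hm
  have hum : u m ≠ 0 := Nat.find_spec hex
  have hlow : ∀ j < m, u j = 0 := fun j hj => not_not.1 (Nat.find_min hex hj)
  have hmn : m < n := by
    by_contra hcon
    exact hum (by simp [u, hcon])
  have hml : ¬ lk m := by
    intro hl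
    obtain ⟨m', hm'⟩ : ∃ m', m = m' + 1 := Nat.exists_eq_succ_of_ne_zero
      (fun h => hH.not_zero (h ▸ hl))
    have := hrow m' (by omega)
    rw [← hm', if_pos hl, hlow m' (by omega), hlow (blockHead lk m')
      (by have := blockHead_le lk m'; omega), Finset.sum_eq_zero fun e he => by
        rw [hlow (blockHead lk e) (by
          have := blockHead_le lk e; have := Finset.mem_range.1 he; omega)]
        simp] at this
    exact hum (by simpa using this.symm)
  have hlast : ∀ d, (∀ t, m < t → t ≤ m + d → lk t) → blockHead lk (m + d) = m → m + d < n →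
      z * u (m + d) =
        (if lk (m + d + 1) then u (m + d + 1) else 0) + natEntry H (m + d) m * u m := by
    intro d hd hh hn
    have := hrow (m + d) hn
    rwa [hh, Finset.sum_eq_zero fun e he => ?_, add_zero] at this
    split_ifs with hl
    · rfl
    · have he' := Finset.mem_range.1 he
      have : e < m := by
        by_contra hcon
        exact hl (hd _ (by omega) (by omega))
      rw [hlow _ ((blockHead_le lk e).trans_lt this), mul_zero]
  have hblock : ∀ d, (∀ t, m < t → t ≤ m + d → lk t) → blockHead lk (m + d) = m ∧
      u (m + d) = u m * homSol lk (natEntry H) z (m + d) := by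
    intro d
    induction d with
    | zero => exact fun _ => ⟨blockHead_of_not hml, by rw [add_zero, homSol_of_not hml, mul_one]⟩
    | succ d ih =>
      intro hd
      have hlk : lk (m + d + 1) := hd _ (by omega) (by omega)
      have hd' : ∀ t, m < t → t ≤ m + d → lk t := fun t ht ht' => hd t ht (by omega)
      have hn := hH.lt _ hlk
      obtain ⟨h1, h2⟩ := ih hd'
      have h3 := hlast d hd' h1 (by omega)
      rw [if_pos hlk, h2] at h3
      refine ⟨by rw [← add_assoc, blockHead, if_pos hlk, h1], ?_⟩
      rw [← add_assoc, homSol, if_pos hlk, h1]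
      linear_combination -h3
  have hend := not_lk_blockEnd (hlt := hH.lt) m
  have hendn := blockEnd_lt (hlt := hH.lt) hmn
  have hmin : ∀ t, m < t → t ≤ m + Nat.find (exists_blockEnd hH.lt m) → lk t := by
    intro t ht ht'
    have := Nat.find_min (exists_blockEnd hH.lt m) (m := t - m - 1) (by omega)
    rw [show m + (t - m - 1) + 1 = t by omega] at this
    exact not_not.1 this
  obtain ⟨h1, h2⟩ := hblock _ hmin
  have h4 := hlast _ hmin h1 hendn
  have hend' : ¬ lk (m + Nat.find (exists_blockEnd hH.lt m) + 1) := hend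
  refine ⟨blockEnd hH.lt m, hendn, hend, ?_⟩
  rw [if_neg hend', zero_add, h2] at h4
  rw [homNext, blockEnd, h1]
  refine (mul_eq_zero.1 ?_).resolve_left hum
  linear_combination h4

end Solution

end PadicEigen

end

noncomputable section

open Polynomial
open scoped WithZero

namespace PadicEigen

open Know

variable {X K : Type*} [Field K] [Valued K ℤᵐ⁰]

/-! ### Computation of eigenvectors -/

/-- Online multiplication: the rows of `Y` are computed one after the other, and the computation of
row `i` uses the row `∑ e < i, G i e * Y e`. -/
theorem learns_online {c ω C : ℝ} (hω : 2 ≤ ω) (hc : 0 ≤ c) (hC : 2 * (c + 1) ≤ C) (hC3 : 3 ≤ C)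
    (hmul : HasMul X K c ω) {P n s : ℕ} (hs : s ≤ 2 ^ P) (G : X → ℕ → ℕ → K)
    (Y : X → ℕ → Fin s → K) (D : ℕ → Know X K → Prop)
    (hD : ∀ i, ∀ ⦃τ τ' : Know X K⦄, τ ≤ τ' → D i τ → D i τ')
    (hDY : ∀ i τ, D i τ → ∀ k, τ.Knows fun x => Y x i k) (σ : Know X K)
    (h0 : σ.Knows fun _ => 0) (hG : ∀ i e, e < i → i < n → σ.Knows fun x => G x i e)
    (step : ∀ i < n, ∀ τ, σ ≤ τ → (∀ e < i, D e τ) →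
      (∀ k, τ.Knows fun x => ∑ e ∈ Finset.range i, G x i e * Y x e k) →
      Learns (D i) τ (3 * 2 ^ P) 0) :
    ∀ p ≤ P, ∀ a τ, σ ≤ τ → (∀ e < a, e < n → D e τ) →
      (∀ i, a ≤ i → i < a + 2 ^ p → i < n → ∀ k,
        τ.Knows fun x => ∑ e ∈ Finset.range a, G x i e * Y x e k) →
      Learns (fun τ => ∀ e < a + 2 ^ p, e < n → D e τ) τ (dcCost C ω P p) 0 := by
  intro p
  induction p with
  | zero =>
    intro _ a τ hτ hDa hacc
    rw [dcCost_zero]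
    by_cases ha : a < n
    · refine ((step a ha τ hτ (fun e he => hDa e he (he.trans ha))
        (hacc a le_rfl (by simp) ha)).le_cost (by gcongr) le_rfl).imp fun τ' hτ' h e he hen => ?_
      rcases (show e ≤ a by simpa [Nat.lt_succ_iff] using he).lt_or_eq with h' | rfl
      · exact hD e hτ' (hDa e h' hen)
      · exact h
    · refine .done (by positivity) le_rfl fun e he hen => hDa e (by omega) hen
  | succ p ih =>
    intro hp a τ hτ hDa hacc
    have hw : 1 ≤ 2 ^ p := Nat.one_le_two_pow
    have hpow : 2 ^ (p + 1) = 2 ^ p + 2 ^ p := by rw [pow_succ]; ring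
    refine Learns.bind_le (f' := dcCost C ω P p + 2 * (2 ^ (P - p) * (c * ((2 : ℝ) ^ p) ^ ω) +
      2 ^ P * 2 ^ p)) (z' := 0) (ih (by omega) a τ hτ hDa fun i h1 h2 => hacc i h1 (by omega))
      (fun τ₁ hτ₁ hQ₁ => ?_) (by linarith [dcCost_succ hω hC hc (show p < P by omega)])
      (add_zero 0).le
    by_cases han : a + 2 ^ p < n
    swap
    · have hd := dcCost_nonneg (show 0 ≤ C by linarith) ω P p
      exact .done (by positivity) le_rfl fun e he hen => hQ₁ e (by omega) hen
    have hsw : Fintype.card (Fin s) ≤ 2 ^ (P - p) * 2 ^ p := by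
      rw [← pow_add, Nat.sub_add_cancel (by omega)]; simpa using hs
    have hσ₁ := hτ.trans hτ₁
    -- The rows just found contribute to the following `2 ^ p` rows through one square block of `G`,
    -- padded with zeros beyond row `n`. Adding this product extends the accumulated sums from `a`
    -- to `a + 2 ^ p` terms, as the second call requires.
    refine Learns.bind_le (f' := dcCost C ω P p + (2 ^ P * 2 ^ p)) (z' := 0) (hmul.mul
      (α := Fin (2 ^ p)) (β := Fin (2 ^ p)) (γ := Fin s) (a := 1) (b := 2 ^ (P - p)) hw
      (by simp) (by simp) hsw (h0.mono hσ₁)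
      (A := fun x => Matrix.of fun i e => if a + 2 ^ p + i < n then G x (a + 2 ^ p + i) (a + e) else 0)
      (B := fun x => Matrix.of fun e k => Y x (a + e) k) ?_ ?_) (fun τ₂ hτ₂ hQ₂ => ?_) ?_
      (add_zero 0).le
    · intro i e
      by_cases h : a + 2 ^ p + i < n
      · simp only [Matrix.of_apply, if_pos h]
        exact (hG _ _ (by omega) h).mono hσ₁
      · simp only [Matrix.of_apply, if_neg h]
        exact h0.mono hσ₁
    · intro e k
      exact hDY _ _ (hQ₁ (a + e) (by omega) (by omega)) k
    · refine Learns.bind_le (Learns.pi_knows (σ := τ₂) (ι := Fin (2 ^ p) × Fin s) (f := 1) (z := 0)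
        (fun q x => if a + 2 ^ p + q.1 < n then ∑ e ∈ Finset.range (a + 2 ^ p),
          G x (a + 2 ^ p + q.1) e * Y x e q.2 else 0) fun q τ' hτ' => ?_)
        (fun τ₃ hτ₃ hQ₃ => ?_) (f' := dcCost C ω P p) (z' := 0) ?_ (by simp)
      · by_cases h : a + 2 ^ p + q.1 < n
        · simp only [if_pos h]
          refine (Learns.knows_add ((hacc (a + 2 ^ p + q.1) (by omega) (by omega) h q.2).mono
            (hτ₁.trans (hτ₂.trans hτ'))) ((hQ₂ q.1 q.2).mono hτ')).imp
            fun τ'' _ hQ => hQ.congr fun x _ => ?_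
          beta_reduce
          rw [Finset.sum_range_add, Matrix.mul_apply, Finset.sum_range (n := 2 ^ p)]
          simp [if_pos h]
        · simp only [if_neg h]
          exact .done zero_le_one le_rfl (h0.mono (hσ₁.trans (hτ₂.trans hτ')))
      · have hσ₃ := hσ₁.trans (hτ₂.trans hτ₃)
        refine (ih (by omega) (a + 2 ^ p) τ₃ hσ₃
          (fun e he hen => hD e (hτ₂.trans hτ₃) (hQ₁ e he hen)) fun i h1 h2 h3 k => ?_).imp
          fun τ₄ _ hQ e he hen => hQ e (by omega) hen
        obtain ⟨q, rfl⟩ := Nat.exists_eq_add_of_le h1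
        have := hQ₃ (⟨q, by omega⟩, k)
        simpa only [if_pos h3] using this
      · have hsr : (s : ℝ) ≤ 2 ^ P := by exact_mod_cast hs
        simp only [Fintype.card_prod, Fintype.card_fin, Nat.cast_mul, Nat.cast_pow,
          Nat.cast_ofNat, mul_one]
        have : (2 : ℝ) ^ p * s ≤ 2 ^ P * 2 ^ p := by rw [mul_comm]; gcongr
        linarith
    · push_cast
      have : 0 ≤ (2 : ℝ) ^ (P - p) * (c * (2 ^ p) ^ ω) := by positivity
      have : 0 ≤ (2 : ℝ) ^ P * 2 ^ p := by positivity
      linarith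

/-- The eigenvectors for several eigenvalues, up to the change of basis. -/
theorem learns_eigSol {c ω C : ℝ} (hω : 2 ≤ ω) (hc : 0 ≤ c) (hC : 2 * (c + 1) ≤ C) (hC3 : 3 ≤ C)
    (hmul : HasMul X K c ω) {P n s : ℕ} (hn : n ≤ 2 ^ P) (hs : s ≤ 2 ^ P)
    (H : X → Matrix (Fin n) (Fin n) K) (lk : ℕ → Prop) (z : X → Fin s → K) (σ : Know X K)
    (h0 : σ.Knows fun _ => 0) (h1 : σ.Knows fun _ => 1) (hH : σ.KnowsMat H)
    (hz : ∀ k, σ.Knows fun x => z x k) (hlt : ∀ j, lk j → j < n)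
    (Y : X → Fin s → ℕ → K)
    (hY : ∀ x k i, Y x k i = stepSol n lk (natEntry (H x)) (z x k) i (Y x k)) :
    Learns (fun τ => τ.KnowsMat fun x => Matrix.of fun (i : Fin n) (k : Fin s) =>
      eigSol hlt (natEntry (H x)) (z x k) (Y x k) i) σ (5 * (n * s) + dcCost C ω P P) 0 := by
  classical
  have hent : ∀ i j, σ.Knows fun x => natEntry (H x) i j := by
    intro i j
    by_cases hij : i < n ∧ j < n
    · simp only [natEntry, dif_pos hij]
      exact hH _ _
    · simp only [natEntry, dif_neg hij]
      exact h0
  -- the solution of the homogeneous recurrence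
  have hsol_of : ∀ (i : ℕ) (k : Fin s) (τ : Know X K), σ ≤ τ →
      (∀ j < i, τ.Knows fun x => homNext lk (natEntry (H x)) (z x k) j) →
      τ.Knows fun x => homSol lk (natEntry (H x)) (z x k) i := by
    intro i k τ hτ hj
    cases i with
    | zero => exact h1.mono hτ
    | succ i =>
      simp only [homSol]
      by_cases hl : lk (i + 1)
      · simp only [if_pos hl]
        exact hj i (Nat.lt_succ_self i)
      · simp only [if_neg hl]
        exact h1.mono hτ
  have hhom : ∀ m : ℕ, Learns (fun τ => ∀ i < m, ∀ k : Fin s,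
      τ.Knows fun x => homNext lk (natEntry (H x)) (z x k) i) σ (m * (s * 2)) 0 := by
    intro m
    induction m with
    | zero => exact .done (by simp) le_rfl (by simp)
    | succ m ih =>
      refine Learns.bind_le ih (fun τ hτ hQ => Learns.imp (Learns.pi_knows (σ := τ) (ι := Fin s)
        (f := 2) (z := 0) (fun k x => homNext lk (natEntry (H x)) (z x k) m) fun k τ' hτ' => ?_)
        fun τ' hτ' hQ' i hi k => ?_) (by simp only [Fintype.card_fin]; push_cast; linarith) (by simp)
      · refine Learns.bind_le (Learns.knows_mul ((hz k).mono (hτ.trans hτ'))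
          (hsol_of m k τ' (hτ.trans hτ') fun j hj => (hQ j hj k).mono hτ'))
          (fun τ'' hτ'' h => Learns.knows_sub h ((hent _ _).mono (hτ.trans (hτ'.trans hτ''))))
          (by norm_num) (by norm_num)
      · rcases (Nat.lt_succ_iff.1 hi).lt_or_eq with h | rfl
        · exact (hQ i h k).mono hτ'
        · exact hQ' k
  refine Learns.bind_le (hhom n) (fun τ₁ hτ₁ hQ₁ => ?_)
    (f' := 3 * (n * s) + dcCost C ω P P) (z' := 0) (by linarith) (add_zero 0).le
  refine Learns.bind_le (Learns.pi (σ := τ₁) (ι := Fin n × Fin s) (f := 1) (z := 0)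
    (fun q τ => τ.Decided fun x => homNext lk (natEntry (H x)) (z x q.2) q.1)
    (fun q τ τ' hτ h => h.mono hτ) fun q τ hτ => Learns.decide ((hQ₁ q.1 q.1.2 q.2).mono hτ))
    (fun τ₂ hτ₂ hQ₂ => ?_) (f' := 2 * (n * s) + dcCost C ω P P) (z' := 0)
    (by simp only [Fintype.card_prod, Fintype.card_fin]; push_cast; linarith) (by simp)
  rcases τ₂.dom.eq_empty_or_nonempty with hempty | ⟨x₀, hx₀⟩
  · exact .empty hempty
  have hσ₂ := hτ₁.trans hτ₂
  have hsr : (s : ℝ) ≤ 2 ^ P := by exact_mod_cast hs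
  -- whether `e` is the end of a block with root `z x k` does not depend on `x`
  have hdec : ∀ i < n, ∀ k, ∀ x ∈ τ₂.dom, homNext lk (natEntry (H x)) (z x k) i = 0 ↔
      homNext lk (natEntry (H x₀)) (z x₀ k) i = 0 := by
    intro i hi k x hx
    rcases hQ₂ (⟨i, hi⟩, k) with h | h
    · exact ⟨fun _ => h x₀ hx₀, fun _ => h x hx⟩
    · exact ⟨fun h' => absurd h' (h x hx), fun h' => absurd h' (h x₀ hx₀)⟩
  have hroot : ∀ k, ∀ x ∈ τ₂.dom, ∀ e, IsRootEnd n lk (natEntry (H x)) (z x k) e ↔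
      IsRootEnd n lk (natEntry (H x₀)) (z x₀ k) e := fun k x hx e =>
    and_congr_right fun he => and_congr_right fun _ => hdec e he k x hx
  have hinh_of : ∀ (i : ℕ) (k : Fin s) (τ : Know X K), τ₂ ≤ τ →
      (∀ j < i, τ.Knows fun x => inhomNext lk (natEntry (H x)) (z x k) (Y x k) j) →
      τ.Knows fun x => inhomSol lk (natEntry (H x)) (z x k) (Y x k) i := by
    intro i k τ hτ hj
    cases i with
    | zero => exact h0.mono (hσ₂.trans hτ)
    | succ i =>
      simp only [inhomSol]
      by_cases hl : lk (i + 1)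
      · simp only [if_pos hl]
        exact hj i (Nat.lt_succ_self i)
      · simp only [if_neg hl]
        exact h0.mono (hσ₂.trans hτ)
  -- The sum supplied online is `carry`. Along with `Y`, each row records `inhomNext`, from which
  -- the next row obtains its `inhomSol`.
  have honline := learns_online hω hc hC hC3 hmul hs (n := n)
    (fun x i e => natEntry (H x) i (blockHead lk e)) (fun x i k => Y x k i)
    (fun i τ => ∀ k, (τ.Knows fun x => Y x k i) ∧
      τ.Knows fun x => inhomNext lk (natEntry (H x)) (z x k) (Y x k) i)
    (fun i τ τ' hτ h k => ⟨(h k).1.mono hτ, (h k).2.mono hτ⟩) (fun i τ h k => (h k).1) τ₂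
    (h0.mono hσ₂) (fun i e _ _ => (hent _ _).mono hσ₂) ?_ P le_rfl 0 τ₂ le_rfl (by simp)
    (fun i _ _ _ k => by simpa using h0.mono hσ₂)
  · refine Learns.bind_le honline (fun τ₃ hτ₃ hQ₃ => ?_) (f' := 2 * (n * s)) (z' := 0)
      (by linarith) (add_zero 0).le
    have hQ₃' : ∀ e < n, ∀ k, (τ₃.Knows fun x => Y x k e) ∧
        τ₃.Knows fun x => inhomNext lk (natEntry (H x)) (z x k) (Y x k) e :=
      fun e he => hQ₃ e (by omega) he
    refine ((Learns.pi_knows (σ := τ₃) (ι := Fin n × Fin s) (f := 2) (z := 0)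
      (fun q x => eigSol hlt (natEntry (H x)) (z x q.2) (Y x q.2) q.1) fun q τ hτ => ?_).le_cost
      (by simp only [Fintype.card_prod, Fintype.card_fin]; push_cast; linarith) (by simp)).imp
      fun τ _ h i k => h (i, k)
    refine Learns.bind_le (Learns.knows_mul ((hQ₃' _ (blockEnd_lt (hlt := hlt) q.1.2) q.2).1.mono hτ)
      (hsol_of q.1 q.2 τ (hσ₂.trans (hτ₃.trans hτ)) fun j hj =>
        (hQ₁ j (hj.trans q.1.2) q.2).mono (hτ₂.trans (hτ₃.trans hτ))))
      (fun τ' hτ' h => Learns.knows_sub h (hinh_of q.1 q.2 τ' (hτ₃.trans (hτ.trans hτ')) fun j hj =>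
        (hQ₃' j (hj.trans q.1.2) q.2).2.mono (hτ.trans hτ'))) (by norm_num) (by norm_num)
  · intro i hi τ hτ hprev hacc
    refine (Learns.pi (σ := τ) (ι := Fin s) (f := 3) (z := 0) (fun k τ =>
      (τ.Knows fun x => Y x k i) ∧
      τ.Knows fun x => inhomNext lk (natEntry (H x)) (z x k) (Y x k) i)
      (fun k τ τ' hτ h => ⟨h.1.mono hτ, h.2.mono hτ⟩) fun k τ' hτ' => ?_).le_cost
      (by simp only [Fintype.card_fin]; linarith) (by simp)
    refine Learns.bind_le (Learns.knows_mul ((hz k).mono (hσ₂.trans (hτ.trans hτ')))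
      (hinh_of i k τ' (hτ.trans hτ') fun j hj => (hprev j hj k).2.mono hτ'))
      (fun τ'' hτ'' h => ?_) (f' := 2) (z' := 0) (by norm_num) (by norm_num)
    refine Learns.bind_le (Learns.knows_add h ((hacc k).mono (hτ'.trans hτ''))) (fun ρ hρ hn => ?_)
      (f' := 1) (z' := 0) (by norm_num) (by norm_num)
    have hinh : ρ.Knows fun x => inhomNext lk (natEntry (H x)) (z x k) (Y x k) i := hn
    have hτρ : τ₂ ≤ ρ := hτ.trans (hτ'.trans (hτ''.trans hρ))
    suffices Learns (fun τ => τ.Knows fun x => Y x k i) ρ 1 0 from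
      this.imp fun ρ' hρ' h' => ⟨h', hinh.mono hρ'⟩
    by_cases hl : lk (i + 1)
    · exact .done zero_le_one le_rfl ((h0.mono (hσ₂.trans hτρ)).congr fun x _ => by
        rw [hY, stepSol, if_pos hl])
    by_cases hex : ∃ e, i < e ∧ IsRootEnd n lk (natEntry (H x₀)) (z x₀ k) e
    · exact .done zero_le_one le_rfl ((h0.mono (hσ₂.trans hτρ)).congr fun x hx => by
        rw [hY, stepSol, if_neg hl, if_pos]
        simpa only [hroot k x (hτρ.1 hx)] using hex)
    by_cases hz0 : homNext lk (natEntry (H x₀)) (z x₀ k) i = 0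
    · exact .done zero_le_one le_rfl ((h1.mono (hσ₂.trans hτρ)).congr fun x hx => by
        rw [hY, stepSol, if_neg hl, if_neg, if_pos ((hdec i hi k x (hτρ.1 hx)).2 hz0)]
        simpa only [hroot k x (hτρ.1 hx)] using hex)
    · refine (Learns.knows_div hinh ((hQ₁ i hi k).mono (hτ₂.trans hτρ))).imp
        fun ρ' hρ' h' => h'.congr fun x hx => ?_
      have hx' := (hτρ.trans hρ').1 hx
      rw [hY, stepSol, if_neg hl, if_neg, if_neg (mt (hdec i hi k x hx').1 hz0)]
      simpa only [hroot k x hx'] using hex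

/-- Right eigenvectors of `M` for several eigenvalues. -/
theorem learns_eigenvectors {c ω C : ℝ} (hω : 2 ≤ ω) (hc : 0 ≤ c) (hC : 2 * (c + 1) ≤ C)
    (hC3 : 3 ≤ C) (hmul : HasMul X K c ω) {P n s : ℕ} (hn : 0 < n) (hP : 2 * n ≤ 2 ^ P)
    (hs : s ≤ 2 ^ P) (M : X → Matrix (Fin n) (Fin n) K) (z : X → Fin s → K) (σ : Know X K)
    (h0 : σ.Knows fun _ => 0) (h1 : σ.Knows fun _ => 1) (hM : σ.KnowsMat M)
    (hz : ∀ k, σ.Knows fun x => z x k)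
    (heig : ∀ x ∈ σ.dom, ∀ k, ∃ v ≠ 0, (M x).mulVec v = z x k • v) :
    Learns (fun τ => ∃ U : X → Matrix (Fin n) (Fin s) K, τ.KnowsMat U ∧ ∀ x ∈ τ.dom, ∀ k,
      (U x).col k ≠ 0 ∧ (M x).mulVec ((U x).col k) = z x k • (U x).col k) σ
      ((P * (2 * (c * ((2 : ℝ) ^ P) ^ ω) + dcCost C ω P P) + 2 * (c * ((2 : ℝ) ^ P) ^ ω)) +
        ((5 * (n * s) + dcCost C ω P P) + c * ((2 : ℝ) ^ P) ^ ω)) 0 := by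
  refine Learns.bind_le (learns_lowerCompanion hω hc hC hC3 hmul hn hP M σ h0 h1 hM)
    (fun τ₁ hτ₁ hQ₁ => ?_) le_rfl (add_zero 0).le
  obtain ⟨V, W, H, lk, kV, kH, hVH⟩ := hQ₁
  rcases τ₁.dom.eq_empty_or_nonempty with hempty | ⟨x₀, hx₀⟩
  · exact .empty hempty
  have hlt := (hVH x₀ hx₀).2.2.lt
  choose Y hY using fun x k => exists_sol n lk (natEntry (H x)) (z x k)
  refine Learns.bind_le (learns_eigSol hω hc hC hC3 hmul (by omega) hs H lk z τ₁ (h0.mono hτ₁)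
    (h1.mono hτ₁) kH (fun k => (hz k).mono hτ₁) hlt Y hY)
    (fun τ₂ hτ₂ hQ₂ => ?_) le_rfl (add_zero 0).le
  have hn' : Fintype.card (Fin n) ≤ 2 ^ P := by simp; omega
  refine (hmul.mul_square hn' hn' (by simpa using hs) (h0.mono (hτ₁.trans hτ₂)) (kV.mono hτ₂)
    hQ₂).imp fun τ₃ hτ₃ hQ₃ => ⟨_, hQ₃, fun x hx k => ?_⟩
  obtain ⟨hVW, hMV, hlow⟩ := hVH x ((hτ₂.trans hτ₃).1 hx)
  have hWV : W x * V x = 1 := mul_eq_one_comm.1 hVW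
  have hcol : (V x * Matrix.of fun (i : Fin n) (k : Fin s) =>
      eigSol hlt (natEntry (H x)) (z x k) (Y x k) i).col k =
      (V x).mulVec fun i : Fin n => eigSol hlt (natEntry (H x)) (z x k) (Y x k) i := rfl
  obtain ⟨v, hv, hMv⟩ := heig x ((hτ₁.trans (hτ₂.trans hτ₃)).1 hx) k
  -- `W` intertwines `M` and `H`, so it carries an eigenvector of `M` to one of `H`; this supplies
  -- the block with root `z x k`.
  have hHW : H x * W x = W x * M x := by
    calc H x * W x = W x * (V x * H x) * W x := by rw [← Matrix.mul_assoc, hWV, Matrix.one_mul]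
      _ = W x * M x := by
        rw [← hMV, Matrix.mul_assoc, Matrix.mul_assoc, hVW, Matrix.mul_one]
  have hroot := hlow.exists_isRootEnd (v := (W x).mulVec v) (z := z x k)
    (fun h => hv (by rw [← Matrix.one_mulVec v, ← hVW, ← Matrix.mulVec_mulVec, h,
      Matrix.mulVec_zero]))
    (by rw [Matrix.mulVec_mulVec, hHW, ← Matrix.mulVec_mulVec, hMv, Matrix.mulVec_smul])
  rw [hcol]
  refine ⟨fun h => hlow.eigSol_ne_zero (hY x k) hroot ?_, ?_⟩
  · have := congrArg (W x).mulVec h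
    rwa [Matrix.mulVec_mulVec, hWV, Matrix.one_mulVec, Matrix.mulVec_zero] at this
  · rw [Matrix.mulVec_mulVec, hMV, ← Matrix.mulVec_mulVec, hlow.mulVec_eigSol (hY x k),
      Matrix.mulVec_smul]

end PadicEigen

end

noncomputable section

open Polynomial
open scoped WithZero

namespace PadicEigen

/-! ### The additive valuation -/

section Valuation

variable {K : Type*} [Field K] [Valued K ℤᵐ⁰]

theorem val_ne_top {x : K} : val x ≠ ⊤ ↔ x ≠ 0 := by
  unfold val
  split_ifs with h <;> simp [h]

theorem val_mul (x y : K) : val (x * y) = val x + val y := by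
  by_cases hx : x = 0
  · simp [val, hx]
  by_cases hy : y = 0
  · simp [val, hy]
  rw [val, if_neg (mul_ne_zero hx hy), val, if_neg hx, val, if_neg hy, ← WithTop.coe_add, ord, ord,
    ord, map_mul, WithZero.log_mul (by simpa using hx) (by simpa using hy), neg_add]

theorem add_finset_inf {ι : Type*} (s : Finset ι) (a : WithTop ℤ) (F : ι → WithTop ℤ) :
    a + s.inf F = s.inf fun i => a + F i :=
  Finset.apply_inf_eq_inf_comp (fun y => a + y) (fun x y => (min_add_add_left a x y).symm)
    (add_top a)

theorem finset_inf_add_inf {ι κ : Type*} [Fintype ι] [Fintype κ] [Nonempty ι] [Nonempty κ]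
    (F : ι → WithTop ℤ) (G : κ → WithTop ℤ) :
    (Finset.univ.inf fun ij : ι × κ => F ij.1 + G ij.2) =
      Finset.univ.inf F + Finset.univ.inf G := by
  apply le_antisymm
  · obtain ⟨i, -, hi⟩ := Finset.exists_mem_eq_inf Finset.univ Finset.univ_nonempty F
    obtain ⟨j, -, hj⟩ := Finset.exists_mem_eq_inf Finset.univ Finset.univ_nonempty G
    rw [hi, hj]
    exact Finset.inf_le (f := fun ij : ι × κ => F ij.1 + G ij.2) (Finset.mem_univ (i, j))
  · exact Finset.le_inf fun ij _ => add_le_add (Finset.inf_le (Finset.mem_univ _))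
      (Finset.inf_le (Finset.mem_univ _))

theorem WithTop.add_sub_cancel_right_of_ne_top {a b : WithTop ℤ} (hb : b ≠ ⊤) : a + b - b = a := by
  lift b to ℤ using hb
  cases a with
  | top => rfl
  | coe a => rw [← WithTop.coe_add, ← WithTop.LinearOrderedAddCommGroup.coe_sub, add_sub_cancel_right]

theorem WithTop.add_sub_of_int {a b c : WithTop ℤ} (hc : c ≠ ⊤) : a + b - c = a + (b - c) := by
  lift c to ℤ using hc
  cases a with
  | top => rfl
  | coe a =>
    cases b with
    | top => rfl
    | coe b =>
      rw [← WithTop.coe_add, ← WithTop.LinearOrderedAddCommGroup.coe_sub,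
        ← WithTop.LinearOrderedAddCommGroup.coe_sub, ← WithTop.coe_add, add_sub_assoc]

end Valuation

/-! ### Simple eigenvalues -/

section Simple

variable {K : Type*} [Field K] {n : ℕ} {M : Matrix (Fin n) (Fin n) K} {lam : K}

theorem IsSimpleEigenvalue.rootMultiplicity (h : IsSimpleEigenvalue M lam) :
    M.charpoly.rootMultiplicity lam = 1 := by
  rw [← h, LinearMap.finrank_maxGenEigenspace_eq, Matrix.charpoly_toLin']

theorem IsSimpleEigenvalue.eval_charpoly (h : IsSimpleEigenvalue M lam) :
    M.charpoly.eval lam = 0 := by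
  have := (Polynomial.rootMultiplicity_pos M.charpoly_monic.ne_zero (x := lam)).1
    (by rw [h.rootMultiplicity]; exact one_pos)
  exact this

theorem IsSimpleEigenvalue.eval_derivative (h : IsSimpleEigenvalue M lam) :
    M.charpoly.derivative.eval lam ≠ 0 := fun h' => by
  have := (Polynomial.one_lt_rootMultiplicity_iff_isRoot M.charpoly_monic.ne_zero (t := lam)).2
    ⟨h.eval_charpoly, h'⟩
  rw [h.rootMultiplicity] at this
  exact lt_irrefl _ this

theorem exists_eigenvector (h : M.charpoly.eval lam = 0) : ∃ v ≠ 0, M.mulVec v = lam • v := by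
  rw [Matrix.eval_charpoly] at h
  obtain ⟨v, hv, h⟩ := Matrix.exists_mulVec_eq_zero_iff.2 h
  refine ⟨v, hv, ?_⟩
  rw [Matrix.sub_mulVec, sub_eq_zero] at h
  rw [← h]
  ext i
  simp [Matrix.scalar_apply, Matrix.mulVec_diagonal]

theorem IsSimpleEigenvalue.exists_right (h : IsSimpleEigenvalue M lam) :
    ∃ v ≠ 0, M.mulVec v = lam • v := exists_eigenvector h.eval_charpoly

theorem IsSimpleEigenvalue.exists_left (h : IsSimpleEigenvalue M lam) :
    ∃ v ≠ 0, M.transpose.mulVec v = lam • v :=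
  exists_eigenvector (by rw [Matrix.charpoly_transpose, h.eval_charpoly])

/-- The eigenspace is contained in the generalized eigenspace, which is a line. -/
theorem IsSimpleEigenvalue.proportional (h : IsSimpleEigenvalue M lam) {u v : Fin n → K}
    (hv0 : v ≠ 0) (hv : M.mulVec v = lam • v) (hu : M.mulVec u = lam • u) : ∃ a : K, u = a • v := by
  have mem : ∀ u : Fin n → K, M.mulVec u = lam • u →
      u ∈ Module.End.maxGenEigenspace (Matrix.toLin' M) lam := fun u hu =>
    (Module.End.genEigenspace (Matrix.toLin' M) lam).mono le_top
      (Module.End.mem_eigenspace_iff.2 (by rw [Matrix.toLin'_apply, hu]))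
  obtain ⟨a, ha⟩ := (finrank_eq_one_iff_of_nonzero'
    (⟨v, mem v hv⟩ : Module.End.maxGenEigenspace (Matrix.toLin' M) lam)
    (fun h' => hv0 (congrArg Subtype.val h'))).1 h ⟨u, mem u hu⟩
  exact ⟨a, (congrArg Subtype.val ha).symm⟩

theorem card_le_of_isSimpleEigenvalue {s : ℕ} {lam : Fin s → K} (hinj : Function.Injective lam)
    (h : ∀ k, IsSimpleEigenvalue M (lam k)) : s ≤ n := by
  classical
  have : Finset.univ.image lam ⊆ M.charpoly.roots.toFinset := by
    intro x hx
    obtain ⟨k, -, rfl⟩ := Finset.mem_image.1 hx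
    rw [Multiset.mem_toFinset, Polynomial.mem_roots M.charpoly_monic.ne_zero]
    exact (h k).eval_charpoly
  have h1 := Finset.card_le_card this
  rw [Finset.card_image_of_injective _ hinj, Finset.card_univ, Fintype.card_fin] at h1
  refine h1.trans ((Multiset.toFinset_card_le _).trans ((Polynomial.card_roots' _).trans ?_))
  rw [Matrix.charpoly_natDegree_eq_dim, Fintype.card_fin]

/-- The matrix `X - M`, entrywise. -/
theorem charmatrix_mul_comX (i j : Fin n) :
    X * comX M i j - ∑ k, C (M i k) * comX M k j = if i = j then M.charpoly else 0 := by
  have := congrFun (congrFun (Matrix.mul_adjugate M.charmatrix) i) j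
  rw [Matrix.mul_apply] at this
  simp only [Matrix.charmatrix_apply, sub_mul, Finset.sum_sub_distrib, Matrix.smul_apply,
    Matrix.one_apply, Matrix.diagonal_apply, ite_mul, zero_mul, Finset.sum_ite_eq,
    Finset.mem_univ, if_true, smul_eq_mul, mul_ite, mul_one, mul_zero] at this
  exact this

theorem comX_mul_charmatrix (i j : Fin n) :
    comX M i j * X - ∑ k, comX M i k * C (M k j) = if i = j then M.charpoly else 0 := by
  have := congrFun (congrFun (Matrix.adjugate_mul M.charmatrix) i) j
  rw [Matrix.mul_apply] at this
  simp only [Matrix.charmatrix_apply, mul_sub, Finset.sum_sub_distrib, Matrix.smul_apply,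
    Matrix.one_apply, Matrix.diagonal_apply, mul_ite, mul_zero, Finset.sum_ite_eq',
    Finset.mem_univ, if_true, smul_eq_mul, mul_one] at this
  exact this

/-- The comatrix of `lam - M` in terms of eigenvectors. -/
theorem IsSimpleEigenvalue.comX_eval (h : IsSimpleEigenvalue M lam) {v w : Fin n → K}
    (hv0 : v ≠ 0) (hv : M.mulVec v = lam • v) (hw0 : w ≠ 0)
    (hw : M.transpose.mulVec w = lam • w) :
    w ⬝ᵥ v ≠ 0 ∧ ∀ i j, (comX M i j).eval lam * (w ⬝ᵥ v) =
      M.charpoly.derivative.eval lam * (v i * w j) := by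
  have col : ∀ j, M.mulVec (fun i => (comX M i j).eval lam) =
      lam • fun i => (comX M i j).eval lam := by
    intro j
    ext i
    have := congrArg (Polynomial.eval lam) (charmatrix_mul_comX (M := M) i j)
    have h0 : Polynomial.eval lam (if i = j then M.charpoly else 0) = 0 := by
      split_ifs
      exacts [h.eval_charpoly, Polynomial.eval_zero]
    rw [h0] at this
    simp only [Polynomial.eval_sub, Polynomial.eval_mul, Polynomial.eval_X,
      Polynomial.eval_finsetSum, Polynomial.eval_C] at this
    simp only [Matrix.mulVec, dotProduct, Pi.smul_apply, smul_eq_mul]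
    exact (sub_eq_zero.1 this).symm
  choose b hb using fun j => h.proportional hv0 hv (col j)
  have hw' : ∀ k, ∑ i, w i * M i k = lam * w k := fun k => by
    have := congrFun hw k
    simp only [Matrix.mulVec, dotProduct, Matrix.transpose_apply, Pi.smul_apply,
      smul_eq_mul] at this
    rw [← this]
    exact Finset.sum_congr rfl fun i _ => mul_comm _ _
  -- Differentiate `(X - M) C = χ_M` at `lam` and multiply by `w` on the left: the terms with the
  -- derivative of `C` cancel because `w` is a left eigenvector, and column `j` of `C(lam)` is `b j`
  -- times `v`.
  have key : ∀ j, b j * (w ⬝ᵥ v) = M.charpoly.derivative.eval lam * w j := by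
    intro j
    have h1 : ∀ i, (comX M i j).eval lam + lam * (comX M i j).derivative.eval lam -
        ∑ k, M i k * (comX M k j).derivative.eval lam =
        if i = j then M.charpoly.derivative.eval lam else 0 := by
      intro i
      have := congrArg (fun p => (Polynomial.derivative p).eval lam)
        (charmatrix_mul_comX (M := M) i j)
      have h0 : (Polynomial.derivative (if i = j then M.charpoly else 0)).eval lam =
          if i = j then M.charpoly.derivative.eval lam else 0 := by
        split_ifs <;> simp
      rw [← h0, ← this]
      simp [Polynomial.derivative_mul, Polynomial.eval_finsetSum]
    have h2 : ∑ i, w i * ((comX M i j).eval lam + lam * (comX M i j).derivative.eval lam -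
        ∑ k, M i k * (comX M k j).derivative.eval lam) =
        M.charpoly.derivative.eval lam * w j := by
      simp [h1, mul_comm]
    have h3 : ∑ i, w i * ∑ k, M i k * (comX M k j).derivative.eval lam =
        ∑ k, w k * (lam * (comX M k j).derivative.eval lam) := by
      simp only [Finset.mul_sum, ← mul_assoc]
      rw [Finset.sum_comm]
      refine Finset.sum_congr rfl fun k _ => ?_
      rw [← Finset.sum_mul, hw', mul_comm lam]
    rw [← h2]
    simp only [mul_sub, mul_add, Finset.sum_sub_distrib, Finset.sum_add_distrib]
    rw [h3, add_sub_cancel_right, dotProduct, Finset.mul_sum]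
    refine Finset.sum_congr rfl fun i _ => ?_
    have := congrFun (hb j) i
    beta_reduce at this
    rw [this, Pi.smul_apply, smul_eq_mul]
    ring
  refine ⟨fun h0 => hw0 ?_, fun i j => ?_⟩
  · ext j
    have := key j
    rw [h0, mul_zero] at this
    exact (mul_eq_zero.1 this.symm).resolve_left h.eval_derivative
  · have := congrFun (hb j) i
    beta_reduce at this
    rw [this, Pi.smul_apply, smul_eq_mul]
    linear_combination v i * key j

end Simple

/-! ### The optimal precision in terms of eigenvectors -/

section Precision

variable {K : Type*} [Field K] [Valued K ℤᵐ⁰] {n : ℕ} {M : Matrix (Fin n) (Fin n) K} {lam : K}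

/-- Taking valuations in `comX_eval` removes both the comatrix and the derivative of the
characteristic polynomial. Any normalization of `v` and `w` will do. -/
theorem IsSimpleEigenvalue.eigenPrec_eq (h : IsSimpleEigenvalue M lam) {v w : Fin n → K}
    (hv0 : v ≠ 0) (hv : M.mulVec v = lam • v) (hw0 : w ≠ 0)
    (hw : M.transpose.mulVec w = lam • w) (N : Matrix (Fin n) (Fin n) ℤ) :
    eigenPrec M N lam = Finset.univ.inf fun ij : Fin n × Fin n =>
      ((N ij.2 ij.1 : ℤ) : WithTop ℤ) + (val (v ij.1) + val (w ij.2)) - val (w ⬝ᵥ v) := by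
  obtain ⟨hd, hC⟩ := h.comX_eval hv0 hv hw0 hw
  refine Finset.inf_congr rfl fun ij _ => ?_
  have h1 := congrArg val (hC ij.1 ij.2)
  rw [val_mul, val_mul, val_mul] at h1
  have hd' := val_ne_top.2 hd
  have hc' := val_ne_top.2 h.eval_derivative
  rw [WithTop.add_sub_of_int hc', WithTop.add_sub_of_int hd']
  congr 1
  rw [← WithTop.add_sub_cancel_right_of_ne_top (a := val ((comX M ij.1 ij.2).eval lam)) hd', h1,
    WithTop.add_sub_of_int hd', add_comm, WithTop.add_sub_cancel_right_of_ne_top hc']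

/-- Finiteness is what allows an integer register to hold the result; a pair of nonzero coordinates
of `v` and `w` bounds the minimum. -/
theorem IsSimpleEigenvalue.eigenPrec_ne_top (h : IsSimpleEigenvalue M lam)
    (N : Matrix (Fin n) (Fin n) ℤ) : eigenPrec M N lam ≠ ⊤ := by
  obtain ⟨v, hv0, hv⟩ := h.exists_right
  obtain ⟨w, hw0, hw⟩ := h.exists_left
  rw [h.eigenPrec_eq hv0 hv hw0 hw]
  obtain ⟨i, hi⟩ := Function.ne_iff.1 hv0
  obtain ⟨j, hj⟩ := Function.ne_iff.1 hw0
  have hd := val_ne_top.2 (h.comX_eval hv0 hv hw0 hw).1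
  refine ne_top_of_le_ne_top ?_ (Finset.inf_le (Finset.mem_univ (i, j)))
  have hvi := val_ne_top.2 hi
  have hwj := val_ne_top.2 hj
  lift val (w ⬝ᵥ v) to ℤ using hd with d
  lift val (v i) to ℤ using hvi with a
  lift val (w j) to ℤ using hwj with b
  exact WithTop.coe_ne_top (a := N j i + (a + b) - d)

/-- The case of a constant precision. -/
theorem IsSimpleEigenvalue.eigenPrec_const (h : IsSimpleEigenvalue M lam) {v w : Fin n → K}
    (hv0 : v ≠ 0) (hv : M.mulVec v = lam • v) (hw0 : w ≠ 0)
    (hw : M.transpose.mulVec w = lam • w) {N : Matrix (Fin n) (Fin n) ℤ} {a : ℤ}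
    (hN : ∀ i j, N i j = a) :
    eigenPrec M N lam = (a : WithTop ℤ) + ((Finset.univ.inf fun i => val (v i)) +
      Finset.univ.inf fun j => val (w j)) - val (w ⬝ᵥ v) := by
  have hne : Nonempty (Fin n) := (Function.ne_iff.1 hv0).nonempty
  have hd := val_ne_top.2 (h.comX_eval hv0 hv hw0 hw).1
  rw [h.eigenPrec_eq hv0 hv hw0 hw, ← finset_inf_add_inf, add_finset_inf]
  simp only [hN]
  lift val (w ⬝ᵥ v) to ℤ using hd with d
  have : ∀ y : WithTop ℤ, y - (d : WithTop ℤ) = ((-d : ℤ) : WithTop ℤ) + y := by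
    intro y
    cases y with
    | top => rfl
    | coe y => rw [← WithTop.LinearOrderedAddCommGroup.coe_sub, ← WithTop.coe_add, neg_add_eq_sub]
  simp only [this]
  rw [add_finset_inf]

/-- A congruence modulo `χ_M` becomes an equality when evaluated at a root, and valuations turn the
product into a sum. -/
theorem IsShortForm.shortPrec_eq {α : K[X]} {P Q : Matrix (Fin n) (Fin n) K}
    (hs : IsShortForm M α P Q) (h : IsSimpleEigenvalue M lam) (N : Matrix (Fin n) (Fin n) ℤ) :
    shortPrec M α P Q N lam = eigenPrec M N lam := by
  have hd := val_ne_top.2 h.eval_derivative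
  rw [shortPrec, eigenPrec, add_finset_inf]
  refine Finset.inf_congr rfl fun ij _ => ?_
  obtain ⟨q, hq⟩ := hs.com_eq ij.1 ij.2
  have h1 := congrArg (Polynomial.eval lam) hq
  rw [Polynomial.eval_mul, h.eval_charpoly, zero_mul, Polynomial.eval_sub, sub_eq_zero,
    Polynomial.eval_mul, Polynomial.eval_mul] at h1
  rw [h1, val_mul, val_mul, ← add_assoc, ← add_assoc]
  lift val (M.charpoly.derivative.eval lam) to ℤ using hd with d
  have : ∀ y : WithTop ℤ, y - (d : WithTop ℤ) = ((-d : ℤ) : WithTop ℤ) + y := by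
    intro y
    cases y with
    | top => rfl
    | coe y => rw [← WithTop.LinearOrderedAddCommGroup.coe_sub, ← WithTop.coe_add, neg_add_eq_sub]
  rw [this, this]
  ac_rfl

end Precision

/-! ### Short forms of matrices with a cyclic vector -/

section ShortForm

variable {K : Type*} [Field K] {n : ℕ} {M : Matrix (Fin n) (Fin n) K}

/-- The matrix with columns `c, M c, M² c, …`. -/
def krylov (M : Matrix (Fin n) (Fin n) K) (c : Fin n → K) : Matrix (Fin n) (Fin n) K :=
  Matrix.of fun i j => (M ^ (j : ℕ)).mulVec c i

/-- By Cayley–Hamilton, reducing `X ^ i` modulo `χ_M` writes every `M ^ i c` in terms of the first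
`n` iterates, which therefore span. -/
theorem isUnit_krylov {c : Fin n → K}
    (hc : Submodule.span K (Set.range fun i : ℕ => Matrix.mulVec (M ^ i) c) = ⊤) :
    IsUnit (krylov M c) := by
  rw [← Matrix.mulVec_surjective_iff_isUnit]
  have : (⊤ : Submodule K (Fin n → K)) ≤ LinearMap.range (krylov M c).mulVecLin := by
    rw [← hc, Submodule.span_le]
    rintro _ ⟨i, rfl⟩
    refine ⟨fun l => (X ^ i %ₘ M.charpoly).coeff l, ?_⟩
    have hdeg : (X ^ i %ₘ M.charpoly).degree < n := by
      have := Polynomial.degree_modByMonic_lt (X ^ i) M.charpoly_monic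
      rwa [Matrix.charpoly_degree_eq_dim, Fintype.card_fin] at this
    ext k
    beta_reduce
    rw [Matrix.pow_eq_aeval_mod_charpoly M i, Polynomial.aeval_def, Polynomial.eval₂_eq_sum,
      ← Polynomial.sum_fin (fun e a => algebraMap K (Matrix (Fin n) (Fin n) K) a * M ^ e)
        (fun e => by simp) hdeg, Matrix.sum_mulVec, Finset.sum_apply,
      Matrix.mulVecLin_apply, Matrix.mulVec, dotProduct]
    refine Finset.sum_congr rfl fun l _ => ?_
    rw [Matrix.algebraMap_eq_diagonal, ← Matrix.mulVec_mulVec, Matrix.mulVec_diagonal, krylov,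
      Matrix.of_apply, mul_comm]
    rfl
  intro y
  obtain ⟨x, hx⟩ := this (Submodule.mem_top (x := y))
  exact ⟨x, hx⟩

/-- Multiplication by `M` shifts the iterates, and Cayley–Hamilton rewrites `M ^ n c` in the last
column. -/
theorem mul_krylov (c : Fin n → K) : M * krylov M c = krylov M c * (companion M).transpose := by
  ext i j
  have h1 : (M * krylov M c) i j = (M ^ ((j : ℕ) + 1)).mulVec c i := by
    rw [pow_succ', ← Matrix.mulVec_mulVec]
    rfl
  rw [h1, Matrix.mul_apply]
  simp only [Matrix.transpose_apply, companion, Matrix.of_apply]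
  by_cases hj : (j : ℕ) + 1 = n
  · simp only [if_pos hj, mul_neg, Finset.sum_neg_distrib]
    have h0 := congrArg (fun A => Matrix.mulVec A c i) (Matrix.aeval_self_charpoly M)
    beta_reduce at h0
    have hdeg : M.charpoly.natDegree = n := by
      rw [Matrix.charpoly_natDegree_eq_dim, Fintype.card_fin]
    have hlead : M.charpoly.coeff n = 1 := by
      have := M.charpoly_monic.coeff_natDegree
      rwa [hdeg] at this
    rw [Polynomial.aeval_eq_sum_range, hdeg, Matrix.sum_mulVec, Finset.sum_apply,
      Finset.sum_range_succ, hlead, one_smul, Matrix.zero_mulVec, Pi.zero_apply,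
      ← Fin.sum_univ_eq_sum_range
        (fun l => Matrix.mulVec (M.charpoly.coeff l • M ^ l) c i)] at h0
    rw [hj, eq_neg_iff_add_eq_zero, add_comm, ← h0]
    congr 1
    refine Finset.sum_congr rfl fun l _ => ?_
    rw [Matrix.smul_mulVec, Pi.smul_apply, smul_eq_mul, krylov, Matrix.of_apply, mul_comm]
  · simp only [if_neg hj, mul_ite, mul_one, mul_zero]
    have hj' : (j : ℕ) + 1 < n := by omega
    rw [Finset.sum_eq_single (⟨j + 1, hj'⟩ : Fin n)]
    · simp [krylov]
    · exact fun b _ hb => if_neg fun h => hb (Fin.ext h)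
    · simp

/-- The Hankel matrix of the coefficients of the characteristic polynomial. -/
def hankel (M : Matrix (Fin n) (Fin n) K) : Matrix (Fin n) (Fin n) K :=
  Matrix.of fun i j => M.charpoly.coeff ((i : ℕ) + j + 1)

theorem charpoly_coeff_dim : M.charpoly.coeff n = 1 := by
  have := M.charpoly_monic.coeff_natDegree
  rwa [Matrix.charpoly_natDegree_eq_dim, Fintype.card_fin] at this

theorem charpoly_coeff_of_lt {k : ℕ} (h : n < k) : M.charpoly.coeff k = 0 :=
  Polynomial.coeff_eq_zero_of_natDegree_lt
    (by rwa [Matrix.charpoly_natDegree_eq_dim, Fintype.card_fin])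

/-- Reversing the rows gives a lower triangular matrix whose diagonal entries are the leading
coefficient of `χ_M`. -/
theorem isUnit_det_hankel : IsUnit (hankel M).det := by
  have h1 : ((hankel M).submatrix Fin.revPerm id).det = 1 := by
    rw [Matrix.det_of_isLowerTriangular]
    · refine Finset.prod_eq_one fun i _ => ?_
      simp only [Matrix.submatrix_apply, hankel, Matrix.of_apply, Fin.revPerm_apply, Fin.val_rev,
        id]
      rw [show n - ((i : ℕ) + 1) + i + 1 = n by omega, charpoly_coeff_dim]
    · intro i j hij
      have hij' : (i : ℕ) < j := hij
      simp only [Matrix.submatrix_apply, hankel, Matrix.of_apply, Fin.revPerm_apply, Fin.val_rev,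
        id]
      exact charpoly_coeff_of_lt (by omega)
  rw [Matrix.det_permute] at h1
  exact IsUnit.of_mul_eq_one_right _ h1

theorem hankel_mul_companion_apply (i j : Fin n) : (hankel M * companion M) i j =
    (if (j : ℕ) = 0 then 0 else M.charpoly.coeff (i + j)) -
      if (i : ℕ) = 0 then M.charpoly.coeff j else 0 := by
  have hn : 0 < n := i.pos
  let l : Fin n := ⟨n - 1, by omega⟩
  have hl : ∀ k : Fin n, (k : ℕ) + 1 = n ↔ k = l := fun k => by
    rw [Fin.ext_iff]; show _ ↔ (k : ℕ) = n - 1; omega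
  have h1 : ∀ k : Fin n, hankel M i k * companion M k j =
      (if (j : ℕ) = k + 1 then M.charpoly.coeff (i + j) else 0) -
        if k = l then (if (i : ℕ) = 0 then M.charpoly.coeff j else 0) else 0 := by
    intro k
    simp only [hankel, companion, Matrix.of_apply, hl]
    by_cases hk : k = l
    · subst hk
      have hjl : ¬ (j : ℕ) = (l : ℕ) + 1 := by
        show ¬ (j : ℕ) = n - 1 + 1
        omega
      rw [if_pos rfl, if_neg hjl, if_pos rfl, zero_sub, mul_neg, neg_inj]
      have hll : (l : ℕ) = n - 1 := rfl
      split_ifs with hi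
      · rw [hi, hll, show 0 + (n - 1) + 1 = n by omega, charpoly_coeff_dim, one_mul]
      · rw [charpoly_coeff_of_lt (by omega), zero_mul]
    · rw [if_neg hk, if_neg hk, sub_zero, mul_ite, mul_one, mul_zero]
      split_ifs with hj
      · rw [hj, add_assoc]
      · rfl
  rw [Matrix.mul_apply]
  simp only [h1, Finset.sum_sub_distrib, Finset.sum_ite_eq', Finset.mem_univ, if_true]
  congr 1
  split_ifs with hj
  · exact Finset.sum_eq_zero fun k _ => if_neg (by omega)
  · rw [Finset.sum_eq_single (⟨j - 1, by omega⟩ : Fin n)]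
    · exact if_pos (by simp; omega)
    · exact fun b _ hb => if_neg fun h => hb (Fin.ext (by simp; omega))
    · simp

/-- The Hankel matrix is symmetric, so the claim is that its product with the companion matrix is
symmetric too; this is read off the explicit entries. -/
theorem companion_transpose_mul_hankel :
    (companion M).transpose * hankel M = hankel M * companion M := by
  have hsymm : (hankel M).transpose = hankel M := by
    ext i j
    simp [hankel, add_comm]
  calc (companion M).transpose * hankel M = (hankel M * companion M).transpose := by
        rw [Matrix.transpose_mul, hsymm]
    _ = hankel M * companion M := by
      ext i j
      rw [Matrix.transpose_apply, hankel_mul_companion_apply, hankel_mul_companion_apply,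
        add_comm (j : ℕ)]
      split_ifs with h1 h2 h2
      · rw [h1, h2]
      · simp [h1]
      · simp [h2]
      · rfl

/-- A matrix with a cyclic vector and its transpose are similar to the companion matrix. -/
theorem HasCyclicVector.similar (h : HasCyclicVector M) :
    ∃ P Q : Matrix (Fin n) (Fin n) K, IsUnit P.det ∧ IsUnit Q.det ∧
      M = P * companion M * P⁻¹ ∧ M.transpose = Q * companion M * Q⁻¹ := by
  obtain ⟨c, hc⟩ := h
  have hB : IsUnit (krylov M c).det := (Matrix.isUnit_iff_isUnit_det _).1 (isUnit_krylov hc)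
  have hS := isUnit_det_hankel (M := M)
  have hMB := mul_krylov (M := M) c
  set B := krylov M c
  have hBt : IsUnit B.transpose.det := by rwa [Matrix.det_transpose]
  have hP : IsUnit (B * hankel M).det := by rw [Matrix.det_mul]; exact hB.mul hS
  -- From `M B = B 𝒞ᵗ` one gets `Mᵗ` by transposition; for `M` itself the Hankel matrix replaces
  -- `𝒞ᵗ` by `𝒞`.
  refine ⟨B * hankel M, B.transpose⁻¹, hP, Matrix.isUnit_nonsing_inv_det _ hBt, ?_, ?_⟩
  · rw [Matrix.mul_assoc B, ← companion_transpose_mul_hankel, ← Matrix.mul_assoc, ← hMB,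
      Matrix.mul_assoc M, Matrix.mul_assoc, Matrix.mul_nonsing_inv _ hP, Matrix.mul_one]
  · have := congrArg Matrix.transpose hMB
    rw [Matrix.transpose_mul, Matrix.transpose_mul, Matrix.transpose_transpose] at this
    rw [Matrix.nonsing_inv_nonsing_inv _ hBt, Matrix.mul_assoc, ← this, ← Matrix.mul_assoc,
      Matrix.nonsing_inv_mul _ hBt, Matrix.one_mul]

variable {R : Type*} [CommRing R] [Algebra K R]

/-- Over a `K`-algebra, an eigenvector of the companion matrix for `x` is a multiple of
`(1, x, x², …)`. -/
theorem companion_eigenvector {x : R} {u : Fin n → R} (hn : 0 < n)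
    (hu : ((companion M).map (algebraMap K R)).mulVec u = x • u) (i : Fin n) :
    u i = x ^ (i : ℕ) * u ⟨0, hn⟩ := by
  obtain ⟨i, hi⟩ := i
  induction i with
  | zero => simp
  | succ i ih =>
    have h1 := congrFun hu ⟨i, by omega⟩
    rw [Matrix.mulVec, dotProduct, Finset.sum_eq_single (⟨i + 1, hi⟩ : Fin n)] at h1
    · have hne : ¬ i + 1 = n := by omega
      simp only [Matrix.map_apply, companion, Matrix.of_apply, if_neg hne, if_true, map_one,
        one_mul, Pi.smul_apply, smul_eq_mul] at h1
      rw [h1, ih (by omega)]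
      simp only [pow_succ']
      ring
    · intro b _ hb
      have hne : ¬ i + 1 = n := by omega
      have hb' : ¬ (b : ℕ) = i + 1 := fun h => hb (Fin.ext h)
      simp [companion, hne, hb']
    · simp

/-- Eigenvectors, over a `K`-algebra, of a matrix that is similar to the companion matrix. -/
theorem eigenvector_of_similar {A P : Matrix (Fin n) (Fin n) K} (hP : IsUnit P.det)
    (hA : A = P * companion M * P⁻¹) {x : R} {u : Fin n → R} (hn : 0 < n)
    (hu : (A.map (algebraMap K R)).mulVec u = x • u) :
    ∃ r : R, ∀ i, u i = aeval x (rowPoly P i) * r := by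
  let y := (P⁻¹.map (algebraMap K R)).mulVec u
  have hPP : (P.map (algebraMap K R)) * (P⁻¹.map (algebraMap K R)) = 1 := by
    rw [← Matrix.map_mul, Matrix.mul_nonsing_inv _ hP, Matrix.map_one _ (map_zero _) (map_one _)]
  have hPu : (P.map (algebraMap K R)).mulVec y = u := by
    rw [Matrix.mulVec_mulVec, hPP, Matrix.one_mulVec]
  have hPA : P⁻¹ * A = companion M * P⁻¹ := by
    rw [hA, ← Matrix.mul_assoc, ← Matrix.mul_assoc, Matrix.nonsing_inv_mul _ hP, Matrix.one_mul]
  have hy : ((companion M).map (algebraMap K R)).mulVec y = x • y := by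
    rw [Matrix.mulVec_mulVec, ← Matrix.map_mul, ← hPA, Matrix.map_mul, ← Matrix.mulVec_mulVec, hu,
      Matrix.mulVec_smul]
  refine ⟨y ⟨0, hn⟩, fun i => ?_⟩
  rw [← hPu, Matrix.mulVec, dotProduct, rowPoly, map_sum, Finset.sum_mul]
  refine Finset.sum_congr rfl fun l _ => ?_
  rw [companion_eigenvector hn hy l]
  simp [mul_assoc]

/-- A matrix with a cyclic vector has a short form. -/
theorem HasCyclicVector.exists_isShortForm (h : HasCyclicVector M) :
    ∃ (α : K[X]) (P Q : Matrix (Fin n) (Fin n) K), IsShortForm M α P Q := by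
  obtain ⟨P, Q, hP, hQ, hMP, hMQ⟩ := h.similar
  rcases Nat.eq_zero_or_pos n with rfl | hn
  · exact ⟨0, P, Q, hP, hQ, hMP, hMQ, fun i => i.elim0⟩
  -- Over `K[X]/χ_M`, the columns of the comatrix are eigenvectors of `M` for the class `x` of `X`,
  -- and its rows are eigenvectors of the transpose.
  let x := AdjoinRoot.root M.charpoly
  let D : Fin n → Fin n → AdjoinRoot M.charpoly := fun i j => AdjoinRoot.mk M.charpoly (comX M i j)
  have hchi : ∀ i j : Fin n, AdjoinRoot.mk M.charpoly (if i = j then M.charpoly else 0) = 0 := by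
    intro i j
    split_ifs
    exacts [AdjoinRoot.mk_self, map_zero _]
  have hcol : ∀ j, (M.map (algebraMap K (AdjoinRoot M.charpoly))).mulVec (fun i => D i j) =
      x • fun i => D i j := by
    intro j
    ext i
    have := congrArg (AdjoinRoot.mk M.charpoly) (charmatrix_mul_comX (M := M) i j)
    rw [hchi, map_sub, map_mul, AdjoinRoot.mk_X, map_sum, sub_eq_zero] at this
    rw [Pi.smul_apply, smul_eq_mul, this, Matrix.mulVec, dotProduct]
    refine Finset.sum_congr rfl fun k _ => ?_
    rw [map_mul, AdjoinRoot.mk_C]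
    rfl
  have hrow : ∀ i, (M.transpose.map (algebraMap K (AdjoinRoot M.charpoly))).mulVec
      (fun j => D i j) = x • fun j => D i j := by
    intro i
    ext j
    have := congrArg (AdjoinRoot.mk M.charpoly) (comX_mul_charmatrix (M := M) i j)
    rw [hchi, map_sub, map_mul, AdjoinRoot.mk_X, map_sum, sub_eq_zero] at this
    rw [Pi.smul_apply, smul_eq_mul, mul_comm, this, Matrix.mulVec, dotProduct]
    refine Finset.sum_congr rfl fun k _ => ?_
    rw [map_mul, AdjoinRoot.mk_C, mul_comm]
    rfl
  choose r hr using fun j => eigenvector_of_similar hP hMP hn (hcol j)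
  choose t ht using fun i => eigenvector_of_similar hQ hMQ hn (hrow i)
  -- The quotient need not be a domain, so cancellation is replaced by unimodularity: the first row
  -- of `P⁻¹` sends `P Vᵗ` to the first entry of `Vᵗ`, which is `1`.
  have hPinv : ∃ q : Fin n → AdjoinRoot M.charpoly, ∑ i, q i * aeval x (rowPoly P i) = 1 := by
    refine ⟨fun i => algebraMap K _ (P⁻¹ ⟨0, hn⟩ i), ?_⟩
    have h1 : ∀ i, aeval x (rowPoly P i) = ∑ l : Fin n, algebraMap K _ (P i l) * x ^ (l : ℕ) := by
      intro i
      simp [rowPoly]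
    simp only [h1, Finset.mul_sum, ← mul_assoc, ← map_mul]
    rw [Finset.sum_comm]
    simp only [← Finset.sum_mul, ← map_sum, ← Matrix.mul_apply, Matrix.nonsing_inv_mul _ hP]
    rw [Finset.sum_eq_single (⟨0, hn⟩ : Fin n)]
    · simp
    · intro b _ hb
      rw [Matrix.one_apply_ne hb.symm, map_zero, zero_mul]
    · simp
  obtain ⟨q, hq⟩ := hPinv
  have hrt : ∀ j, r j = aeval x (rowPoly Q j) * ∑ i, q i * t i := by
    intro j
    calc r j = (∑ i, q i * aeval x (rowPoly P i)) * r j := by rw [hq, one_mul]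
      _ = ∑ i, q i * D i j := by
        rw [Finset.sum_mul]
        exact Finset.sum_congr rfl fun i _ => by rw [mul_assoc, ← hr]
      _ = _ := by
        rw [Finset.mul_sum]
        exact Finset.sum_congr rfl fun i _ => by rw [ht]; ring
  obtain ⟨α, hα⟩ := AdjoinRoot.mk_surjective (∑ i, q i * t i)
  refine ⟨α, P, Q, hP, hQ, hMP, hMQ, fun i j => ?_⟩
  rw [← AdjoinRoot.mk_eq_mk, map_mul, map_mul, hα]
  have := hr j i
  rw [hrt j, AdjoinRoot.aeval_eq, AdjoinRoot.aeval_eq] at this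
  rw [show AdjoinRoot.mk M.charpoly (comX M i j) = D i j from rfl, this]
  ring

end ShortForm

end PadicEigen

end

noncomputable section

open Polynomial
open scoped WithZero

namespace PadicEigen

open Know

/-! ### The exponent of matrix multiplication is at least two -/

section Exponent

variable {K : Type*} [Field K] [Valued K ℤᵐ⁰]

/-- A computation with `m` operations in `K` depends on the initial contents of at most `2 m`
registers only, except for the contents that are left unchanged. -/
theorem CompTree.exists_read {I J O : Type} [DecidableEq I] (T : CompTree K I J O) (ρ : I → K)
    (ζ : J → ℤ) : ∃ S : Finset I, S.card ≤ 2 * (T.run ρ ζ).fieldOps ∧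
      ∀ ρ' : I → K, (∀ i ∈ S, ρ' i = ρ i) → (T.run ρ' ζ).out = (T.run ρ ζ).out ∧
        ∀ i, (T.run ρ' ζ).reg i = (T.run ρ ζ).reg i ∨
          ((T.run ρ ζ).reg i = ρ i ∧ (T.run ρ' ζ).reg i = ρ' i) := by
  classical
  have upd : ∀ (S : Finset I) (ρ ρ' : I → K) (dst : I) (c : K), (∀ i ∈ S, ρ' i = ρ i) →
      ∀ i ∈ S, Function.update ρ' dst c i = Function.update ρ dst c i := by
    intro S ρ ρ' dst c h i hi
    by_cases hd : i = dst
    · subst hd; simp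
    · simp [hd, h i hi]
  have back : ∀ (ρ ρ' : I → K) (dst : I) (c a b : K) (i : I),
      (b = a ∨ a = Function.update ρ dst c i ∧ b = Function.update ρ' dst c i) →
        b = a ∨ a = ρ i ∧ b = ρ' i := by
    rintro ρ ρ' dst c a b i (h | ⟨h1, h2⟩)
    · exact .inl h
    · by_cases hd : i = dst
      · subst hd
        rw [Function.update_self] at h1 h2
        exact .inl (h2.trans h1.symm)
      · rw [Function.update_of_ne hd] at h1 h2
        exact .inr ⟨h1, h2⟩
  induction T generalizing ρ ζ with
  | ret o => exact ⟨∅, by simp, fun ρ' _ => ⟨rfl, fun i => .inr ⟨rfl, rfl⟩⟩⟩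
  | const c dst t ih =>
    obtain ⟨S, hS, h⟩ := ih (Function.update ρ dst c) ζ
    refine ⟨S, ?_, fun ρ' hρ' => ?_⟩
    · simp only [CompTree.run, Outcome.charge, update_classical]
      omega
    · obtain ⟨h1, h2⟩ := h (Function.update ρ' dst c) (upd S ρ ρ' dst c hρ')
      simp only [CompTree.run, Outcome.charge, update_classical]
      exact ⟨h1, fun i => back _ _ _ _ _ _ _ (h2 i)⟩
  | arith op a b dst t ih =>
    obtain ⟨S, hS, h⟩ := ih (Function.update ρ dst (op.apply (ρ a) (ρ b))) ζ
    refine ⟨insert a (insert b S), ?_, fun ρ' hρ' => ?_⟩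
    · simp only [CompTree.run, Outcome.charge, update_classical]
      have h1 := Finset.card_insert_le a (insert b S)
      have h2 := Finset.card_insert_le b S
      omega
    · have ha := hρ' a (by simp)
      have hb := hρ' b (by simp)
      obtain ⟨h1, h2⟩ := h (Function.update ρ' dst (op.apply (ρ a) (ρ b)))
        (upd S ρ ρ' dst _ fun i hi => hρ' i (by simp [hi]))
      simp only [CompTree.run, Outcome.charge, update_classical, ha, hb]
      exact ⟨h1, fun i => back _ _ _ _ _ _ _ (h2 i)⟩
  | ifZero a t u iht ihu =>
    by_cases h0 : ρ a = 0
    · obtain ⟨S, hS, h⟩ := iht ρ ζ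
      refine ⟨insert a S, ?_, fun ρ' hρ' => ?_⟩
      · simp only [CompTree.run, Outcome.charge, h0, if_true]
        have := Finset.card_insert_le a S
        omega
      · have ha := hρ' a (by simp)
        simp only [CompTree.run, Outcome.charge, ha, h0, if_true]
        exact h ρ' fun i hi => hρ' i (by simp [hi])
    · obtain ⟨S, hS, h⟩ := ihu ρ ζ
      refine ⟨insert a S, ?_, fun ρ' hρ' => ?_⟩
      · simp only [CompTree.run, Outcome.charge, h0, if_false]
        have := Finset.card_insert_le a S
        omega
      · have ha := hρ' a (by simp)
        simp only [CompTree.run, Outcome.charge, ha, h0, if_false]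
        exact h ρ' fun i hi => hρ' i (by simp [hi])
  | valuation a dst t u iht ihu =>
    by_cases h0 : ρ a = 0
    · obtain ⟨S, hS, h⟩ := iht ρ ζ
      refine ⟨insert a S, ?_, fun ρ' hρ' => ?_⟩
      · simp only [CompTree.run, Outcome.charge, h0, if_true]
        have := Finset.card_insert_le a S
        omega
      · have ha := hρ' a (by simp)
        simp only [CompTree.run, Outcome.charge, ha, h0, if_true]
        exact h ρ' fun i hi => hρ' i (by simp [hi])
    · obtain ⟨S, hS, h⟩ := ihu ρ (Function.update ζ dst (ord (ρ a)))
      refine ⟨insert a S, ?_, fun ρ' hρ' => ?_⟩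
      · simp only [CompTree.run, Outcome.charge, h0, if_false]
        have := Finset.card_insert_le a S
        omega
      · have ha := hρ' a (by simp)
        simp only [CompTree.run, Outcome.charge, ha, h0, if_false]
        exact h ρ' fun i hi => hρ' i (by simp [hi])
  | intConst c dst t ih =>
    simp only [CompTree.run, Outcome.charge, add_zero]
    exact ih ρ _
  | intArith op a b dst t ih =>
    simp only [CompTree.run, Outcome.charge, add_zero]
    exact ih ρ _
  | ifLe a b t u iht ihu =>
    by_cases h0 : ζ a ≤ ζ b
    · simp only [CompTree.run, Outcome.charge, h0, if_true, add_zero]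
      exact iht ρ ζ
    · simp only [CompTree.run, Outcome.charge, h0, if_false, add_zero]
      exact ihu ρ ζ

/-- A product `A * B` cannot be computed without reading all the entries of `A`. -/
theorem sq_le_of_mul {n : ℕ} {b : K} (hb0 : b ≠ 0) (hb1 : b ≠ 1)
    (T : CompTree K (((Fin n × Fin n) ⊕ (Fin n × Fin n)) ⊕ ℕ) ℕ
        (Fin n → Fin n → ((Fin n × Fin n) ⊕ (Fin n × Fin n)) ⊕ ℕ))
    (hT : ∀ A B : Matrix (Fin n) (Fin n) K,
      let r := T.run
        (Sum.elim (Sum.elim (fun p => A p.1 p.2) (fun p => B p.1 p.2)) (fun _ => 0)) (fun _ => 0)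
      ∀ i j, r.reg (r.out i j) = (A * B) i j) :
    ∃ A B : Matrix (Fin n) (Fin n) K, n ^ 2 ≤ 2 * (T.run
        (Sum.elim (Sum.elim (fun p => A p.1 p.2) (fun p => B p.1 p.2)) (fun _ => 0))
        (fun _ => 0)).fieldOps := by
  classical
  -- If entry `(i, j)` of `A = 0` is not read, changing it to `1` changes `(A B)_{ii}` from `0` to
  -- `b`. The output register could change only by being an untouched input register, which would go
  -- from `0` to `1` or stay at `0`. Hence the requirement that `b` be neither `0` nor `1`.
  let B : Matrix (Fin n) (Fin n) K := Matrix.of fun _ _ => b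
  refine ⟨0, B, ?_⟩
  obtain ⟨S, hS, h⟩ := T.exists_read
    (Sum.elim (Sum.elim (fun p => (0 : Matrix (Fin n) (Fin n) K) p.1 p.2) (fun p => B p.1 p.2))
      (fun _ => 0)) (fun _ => 0)
  refine le_trans ?_ hS
  have hsub : Finset.univ.image (fun p : Fin n × Fin n =>
      (Sum.inl (Sum.inl p) : ((Fin n × Fin n) ⊕ (Fin n × Fin n)) ⊕ ℕ)) ⊆ S := by
    intro q hq
    obtain ⟨⟨i, j⟩, -, rfl⟩ := Finset.mem_image.1 hq
    by_contra hmem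
    let A : Matrix (Fin n) (Fin n) K := Matrix.single i j 1
    obtain ⟨hout, hreg⟩ := h
      (Sum.elim (Sum.elim (fun p => A p.1 p.2) (fun p => B p.1 p.2)) (fun _ => 0)) (by
        rintro ((⟨k, l⟩ | p) | m) hk
        · have : ¬ (i = k ∧ j = l) := by
            rintro ⟨rfl, rfl⟩
            exact hmem hk
          simp [A, Matrix.single_apply, this]
        · rfl
        · rfl)
    have h0 := hT 0 B i i
    have h1 := hT A B i i
    have hAB : (A * B) i i = b := by simp [A, B]
    rw [hAB, hout] at h1
    rw [Matrix.zero_mul, Matrix.zero_apply] at h0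
    have hr := hreg ((T.run (Sum.elim (Sum.elim (fun p => (0 : Matrix (Fin n) (Fin n) K) p.1 p.2)
      (fun p => B p.1 p.2)) (fun _ => 0)) (fun _ => 0)).out i i)
    rw [h0, h1] at hr
    generalize (T.run (Sum.elim (Sum.elim (fun p => (0 : Matrix (Fin n) (Fin n) K) p.1 p.2)
      (fun p => B p.1 p.2)) (fun _ => 0)) (fun _ => 0)).out i i = o at hr
    rcases hr with hr | ⟨hr0, hr1⟩
    · exact hb0 hr
    · rcases o with (⟨k, l⟩ | p) | m
      · simp only [Sum.elim_inl, A, Matrix.single_apply] at hr1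
        split_ifs at hr1
        exacts [hb1 hr1, hb0 hr1]
      · exact hb0 hr0.symm
      · exact hb0 hr1
  have := Finset.card_le_card hsub
  rw [Finset.card_image_of_injective _ fun p q h => Sum.inl_injective (Sum.inl_injective h),
    Finset.card_univ,
    Fintype.card_prod, Fintype.card_fin, ← sq] at this
  exact this

/-- Reading `n²` entries takes at least `n² / 2` operations, so `n ^ (2 - ω)` is bounded.
Surjectivity of the valuation supplies the element `b` with nontrivial valuation. -/
theorem MatMulExponent.two_le {ω : ℝ} (h : MatMulExponent K ω)
    (hv : Function.Surjective (Valued.v : K → ℤᵐ⁰)) : 2 ≤ ω := by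
  obtain ⟨c, hc⟩ := h
  obtain ⟨b, hb⟩ := hv (WithZero.exp 1)
  have hb0 : b ≠ 0 := by
    rintro rfl
    rw [map_zero] at hb
    exact WithZero.exp_ne_zero hb.symm
  have hb1 : b ≠ 1 := by
    rintro rfl
    rw [map_one, ← WithZero.exp_zero, WithZero.exp_inj] at hb
    exact absurd hb (by decide)
  by_contra! hω
  have hbound : ∀ n : ℕ, 1 ≤ n → (n : ℝ) ^ (2 - ω) ≤ 2 * c := by
    intro n hn
    obtain ⟨T, hT⟩ := hc n hn
    obtain ⟨A, B, hAB⟩ := sq_le_of_mul hb0 hb1 T fun A B => (hT A B).1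
    have key : ∀ m : ℕ, n ^ 2 ≤ 2 * m → (m : ℝ) ≤ c * (n : ℝ) ^ ω →
        (n : ℝ) ^ 2 ≤ 2 * (c * (n : ℝ) ^ ω) := fun m h h' => by
      have h3 : (n : ℝ) ^ 2 ≤ 2 * m := by exact_mod_cast h
      linarith
    have h2 := key _ hAB (hT A B).2.1
    have hn' : (0 : ℝ) < n := by exact_mod_cast hn
    rw [Real.rpow_sub hn', div_le_iff₀ (Real.rpow_pos_of_pos hn' _), Real.rpow_two]
    linarith
  have ht := (tendsto_rpow_atTop (sub_pos.2 hω)).comp tendsto_natCast_atTop_atTop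
  obtain ⟨n, hn1, hn⟩ := ((ht.eventually_gt_atTop (2 * c)).and
    (Filter.eventually_ge_atTop 1)).exists
  exact absurd (hbound n hn) (not_le.2 hn1)

end Exponent

/-! ### Learning the optimal precisions -/

section Precision

variable {X K : Type*} [Field K] [Valued K ℤᵐ⁰] {σ : Know X K}

theorem Learns.knows_dot {ι : Type*} (s : Finset ι) (F G : ι → X → K) (h0 : σ.Knows fun _ => 0)
    (hF : ∀ i ∈ s, σ.Knows (F i)) (hG : ∀ i ∈ s, σ.Knows (G i)) :
    Learns (fun τ => τ.Knows fun x => ∑ i ∈ s, F i x * G i x) σ (2 * s.card) 0 := by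
  classical
  induction s using Finset.induction_on with
  | empty => exact .done (by simp) le_rfl (by simpa using h0)
  | insert a s ha ih =>
    rw [Finset.card_insert_of_notMem ha]
    refine bind_le (ih (fun i hi => hF i (Finset.mem_insert_of_mem hi))
      (fun i hi => hG i (Finset.mem_insert_of_mem hi))) (fun τ hτ hQ =>
      (knows_mul ((hF a (Finset.mem_insert_self _ _)).mono hτ)
        ((hG a (Finset.mem_insert_self _ _)).mono hτ)).bind fun τ' hτ' hQ' =>
        (knows_add hQ' (hQ.mono hτ')).imp fun τ'' _ h => ?_) (by push_cast; linarith) (by simp)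
    simpa only [Finset.sum_insert ha] using h

/-- The number of operations in `K` for one family of eigenvectors. -/
def eigenvectorCost (C c ω : ℝ) (P n s : ℕ) : ℝ :=
  (P * (2 * (c * ((2 : ℝ) ^ P) ^ ω) + dcCost C ω P P) + 2 * (c * ((2 : ℝ) ^ P) ^ ω)) +
    ((5 * (n * s) + dcCost C ω P P) + c * ((2 : ℝ) ^ P) ^ ω)

/-- The number of operations in `K` for the valuations of the eigenvectors. -/
def eigenCost (C c ω : ℝ) (P n s : ℕ) : ℝ :=
  1 + (eigenvectorCost C c ω P n s + (eigenvectorCost C c ω P n s + (4 * (n * s) + s)))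

/-- The valuations of left and right eigenvectors and of their dot products. -/
theorem learns_val_eigenvectors {c ω C : ℝ} (hω : 2 ≤ ω) (hc : 0 ≤ c) (hC : 2 * (c + 1) ≤ C)
    (hC3 : 3 ≤ C) (hmul : HasMul X K c ω) {P n s : ℕ} (hn : 0 < n) (hP : 2 * n ≤ 2 ^ P)
    (hs : s ≤ 2 ^ P) (M : X → Matrix (Fin n) (Fin n) K) (z : X → Fin s → K)
    (h0 : σ.Knows fun _ => 0) (hM : σ.KnowsMat M) (hz : ∀ k, σ.Knows fun x => z x k)
    (heig : ∀ x ∈ σ.dom, ∀ k, IsSimpleEigenvalue (M x) (z x k)) :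
    Learns (fun τ => ∃ v w : Fin s → X → Fin n → K,
      (∀ k i, τ.KnowsTop fun x => val (v k x i)) ∧ (∀ k i, τ.KnowsTop fun x => val (w k x i)) ∧
      (∀ k, τ.KnowsTop fun x => val (w k x ⬝ᵥ v k x)) ∧ ∀ x ∈ τ.dom, ∀ k,
        (v k x ≠ 0 ∧ (M x).mulVec (v k x) = z x k • v k x) ∧
        (w k x ≠ 0 ∧ (M x).transpose.mulVec (w k x) = z x k • w k x)) σ
      (eigenCost C c ω P n s) (2 * (n * s) + s) := by
  refine Learns.bind_le (Learns.knows_const 1) (fun τ₁ h₁ k1 => ?_)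
    le_rfl (zero_add _).le
  refine Learns.bind_le (learns_eigenvectors hω hc hC hC3 hmul hn hP hs M z τ₁ (h0.mono h₁) k1
    (hM.mono h₁) (fun k => (hz k).mono h₁) fun x hx k => (heig x (h₁.1 hx) k).exists_right)
    (fun τ₂ h₂ ⟨U, kU, hU⟩ => ?_) le_rfl (zero_add _).le
  have h₁₂ := h₁.trans h₂
  refine Learns.bind_le (learns_eigenvectors hω hc hC hC3 hmul hn hP hs
    (fun x => (M x).transpose) z τ₂ (h0.mono h₁₂) (k1.mono h₂)
    (fun i j => hM.mono h₁₂ j i) (fun k => (hz k).mono h₁₂)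
    fun x hx k => (heig x (h₁₂.1 hx) k).exists_left)
    (fun τ₃ h₃ ⟨W, kW, hW⟩ => ?_) le_rfl (zero_add _).le
  refine Learns.bind_le (Learns.pi_knows (f := 2 * n) (z := 0)
    (fun (k : Fin s) x => (W x).col k ⬝ᵥ (U x).col k) fun k τ hτ => ?_)
    (fun τ₄ h₄ kd => ?_)
    (f' := 2 * (n * s) + s) (z' := 2 * (n * s) + s) (by simp; linarith) (by simp)
  · have := Learns.knows_dot (σ := τ) Finset.univ (fun i x => W x i k) (fun i x => U x i k)
      (h0.mono (h₁₂.trans (h₃.trans hτ))) (fun i _ => (kW i k).mono hτ)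
      (fun i _ => (kU i k).mono (h₃.trans hτ))
    rwa [Finset.card_univ, Fintype.card_fin] at this
  have step : ∀ (τ : Know X K) (A : X → Matrix (Fin n) (Fin s) K), τ.KnowsMat A →
      Learns (fun τ => ∀ p : Fin n × Fin s, τ.KnowsTop fun x => val (A x p.1 p.2)) τ
        (n * s) (n * s) := by
    intro τ A hA
    have := Learns.pi (σ := τ) (f := 1) (z := 1)
      (fun (p : Fin n × Fin s) τ => τ.KnowsTop fun x => val (A x p.1 p.2))
      (fun _ _ _ hτ h => h.mono hτ) fun p τ' hτ' => Learns.knowsTop_val ((hA p.1 p.2).mono hτ')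
    simpa using this
  refine Learns.bind_le (step τ₄ U (kU.mono (h₃.trans h₄))) (fun τ₅ h₅ kvU => ?_)
    (f' := n * s + s) (z' := n * s + s) (by linarith) (by linarith)
  refine Learns.bind_le (step τ₅ W (kW.mono (h₄.trans h₅))) (fun τ₆ h₆ kvW => ?_)
    (f' := s) (z' := s) le_rfl le_rfl
  have := Learns.pi (σ := τ₆) (f := 1) (z := 1)
      (fun (k : Fin s) τ => τ.KnowsTop fun x => val ((W x).col k ⬝ᵥ (U x).col k))
      (fun _ _ _ hτ h => h.mono hτ)
      fun k τ' hτ' => Learns.knowsTop_val ((kd k).mono (h₅.trans (h₆.trans hτ')))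
  rw [Fintype.card_fin, mul_one] at this
  refine this.imp fun τ₇ h₇ kvd => ⟨fun k x => (U x).col k, fun k x => (W x).col k,
    fun k i => (kvU (i, k)).mono (h₆.trans h₇), fun k i => (kvW (i, k)).mono h₇, kvd,
    fun x hx k => ⟨hU x ?_ k, hW x ?_ k⟩⟩
  · exact (h₃.trans (h₄.trans (h₅.trans (h₆.trans h₇)))).1 hx
  · exact (h₄.trans (h₅.trans (h₆.trans h₇))).1 hx

theorem Know.KnowsInt.knowsTop {X K : Type*} {σ : Know X K} {g : X → ℤ} (h : σ.KnowsInt g) :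
    σ.KnowsTop fun x => (g x : WithTop ℤ) := .inr ⟨g, h, fun _ _ => rfl⟩

theorem Know.KnowsTop.congr {X K : Type*} {σ : Know X K} {f g : X → WithTop ℤ} (h : σ.KnowsTop f) (hfg : ∀ x ∈ σ.dom, f x = g x) :
    σ.KnowsTop g :=
  h.imp (fun h x hx => (hfg x hx).symm.trans (h x hx)) fun ⟨u, hu, h⟩ =>
    ⟨u, hu, fun x hx => (hfg x hx).symm.trans (h x hx)⟩

/-- For each eigenvalue, every pair of indices costs three integer operations for its term and one
for the minimum; the valuations account for at most `3 n s` more. -/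
theorem learns_eigenPrec {c ω C : ℝ} (hω : 2 ≤ ω) (hc : 0 ≤ c) (hC : 2 * (c + 1) ≤ C)
    (hC3 : 3 ≤ C) (hmul : HasMul X K c ω) {P n s : ℕ} (hn : 0 < n) (hP : 2 * n ≤ 2 ^ P)
    (hs : s ≤ 2 ^ P) (M : X → Matrix (Fin n) (Fin n) K) (N : X → Matrix (Fin n) (Fin n) ℤ)
    (z : X → Fin s → K) (h0 : σ.Knows fun _ => 0) (hM : σ.KnowsMat M)
    (hN : ∀ i j, σ.KnowsInt fun x => N x i j) (hz : ∀ k, σ.Knows fun x => z x k)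
    (heig : ∀ x ∈ σ.dom, ∀ k, IsSimpleEigenvalue (M x) (z x k)) :
    Learns (fun τ => ∀ k, τ.KnowsTop fun x => eigenPrec (M x) (N x) (z x k)) σ
      (eigenCost C c ω P n s) (7 * ((n : ℝ) ^ 2 * s)) := by
  have hn1 : (1 : ℝ) ≤ n := by exact_mod_cast hn
  have hns : (n : ℝ) * s ≤ n ^ 2 * s := by
    rw [sq]; exact mul_le_mul_of_nonneg_right (by nlinarith) (by positivity)
  have hs1 : (s : ℝ) ≤ n * s := le_mul_of_one_le_left (by positivity) hn1
  refine Learns.bind_le (learns_val_eigenvectors hω hc hC hC3 hmul hn hP hs M z h0 hM hz heig)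
    (f' := s * 0) (z' := s * (4 * (n : ℝ) ^ 2)) (fun τ₁ h₁ ⟨v, w, kv, kw, kd, hvw⟩ => ?_) (by simp)
    (by linarith)
  have := Learns.pi (σ := τ₁) (f := 0) (z := 4 * (n : ℝ) ^ 2)
    (fun (k : Fin s) τ => τ.KnowsTop fun x => eigenPrec (M x) (N x) (z x k))
    (fun _ _ _ hτ h => h.mono hτ) fun k τ hτ => ?_
  · rwa [Fintype.card_fin] at this
  have hterm := Learns.pi (σ := τ) (f := 0) (z := 3)
    (fun (ij : Fin n × Fin n) τ => τ.KnowsTop fun x => ((N x ij.2 ij.1 : ℤ) : WithTop ℤ) +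
      (val (v k x ij.1) + val (w k x ij.2)) - val (w k x ⬝ᵥ v k x))
    (fun _ _ _ hτ h => h.mono hτ) fun ij τ' hτ' => ?_
  · refine Learns.bind_le hterm (fun τ' hτ' kt =>
      (Learns.knowsTop_finset_inf Finset.univ _ fun ij _ => kt ij).imp fun τ'' hτ'' h =>
        KnowsTop.congr h fun x hx => ?_) (by simp) (by simp; linarith)
    have hx₁ := (hτ.trans (hτ'.trans hτ'')).1 hx
    obtain ⟨⟨hv0, hv⟩, hw0, hw⟩ := hvw x hx₁ k
    exact ((heig x (h₁.1 hx₁) k).eigenPrec_eq hv0 hv hw0 hw (N x)).symm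
  · have h01 := hτ.trans hτ'
    refine Learns.bind_le (Learns.knowsTop_add ((kv k ij.1).mono h01) ((kw k ij.2).mono h01))
      (fun τ₂ h₂ ka => ?_) (f' := 0) (z' := 2) (by simp) (by norm_num)
    refine Learns.bind_le (Learns.knowsTop_add (KnowsInt.knowsTop
      ((hN ij.2 ij.1).mono (h₁.trans (h01.trans h₂)))) ka)
      (fun τ₃ h₃ kb => ?_) (f' := 0) (z' := 1) (by simp) (by norm_num)
    refine Learns.knowsTop_sub kb ((kd k).mono (h01.trans (h₂.trans h₃))) fun x hx => ?_
    have hx₁ := (h01.trans (h₂.trans h₃)).1 hx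
    obtain ⟨⟨hv0, hv⟩, hw0, hw⟩ := hvw x hx₁ k
    exact val_ne_top.2 ((heig x (h₁.1 hx₁) k).comX_eval hv0 hv hw0 hw).1

/-- The minimum over pairs separates into a minimum over the `v_i` and one over the `w_j`, so `2 n +
3` integer operations per eigenvalue suffice once the valuations are known. -/
theorem learns_eigenPrec_const {c ω C : ℝ} (hω : 2 ≤ ω) (hc : 0 ≤ c) (hC : 2 * (c + 1) ≤ C)
    (hC3 : 3 ≤ C) (hmul : HasMul X K c ω) {P n s : ℕ} (hn : 0 < n) (hP : 2 * n ≤ 2 ^ P)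
    (hs : s ≤ 2 ^ P) (M : X → Matrix (Fin n) (Fin n) K) (N : X → Matrix (Fin n) (Fin n) ℤ)
    (z : X → Fin s → K) (h0 : σ.Knows fun _ => 0) (hM : σ.KnowsMat M)
    (hN : ∀ i j, σ.KnowsInt fun x => N x i j) (hz : ∀ k, σ.Knows fun x => z x k)
    (heig : ∀ x ∈ σ.dom, ∀ k, IsSimpleEigenvalue (M x) (z x k))
    (hconst : ∀ x ∈ σ.dom, ∃ a : ℤ, ∀ i j, N x i j = a) :
    Learns (fun τ => ∀ k, τ.KnowsTop fun x => eigenPrec (M x) (N x) (z x k)) σ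
      (eigenCost C c ω P n s) (8 * ((n : ℝ) * s)) := by
  have hn1 : (1 : ℝ) ≤ n := by exact_mod_cast hn
  have hs1 : (s : ℝ) ≤ n * s := le_mul_of_one_le_left (by positivity) hn1
  refine Learns.bind_le (learns_val_eigenvectors hω hc hC hC3 hmul hn hP hs M z h0 hM hz heig)
    (f' := s * 0) (z' := s * (2 * n + 3)) (fun τ₁ h₁ ⟨v, w, kv, kw, kd, hvw⟩ => ?_) (by simp)
    (by linarith)
  have := Learns.pi (σ := τ₁) (f := 0) (z := 2 * n + 3)
    (fun (k : Fin s) τ => τ.KnowsTop fun x => eigenPrec (M x) (N x) (z x k))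
    (fun _ _ _ hτ h => h.mono hτ) fun k τ hτ => ?_
  · rwa [Fintype.card_fin] at this
  refine Learns.bind_le (Learns.knowsTop_finset_inf Finset.univ _ fun i _ => (kv k i).mono hτ)
    (fun τ₂ h₂ kv' => ?_) (f' := 0) (z' := n + 3) (by simp) (by simp; linarith)
  refine Learns.bind_le (Learns.knowsTop_finset_inf Finset.univ _ fun i _ =>
    (kw k i).mono (hτ.trans h₂)) (fun τ₃ h₃ kw' => ?_) (f' := 0) (z' := 3) (by simp) (by simp)
  refine Learns.bind_le (Learns.knowsTop_add (kv'.mono h₃) kw') (fun τ₄ h₄ ka => ?_)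
    (f' := 0) (z' := 2) (by simp) (by norm_num)
  have h14 := hτ.trans (h₂.trans (h₃.trans h₄))
  refine Learns.bind_le (Learns.knowsTop_add (KnowsInt.knowsTop
    ((hN ⟨0, hn⟩ ⟨0, hn⟩).mono (h₁.trans h14))) ka) (fun τ₅ h₅ kb => ?_)
    (f' := 0) (z' := 1) (by simp) (by norm_num)
  refine (Learns.knowsTop_sub kb ((kd k).mono (h14.trans h₅)) fun x hx => ?_).imp
    fun τ₆ h₆ h => KnowsTop.congr h fun x hx => ?_
  · have hx₁ := (h14.trans h₅).1 hx
    obtain ⟨⟨hv0, hv⟩, hw0, hw⟩ := hvw x hx₁ k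
    exact val_ne_top.2 ((heig x (h₁.1 hx₁) k).comX_eval hv0 hv hw0 hw).1
  · have hx₁ := (h14.trans (h₅.trans h₆)).1 hx
    obtain ⟨⟨hv0, hv⟩, hw0, hw⟩ := hvw x hx₁ k
    obtain ⟨a, ha⟩ := hconst x (h₁.1 hx₁)
    exact ((heig x (h₁.1 hx₁) k).eigenPrec_const hv0 hv hw0 hw
      fun i j => (ha i j).trans (ha _ _).symm).symm

end Precision

end PadicEigen

end

noncomputable section

open Polynomial
open scoped WithZero

namespace PadicEigen

open Know

/-! ### Bounds on the costs -/

section Bounds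

/-- One factor `P + 1` comes from the depth of the recursions and one from the number of doublings;
the terms in `n s` are absorbed because `2 ≤ ω`. -/
theorem eigenCost_le {C c ω : ℝ} (hω : 2 ≤ ω) (hc : 0 ≤ c) (hC : 0 ≤ C) {P n s : ℕ}
    (hn : n ≤ 2 ^ P) (hs : s ≤ n) :
    eigenCost C c ω P n s ≤ (16 + 10 * c + 4 * C) * (((P : ℝ) + 1) ^ 2 * ((2 : ℝ) ^ P) ^ ω) := by
  set L : ℝ := (P : ℝ) + 1 with hL
  set B : ℝ := (2 : ℝ) ^ P with hB
  have hB1 : 1 ≤ B := one_le_pow₀ (by norm_num)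
  have hL1 : 1 ≤ L := by rw [hL]; linarith [(Nat.cast_nonneg P : (0 : ℝ) ≤ P)]
  have hdc : dcCost C ω P P = C * (L * B ^ ω) := by
    rw [dcCost, ← hL, ← hB, Real.rpow_sub_one (by linarith)]
    field_simp
  have hBω : B ^ 2 ≤ B ^ ω := by
    rw [← Real.rpow_two]
    exact Real.rpow_le_rpow_of_exponent_le hB1 hω
  set W := B ^ ω with hW
  have hnB : (n : ℝ) ≤ B := by rw [hB]; exact_mod_cast hn
  have hsn : (s : ℝ) ≤ n := by exact_mod_cast hs
  have hn0 : (0 : ℝ) ≤ n := Nat.cast_nonneg n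
  have hs0 : (0 : ℝ) ≤ s := Nat.cast_nonneg s
  have hW1 : 1 ≤ W := le_trans (one_le_pow₀ hB1) hBω
  have hns : (n : ℝ) * s ≤ W := le_trans (by nlinarith) hBω
  have hsW : (s : ℝ) ≤ W := le_trans (by nlinarith) hBω
  have hLW : W ≤ L * W := le_mul_of_one_le_left (by linarith) hL1
  have hLLW : L * W ≤ L ^ 2 * W := by
    rw [sq, mul_assoc]; exact le_mul_of_one_le_left (by positivity) hL1
  have hPL : (P : ℝ) ≤ L := by rw [hL]; linarith
  have hE : eigenvectorCost C c ω P n s ≤ (5 + 5 * c + 2 * C) * (L ^ 2 * W) := by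
    rw [eigenvectorCost, hdc, ← hB, ← hW]
    have h1 : (P : ℝ) * (2 * (c * W) + C * (L * W)) ≤ 2 * c * (L ^ 2 * W) + C * (L ^ 2 * W) := by
      calc (P : ℝ) * (2 * (c * W) + C * (L * W)) ≤ L * (2 * (c * W) + C * (L * W)) :=
            mul_le_mul_of_nonneg_right hPL (by positivity)
        _ = 2 * c * (L * W) + C * (L ^ 2 * W) := by ring
        _ ≤ _ := by linarith [mul_le_mul_of_nonneg_left hLLW (by positivity : 0 ≤ 2 * c)]
    have h2 := mul_le_mul_of_nonneg_left (hLW.trans hLLW) hc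
    have h3 := mul_le_mul_of_nonneg_left hLLW hC
    linarith
  rw [eigenCost]
  linarith

/-- A power of two between `2 n` and `4 n`, and the resulting bound on the cost. -/
theorem exists_eigenCost_le {C c ω : ℝ} (hω : 2 ≤ ω) (hc : 0 ≤ c) (hC : 0 ≤ C) {n s : ℕ}
    (hn : 0 < n) (hs : s ≤ n) : ∃ P : ℕ, 2 * n ≤ 2 ^ P ∧
      eigenCost C c ω P n s ≤ ((16 + 10 * c + 4 * C) * (25 * 4 ^ ω)) *
        ((n : ℝ) ^ ω * Real.log ((n : ℝ) + 2) ^ 2) := by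
  refine ⟨Nat.clog 2 (2 * n), Nat.le_pow_clog (by norm_num) _, ?_⟩
  set P := Nat.clog 2 (2 * n) with hP
  have hle : 2 * n ≤ 2 ^ P := Nat.le_pow_clog (by norm_num) _
  have hP0 : 0 < P := Nat.clog_pos (by norm_num) (by omega)
  have hlt : 2 ^ (P - 1) < 2 * n := Nat.pow_pred_clog_lt_self (by norm_num) (by omega)
  have hlt' : (2 : ℝ) ^ P ≤ 4 * n := by
    have : 2 ^ P ≤ 4 * n := by
      have : 2 ^ P = 2 * 2 ^ (P - 1) := by rw [← pow_succ']; congr 1; omega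
      omega
    exact_mod_cast this
  have hn1 : (1 : ℝ) ≤ n := by exact_mod_cast hn
  have hpow : ((2 : ℝ) ^ P) ^ ω ≤ 4 ^ ω * (n : ℝ) ^ ω := by
    rw [← Real.mul_rpow (by norm_num) (by linarith)]
    exact Real.rpow_le_rpow (by positivity) hlt' (by linarith)
  have hlog0 : 0 ≤ Real.log ((n : ℝ) + 2) := Real.log_nonneg (by linarith)
  have hlog : (P : ℝ) + 1 ≤ 5 * Real.log ((n : ℝ) + 2) := by
    -- Since `2 ^ P ≤ 4 n`, the left side is at most `8 n`. With `log 2 > 3/5`, taking logarithms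
    -- gives the factor `5`.
    have h1 : (2 : ℝ) ^ (P + 1) ≤ ((n : ℝ) + 2) ^ 3 := by
      rw [pow_succ]
      nlinarith [sq_nonneg (n : ℝ), pow_nonneg (by linarith : (0 : ℝ) ≤ n) 3]
    have h2 := Real.log_le_log (by positivity) h1
    rw [Real.log_pow, Real.log_pow] at h2
    push_cast at h2
    have h3 := Real.log_two_gt_d9
    have hP1 : (0 : ℝ) ≤ (P : ℝ) + 1 := by positivity
    nlinarith
  refine (eigenCost_le hω hc hC (by omega) hs).trans ?_
  have hsq : ((P : ℝ) + 1) ^ 2 ≤ 25 * Real.log ((n : ℝ) + 2) ^ 2 := by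
    calc ((P : ℝ) + 1) ^ 2 ≤ (5 * Real.log ((n : ℝ) + 2)) ^ 2 :=
          pow_le_pow_left₀ (by positivity) hlog 2
      _ = _ := by ring
  rw [mul_assoc]
  refine mul_le_mul_of_nonneg_left ?_ (by positivity)
  calc ((P : ℝ) + 1) ^ 2 * ((2 : ℝ) ^ P) ^ ω
      ≤ (25 * Real.log ((n : ℝ) + 2) ^ 2) * (4 ^ ω * (n : ℝ) ^ ω) :=
        mul_le_mul hsq hpow (by positivity) (by positivity)
    _ = _ := by ring

end Bounds

/-! ### Computation trees for the optimal precisions -/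

section Compile

variable {K : Type*} [Field K] {n s : ℕ} {S : Set (Matrix (Fin n) (Fin n) ℤ)}

/-- The inputs: a matrix, the precisions on its entries, and eigenvalues. -/
abbrev EigenInput (K : Type*) (n s : ℕ) : Type _ :=
  Matrix (Fin n) (Fin n) K × Matrix (Fin n) (Fin n) ℤ × (Fin s → K)

/-- The registers for elements of `K`, as functions of the input. -/
def inputReg (K : Type*) [Field K] (n s : ℕ) :
    ((Fin n × Fin n) ⊕ Fin s) ⊕ ℕ → EigenInput K n s → K := fun i x =>
  Sum.elim (Sum.elim (fun p : Fin n × Fin n => x.1 p.1 p.2) x.2.2) (fun _ => 0) i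

/-- The registers for integers, as functions of the input. -/
def inputIntReg (K : Type*) (n s : ℕ) : (Fin n × Fin n) ⊕ ℕ → EigenInput K n s → ℤ := fun i x =>
  Sum.elim (fun p : Fin n × Fin n => x.2.1 p.1 p.2) (fun _ => 0) i

/-- The knowledge at the beginning of the computation, with one work register in use. -/
def inputKnow (K : Type*) [Field K] (n s : ℕ) (S : Set (Matrix (Fin n) (Fin n) ℤ)) :
    Know (EigenInput K n s) K where
  dom := {x | x.2.1 ∈ S ∧ Function.Injective x.2.2 ∧ ∀ k, IsSimpleEigenvalue x.1 (x.2.2 k)}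
  fld := inputReg K n s '' {i | InUse 1 i}
  int := inputIntReg K n s '' {i | InUse 1 i}

theorem inputKnow_zero : (inputKnow K n s S).Knows fun _ => 0 :=
  ⟨inputReg K n s (.inr 0), ⟨.inr 0, fun k hk => by cases hk; exact Nat.one_pos, rfl⟩, fun _ _ => rfl⟩

theorem inputKnow_mat : (inputKnow K n s S).KnowsMat fun x => x.1 := fun i j =>
  ⟨inputReg K n s (.inl (.inl (i, j))), ⟨.inl (.inl (i, j)), fun k hk => by simp at hk, rfl⟩, fun _ _ => rfl⟩

theorem inputKnow_eigenvalue (k : Fin s) : (inputKnow K n s S).Knows fun x => x.2.2 k :=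
  ⟨inputReg K n s (.inl (.inr k)), ⟨.inl (.inr k), fun k hk => by simp at hk, rfl⟩, fun _ _ => rfl⟩

theorem inputKnow_prec (i j : Fin n) : (inputKnow K n s S).KnowsInt fun x => x.2.1 i j :=
  ⟨inputIntReg K n s (.inl (i, j)), ⟨.inl (i, j), fun k hk => by simp at hk, rfl⟩, fun _ _ => rfl⟩

variable [Valued K ℤᵐ⁰]

/-- The formula for short forms needs no computation of its own: it has the same value as
`eigenPrec`, whatever the short form. -/
theorem eigenPrecComputable_of_learns {f z : ℝ}
    (h : Learns (fun τ => ∀ k, τ.KnowsTop fun x : EigenInput K n s =>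
      eigenPrec x.1 x.2.1 (x.2.2 k)) (inputKnow K n s S) f z) :
    EigenPrecComputable K n s S f z := by
  classical
  have h' : Learns (fun τ => ∀ k, ∃ g ∈ τ.int, ∀ x ∈ τ.dom,
      ((g x : ℤ) : WithTop ℤ) = eigenPrec x.1 x.2.1 (x.2.2 k)) (inputKnow K n s S) f z := by
    refine h.imp fun τ hτ hQ k => ?_
    rcases hQ k with htop | ⟨g, ⟨g', hg', hgg⟩, hg⟩
    -- The precision is finite on every admissible input, so none is left in this branch and any
    -- register may be returned.
    · refine ⟨inputIntReg K n s (.inr 0), hτ.2.2 ⟨_, fun k hk => ?_, rfl⟩, fun x hx => ?_⟩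
      · cases hk
        exact Nat.one_pos
      · exact absurd (htop x hx) (((hτ.1 hx).2.2 k).eigenPrec_ne_top _)
    · exact ⟨g', hg', fun x hx => by rw [hgg x hx]; exact (hg x hx).symm⟩
  choose a ha using fun (g : EigenInput K n s → K) (hg : g ∈ (inputKnow K n s S).fld) => hg
  choose b hb using fun (g : EigenInput K n s → ℤ) (hg : g ∈ (inputKnow K n s S).int) => hg
  obtain ⟨T, hT⟩ := Learns.compile
    (fun (x : EigenInput K n s) k (m : ℤ) => (m : WithTop ℤ) = eigenPrec x.1 x.2.1 (x.2.2 k))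
    h' (fun τ hQ => hQ) 1 1
    (fun g => if hg : g ∈ (inputKnow K n s S).fld then a g hg else .inr 0)
    (fun g => if hg : g ∈ (inputKnow K n s S).int then b g hg else .inr 0)
    (fun g hg => by rw [dif_pos hg]; exact (ha g hg).1)
    (fun g hg => by rw [dif_pos hg]; exact (hb g hg).1)
  refine ⟨T, fun M N lam hN hinj hlam => ?_⟩
  obtain ⟨h1, h2⟩ := hT (M, N, lam) ⟨hN, hinj, hlam⟩ (fun i => inputReg K n s i (M, N, lam))
    (fun i => inputIntReg K n s i (M, N, lam))
    (fun g hg => by rw [dif_pos hg]; exact congrFun (ha g hg).2 _)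
    (fun g hg => by rw [dif_pos hg]; exact congrFun (hb g hg).2 _)
  exact ⟨fun k => ⟨h1 k, fun α P Q hs => by rw [hs.shortPrec_eq (hlam k)]; exact h1 k⟩, h2⟩

/-- The trivial cases: no eigenvalue is asked for, or there are too many of them. -/
theorem learns_of_trivial {f z : ℝ}
    {R : Fin s → Know (EigenInput K n s) K → Prop} (h : n = 0 ∨ n < s) (hf : 0 ≤ f) (hz : 0 ≤ z) :
    Learns (fun τ => ∀ k, R k τ) (inputKnow K n s S) f z := by
  rcases Nat.eq_zero_or_pos s with rfl | hs
  · exact .done hf hz fun k => k.elim0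
  · refine .empty (Set.eq_empty_of_forall_notMem fun x hx => ?_)
    have := card_le_of_isSimpleEigenvalue hx.2.1 hx.2.2
    omega

end Compile

/-- The optimal precisions can be computed in `O~(n ^ ω)` operations in `K`. -/
theorem exists_eigenPrecComputable {K : Type*} [Field K] [Valued K ℤᵐ⁰] {c ω : ℝ} (hω : 2 ≤ ω)
    (hc : 0 ≤ c) (hmul : ∀ n s : ℕ, HasMul (EigenInput K n s) K c ω) : ∃ a : ℝ, ∀ n s : ℕ,
      EigenPrecComputable K n s Set.univ (a * ((n : ℝ) ^ ω * Real.log ((n : ℝ) + 2) ^ 2))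
        (a * ((n : ℝ) ^ 2 * (s : ℝ))) ∧
      EigenPrecComputable K n s {N | ∃ a : ℤ, ∀ i j, N i j = a}
        (a * ((n : ℝ) ^ ω * Real.log ((n : ℝ) + 2) ^ 2)) (a * ((n : ℝ) * (s : ℝ))) := by
  set C : ℝ := 2 * (c + 1) + 1 with hCdef
  have hC : 2 * (c + 1) ≤ C := by linarith
  have hC3 : 3 ≤ C := by linarith
  have h4 : (1 : ℝ) ≤ 4 ^ ω := Real.one_le_rpow (by norm_num) (by linarith)
  set a : ℝ := (16 + 10 * c + 4 * C) * (25 * 4 ^ ω) with ha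
  have ha8 : 8 ≤ a := by rw [ha]; nlinarith
  refine ⟨a, fun n s => ?_⟩
  have hlog : 0 ≤ Real.log ((n : ℝ) + 2) :=
    Real.log_nonneg (by linarith [(Nat.cast_nonneg n : (0 : ℝ) ≤ n)])
  -- Distinct simple eigenvalues number at most `n`. These cases are set aside because the algorithm
  -- assumes `0 < n` and `s ≤ 2 ^ P`.
  by_cases htriv : n = 0 ∨ n < s
  · exact ⟨eigenPrecComputable_of_learns (learns_of_trivial htriv (by positivity) (by positivity)),
      eigenPrecComputable_of_learns (learns_of_trivial htriv (by positivity) (by positivity))⟩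
  have hn : 0 < n := by omega
  have hs : s ≤ n := by omega
  obtain ⟨P, hP, hcost⟩ := exists_eigenCost_le hω hc (by linarith : 0 ≤ C) hn hs
  refine ⟨eigenPrecComputable_of_learns ((learns_eigenPrec hω hc hC hC3 (hmul n s) hn hP (by omega)
    (fun x => x.1) (fun x => x.2.1) (fun x => x.2.2) inputKnow_zero inputKnow_mat inputKnow_prec
    inputKnow_eigenvalue fun x hx => hx.2.2).le_cost hcost ?_),
    eigenPrecComputable_of_learns ((learns_eigenPrec_const hω hc hC hC3 (hmul n s) hn hP (by omega)
    (fun x => x.1) (fun x => x.2.1) (fun x => x.2.2) inputKnow_zero inputKnow_mat inputKnow_prec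
    inputKnow_eigenvalue (fun x hx => hx.2.2) fun x hx => hx.1).le_cost hcost ?_)⟩
  · exact mul_le_mul_of_nonneg_right (by linarith) (by positivity)
  · exact mul_le_mul_of_nonneg_right ha8 (by positivity)

end PadicEigen

end

/-- `K` is a complete discrete valuation field, and `ω` an exponent of matrix multiplication. Every
matrix with a cyclic vector has a short form; the optimal precisions on `s` simple eigenvalues can
be computed in `O~(n ^ ω)` operations in `K` and `O(n² s)` operations on integers, and `O(n s)`
operations on integers if the precisions on the entries are all equal. -/
theorem proposition5p6 (K : Type*) [Field K] [Valued K (WithZero (Multiplicative ℤ))]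
    [CompleteSpace K]
    (hv : Function.Surjective (Valued.v : K → WithZero (Multiplicative ℤ)))
    (ω : ℝ) (hω : PadicEigen.MatMulExponent K ω) :
    (∀ (n : ℕ) (M : Matrix (Fin n) (Fin n) K), PadicEigen.HasCyclicVector M →
      ∃ (α : Polynomial K) (P Q : Matrix (Fin n) (Fin n) K), PadicEigen.IsShortForm M α P Q) ∧
    (∃ (c : ℝ) (d : ℕ), ∀ n s : ℕ,
      PadicEigen.EigenPrecComputable K n s Set.univ
        (c * ((n : ℝ) ^ ω * Real.log ((n : ℝ) + 2) ^ d)) (c * ((n : ℝ) ^ 2 * (s : ℝ)))) ∧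
    (∃ (c : ℝ) (d : ℕ), ∀ n s : ℕ,
      PadicEigen.EigenPrecComputable K n s {N | ∃ a : ℤ, ∀ i j, N i j = a}
        (c * ((n : ℝ) ^ ω * Real.log ((n : ℝ) + 2) ^ d)) (c * ((n : ℝ) * (s : ℝ)))) := by
  obtain ⟨c, hc, hmul⟩ := hω.hasMul
  obtain ⟨a, ha⟩ := PadicEigen.exists_eigenPrecComputable (hω.two_le hv) hc fun n s =>
    hmul (PadicEigen.EigenInput K n s)
  exact ⟨fun n M hM => hM.exists_isShortForm, ⟨a, 2, fun n s => (ha n s).1⟩,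
    ⟨a, 2, fun n s => (ha n s).2⟩⟩
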